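/- Let $N\ge 1$ be an integer and $Q=2N+2$, let $0<\lambda<Q$, and put $Q^*_\lambda=\frac{2Q-\lambda}{Q-2}$. On the Heisenberg group $\mathbb{H}^N=\mathbb{R}^N\times\mathbb{R}^N\times\mathbb{R}$ with group law $$(x,y,t)\cdot(x',y',t')=\bigl(x+x',\,y+y',\,t+t'+2(\langle x',y\rangle-\langle x,y'\rangle)\bigr)$$ consider the left-invariant vector fields $X_j=\partial_{x_j}+2y_j\partial_t$, $Y_j=\partial_{y_j}-2x_j\partial_t$ ($1\le j\le N$), the Kohn Laplacian $\Delta_{\mathbb{H}}=\sum_{j=1}^N (X_j^2+Y_j^2)$ and the homogeneous norm $|(x,y,t)|=(t^2+(|x|^2+|y|^2)^2)^{1/4}$. For a bounded domain $\Omega\subset\mathbb{H}^N$, let $\Gamma^2(\overline\Omega)$ be the space of all continuous functions $u:\overline\Omega\to\mathbb{R}$ such that $X_ju$, $Y_ju$, $X_j^2u$, $Y_j^2u$ (derivatives along the integral curves of the fields) exist and are continuous in $\Omega$ and extend continuously to $\overline\Omega$, for all $j$. **Theorem.** Let $a<0$, and let $\Omega\subset\mathbb{H}^N$ be a bounded domain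 with $C^2$ boundary that is strictly star-shaped with respect to the origin, that is, $X\cdot\nu>0$ at every point of $\partial\Omega$, where $\nu$ is the Euclidean outer unit normal and $X=\sum_{j=1}^N(x_j\partial_{x_j}+y_j\partial_{y_j})+2t\,\partial_t$ is the generator of the dilations $(x,y,t)\mapsto(\theta x,\theta y,\theta^2t)$. If $u\in\Gamma^2(\overline\Omega)$ satisfies $$-\Delta_{\mathbb{H}}u(\xi)=a\,u(\xi)+\left(\int_\Omega\frac{|u(\eta)|^{Q^*_\lambda}}{|\eta^{-1}\xi|^{\lambda}}\,d\eta\right)|u(\xi)|^{Q^*_\lambda-2}u(\xi)\quad\text{for all }\xi\in\Omega,\qquad u=0\ \text{ on }\partial\Omega,$$ then $u=0$ on $\overline\Omega$. (Here $|s|^{Q^*_\lambda-2}s$ is read as $0$ for $s=0$.) -/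

import Mathlib

open MeasureTheory

namespace HeisChoquard

/-- The underlying space `ℝ^N × ℝ^N × ℝ` of the Heisenberg group `ℍ^N`, with its Euclidean
structure and its Lebesgue measure. -/
abbrev Heis (N : ℕ) : Type := EuclideanSpace ℝ (Fin N ⊕ Fin N ⊕ Unit)

variable {N : ℕ}

/-- The coordinates `x_j` of `ξ = (x, y, t)`. -/
def xc (ξ : Heis N) (j : Fin N) : ℝ := ξ (Sum.inl j)

/-- The coordinates `y_j` of `ξ = (x, y, t)`. -/
def yc (ξ : Heis N) (j : Fin N) : ℝ := ξ (Sum.inr (Sum.inl j))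

/-- The coordinate `t` of `ξ = (x, y, t)`. -/
def tc (ξ : Heis N) : ℝ := ξ (Sum.inr (Sum.inr ()))

/-- The point (or vector) `(x, y, t)`. -/
noncomputable def mk (x y : Fin N → ℝ) (t : ℝ) : Heis N :=
  WithLp.toLp 2 (Sum.elim x (Sum.elim y fun _ => t))

/-- The group law
`(x, y, t) · (x', y', t') = (x + x', y + y', t + t' + 2 (⟨x', y⟩ - ⟨x, y'⟩))`. -/
noncomputable def hmul (ξ η : Heis N) : Heis N :=
  mk (fun j => xc ξ j + xc η j) (fun j => yc ξ j + yc η j)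
    (tc ξ + tc η + 2 * (∑ j, xc η j * yc ξ j - ∑ j, xc ξ j * yc η j))

/-- The group inverse `(x, y, t)⁻¹ = (-x, -y, -t)`. -/
noncomputable def hinv (ξ : Heis N) : Heis N :=
  mk (fun j => -xc ξ j) (fun j => -yc ξ j) (-tc ξ)

/-- The homogeneous norm `|(x, y, t)| = (t² + (|x|² + |y|²)²)^(1/4)`. -/
noncomputable def hnorm (ξ : Heis N) : ℝ :=
  (tc ξ ^ 2 + (∑ j, (xc ξ j ^ 2 + yc ξ j ^ 2)) ^ 2) ^ (1 / 4 : ℝ)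

/-- The left-invariant vector field `X_j = ∂/∂x_j + 2 y_j ∂/∂t`. -/
noncomputable def fieldX (j : Fin N) (ξ : Heis N) : Heis N :=
  mk (Pi.single j 1) 0 (2 * yc ξ j)

/-- The left-invariant vector field `Y_j = ∂/∂y_j - 2 x_j ∂/∂t`. -/
noncomputable def fieldY (j : Fin N) (ξ : Heis N) : Heis N :=
  mk 0 (Pi.single j 1) (-(2 * xc ξ j))

/-- `X_j` is the left-invariant field that equals `∂/∂x_j` at the identity. Its integral curve
through `ξ` is the straight line `s ↦ ξ + s X_j(ξ)`. -/
theorem hmul_curveX (j : Fin N) (ξ : Heis N) (s : ℝ) :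
    hmul ξ (mk (Pi.single j s) 0 0) = ξ + s • fieldX j ξ := by
  ext i
  rcases i with i | i | i
  · by_cases h : i = j
    · subst h; simp [hmul, mk, fieldX, xc]
    · simp [hmul, mk, fieldX, xc, h]
  · simp [hmul, mk, fieldX, yc]
  · simp [hmul, mk, fieldX, xc, yc, tc, Pi.single_apply]
    ring

/-- `Y_j` is the left-invariant field that equals `∂/∂y_j` at the identity. Its integral curve
through `ξ` is the straight line `s ↦ ξ + s Y_j(ξ)`. -/
theorem hmul_curveY (j : Fin N) (ξ : Heis N) (s : ℝ) :
    hmul ξ (mk 0 (Pi.single j s) 0) = ξ + s • fieldY j ξ := by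
  ext i
  rcases i with i | i | i
  · simp [hmul, mk, fieldY, xc]
  · by_cases h : i = j
    · subst h; simp [hmul, mk, fieldY, yc]
    · simp [hmul, mk, fieldY, yc, h]
  · simp [hmul, mk, fieldY, xc, yc, tc, Pi.single_apply]
    ring

/-- The generator `X = ∑_j (x_j ∂/∂x_j + y_j ∂/∂y_j) + 2 t ∂/∂t` of the dilations
`(x, y, t) ↦ (θ x, θ y, θ² t)`. -/
noncomputable def dilationField (ξ : Heis N) : Heis N :=
  mk (xc ξ) (yc ξ) (2 * tc ξ)

/-- The function `Zu`: the derivative of `u` along a vector field `Z`. For `Z = X_j, Y_j` the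
integral curve through `ξ` is `s ↦ ξ + s Z(ξ)`, so this is the derivative at `s = 0` of `u` along
that curve; no Euclidean differentiability of `u` is involved. -/
noncomputable def along (Z : Heis N → Heis N) (u : Heis N → ℝ) (ξ : Heis N) : ℝ :=
  lineDeriv ℝ u ξ (Z ξ)

/-- The Kohn Laplacian `∑_j (X_j² + Y_j²)`. -/
noncomputable def kohnLaplacian (u : Heis N → ℝ) (ξ : Heis N) : ℝ :=
  ∑ j : Fin N, (along (fieldX j) (along (fieldX j) u) ξ + along (fieldY j) (along (fieldY j) u) ξ)

/-- `g` is continuous in `Ω` and extends continuously to the closure of `Ω`. -/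
def ContinuousUpTo (Ω : Set (Heis N)) (g : Heis N → ℝ) : Prop :=
  ∃ G : Heis N → ℝ, ContinuousOn G (closure Ω) ∧ Set.EqOn G g Ω

/-- In `Ω` the derivatives `Zu` and `Z²u` exist, are continuous, and extend continuously to the
closure of `Ω`. -/
def TwiceDiffAlong (Z : Heis N → Heis N) (Ω : Set (Heis N)) (u : Heis N → ℝ) : Prop :=
  (∀ ξ ∈ Ω, LineDifferentiableAt ℝ u ξ (Z ξ)) ∧
  (∀ ξ ∈ Ω, LineDifferentiableAt ℝ (along Z u) ξ (Z ξ)) ∧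
  ContinuousUpTo Ω (along Z u) ∧
  ContinuousUpTo Ω (along Z (along Z u))

/-- The space `Γ²` of the closure of `Ω`: functions continuous on the closure for which `X_j u`,
`Y_j u`, `X_j² u`, `Y_j² u` are continuous in `Ω` and extend continuously to the closure. The
values of `u` outside the closure play no role. -/
def GammaTwo (Ω : Set (Heis N)) (u : Heis N → ℝ) : Prop :=
  ContinuousOn u (closure Ω) ∧
  ∀ j : Fin N, TwiceDiffAlong (fieldX j) Ω u ∧ TwiceDiffAlong (fieldY j) Ω u

/-- The homogeneous dimension `Q = 2N + 2`. -/
def homDim (N : ℕ) : ℝ := 2 * N + 2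

/-- The critical exponent `Q*_lam = (2Q - lam) / (Q - 2)`. -/
noncomputable def critExp (N : ℕ) (lam : ℝ) : ℝ := (2 * homDim N - lam) / (homDim N - 2)

/-- The nonlocal potential `∫_Ω |u(η)|^{Q*_lam} / |η⁻¹ ξ|^lam dη`. -/
noncomputable def choquardPotential (lam : ℝ) (Ω : Set (Heis N)) (u : Heis N → ℝ)
    (ξ : Heis N) : ℝ :=
  ∫ η in Ω, |u η| ^ critExp N lam / hnorm (hmul (hinv η) ξ) ^ lam

/-- `u` solves `-Δu = a u + (∫_Ω |u(η)|^q / |η⁻¹ ξ|^lam dη) |u|^(q-2) u` in `Ω`,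
`u = 0` on `∂Ω`, where `q = Q*_lam`. -/
def IsSolution (a lam : ℝ) (Ω : Set (Heis N)) (u : Heis N → ℝ) : Prop :=
  (∀ ξ ∈ Ω, -kohnLaplacian u ξ =
    a * u ξ + choquardPotential lam Ω u ξ * (|u ξ| ^ (critExp N lam - 2) * u ξ)) ∧
  ∀ ξ ∈ frontier Ω, u ξ = 0

/-- `ρ` is a `C²` defining function of `Ω` near `p`, negative inside `Ω`. -/
def IsDefiningFunctionAt (Ω : Set (Heis N)) (p : Heis N) (ρ : Heis N → ℝ) : Prop :=
  gradient ρ p ≠ 0 ∧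
  ∃ U : Set (Heis N), IsOpen U ∧ p ∈ U ∧ ContDiffOn ℝ 2 ρ U ∧ Ω ∩ U = {q ∈ U | ρ q < 0}

/-- The boundary of `Ω` is of class `C²`, with `Ω` locally on one side of it. -/
def HasC2Boundary (Ω : Set (Heis N)) : Prop :=
  ∀ p ∈ frontier Ω, ∃ ρ : Heis N → ℝ, IsDefiningFunctionAt Ω p ρ

/-- `ν` is the (Euclidean) outer unit normal to the boundary of `Ω` at `p`. -/
def IsOuterUnitNormal (Ω : Set (Heis N)) (p ν : Heis N) : Prop :=
  ∃ ρ : Heis N → ℝ, IsDefiningFunctionAt Ω p ρ ∧ ν = ‖gradient ρ p‖⁻¹ • gradient ρ p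

/-- `Ω` is strictly star-shaped with respect to the origin for the dilations of the Heisenberg
group: the generator of the dilations points strictly outwards at every boundary point. -/
def StrictlyStarShaped (Ω : Set (Heis N)) : Prop :=
  ∀ p ∈ frontier Ω, ∀ ν : Heis N, IsOuterUnitNormal Ω p ν → 0 < inner ℝ (dilationField p) ν

end HeisChoquard

/-! The classical Pohozaev argument multiplies the equation by `Xu`. This contains `∂_t u`, which
need not exist for a function in `Γ²`. Here the equation is tested against the dilate `u_θ = u ∘
δ_θ` with `θ > 1`, and the result is read to first order as `θ ↓ 1`. Strict star-shapedness gives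
`δ_θ ξ ∈ Ω → ξ ∈ Ω` (`StrictlyStarShaped.dil_mem`), so `u_θ`, extended by zero, vanishes off `Ω` and
is an admissible test function.

Write `A = ∫ |∇_H u|²`, `B = ∫ u²`, `C = ∫ V |u|^q`, where `V` is the potential and `q` the critical
exponent. Young's inequality and the Jacobian `θ^Q` bound the gradient term by `(1 + θ^(2-Q)) A /
2`; since `a < 0`, the linear term is at least `a (1 + θ^(-Q)) B / 2`. An upper bound for the Taylor
remainder of `|s|^q` (`rpow_remainder_le`), together with a Schur-type bound for the convolution
energy, shows that the nonlocal term is at least `C + (θ^(λ-2Q) - 1) C / (2q) - K I(θ)`, where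
`I(θ)` is the squared `L²` distance between the signed powers of exponent `q/2` of `u_θ` and `u`.
Hence a function `G` built from these powers of `θ` satisfies `G(θ) ≥ -K I(θ)`. Testing with `u`
itself gives `A = aB + C`, so `G(1) = 0`; and `q (Q - 2) = 2Q - λ` gives `G'(1) = aB`. If `I(θ) =
o(θ - 1)`, then `aB ≥ 0`, and `a < 0` forces `B = 0`.

The analytic core is `I(θ) = o(θ - 1)`. The signed power of exponent `q/2` has a square integrable
horizontal gradient, as testing against `|u|^(q-2) u` shows
(`HorizontalC2On.sqInt_spowDeriv_ne_top`). A dilation also moves points along the centre, where only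
commutators help: a central displacement `τ` is a loop of four horizontal segments of length
comparable to `√|τ|`. The squared mean increment is therefore `O(|τ|)` with a constant controlled by
the horizontal gradient, and `o(|τ|)` for continuously differentiable functions. Averaging over
small translations transfers both bounds to dilations (`dilIncr_le_of_transIncr_le`), and
approximation gives `o(θ - 1)` in general (`HorizontalC1OffZero.exists_dilIncr_le_small`).

Boundary terms never appear: every test function is first composed with the truncation `softThr`,
which makes its support a compact subset of `Ω`. -/

namespace HeisChoquard

open scoped ENNReal

variable {N : ℕ}

/-! ### Group law, horizontal flows and the commutator loop. -/

section GroupStructure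

theorem Heis.ext_coord {ξ η : Heis N} (hx : ∀ j, xc ξ j = xc η j) (hy : ∀ j, yc ξ j = yc η j)
    (ht : tc ξ = tc η) : ξ = η := by
  ext i
  rcases i with i | i | i
  · exact hx i
  · exact hy i
  · exact ht

@[simp] theorem xc_mk (x y : Fin N → ℝ) (t : ℝ) (j : Fin N) : xc (mk x y t) j = x j := rfl
@[simp] theorem yc_mk (x y : Fin N → ℝ) (t : ℝ) (j : Fin N) : yc (mk x y t) j = y j := rfl
@[simp] theorem tc_mk (x y : Fin N → ℝ) (t : ℝ) : tc (mk x y t) = t := rfl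
@[simp] theorem xc_add (ξ η : Heis N) (j : Fin N) : xc (ξ + η) j = xc ξ j + xc η j := rfl
@[simp] theorem yc_add (ξ η : Heis N) (j : Fin N) : yc (ξ + η) j = yc ξ j + yc η j := rfl
@[simp] theorem tc_add (ξ η : Heis N) : tc (ξ + η) = tc ξ + tc η := rfl
@[simp] theorem xc_smul (c : ℝ) (ξ : Heis N) (j : Fin N) : xc (c • ξ) j = c * xc ξ j := rfl
@[simp] theorem yc_smul (c : ℝ) (ξ : Heis N) (j : Fin N) : yc (c • ξ) j = c * yc ξ j := rfl
@[simp] theorem tc_smul (c : ℝ) (ξ : Heis N) : tc (c • ξ) = c * tc ξ := rfl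
@[simp] theorem xc_zero (j : Fin N) : xc (0 : Heis N) j = 0 := rfl
@[simp] theorem yc_zero (j : Fin N) : yc (0 : Heis N) j = 0 := rfl
@[simp] theorem tc_zero : tc (0 : Heis N) = 0 := rfl

@[simp] theorem xc_neg (ξ : Heis N) (j : Fin N) : xc (-ξ) j = -xc ξ j := rfl
@[simp] theorem yc_neg (ξ : Heis N) (j : Fin N) : yc (-ξ) j = -yc ξ j := rfl
@[simp] theorem tc_neg (ξ : Heis N) : tc (-ξ) = -tc ξ := rfl

@[simp] theorem xc_hmul (ξ η : Heis N) (j : Fin N) : xc (hmul ξ η) j = xc ξ j + xc η j := rfl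
@[simp] theorem yc_hmul (ξ η : Heis N) (j : Fin N) : yc (hmul ξ η) j = yc ξ j + yc η j := rfl
theorem tc_hmul (ξ η : Heis N) :
    tc (hmul ξ η) = tc ξ + tc η + 2 * (∑ j, xc η j * yc ξ j - ∑ j, xc ξ j * yc η j) := rfl
@[simp] theorem xc_hinv (ξ : Heis N) (j : Fin N) : xc (hinv ξ) j = -xc ξ j := rfl
@[simp] theorem yc_hinv (ξ : Heis N) (j : Fin N) : yc (hinv ξ) j = -yc ξ j := rfl
@[simp] theorem tc_hinv (ξ : Heis N) : tc (hinv ξ) = -tc ξ := rfl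

theorem hinv_eq_neg (ξ : Heis N) : hinv ξ = -ξ :=
  Heis.ext_coord (fun _ => rfl) (fun _ => rfl) rfl

theorem hmul_assoc (ξ η ζ : Heis N) : hmul (hmul ξ η) ζ = hmul ξ (hmul η ζ) := by
  apply Heis.ext_coord
  · intro j; simp [add_assoc]
  · intro j; simp [add_assoc]
  · simp only [tc_hmul, xc_hmul, yc_hmul, mul_add, add_mul, Finset.sum_add_distrib]
    ring

@[simp] theorem hmul_zero (ξ : Heis N) : hmul ξ 0 = ξ := by
  apply Heis.ext_coord <;> simp [tc_hmul]

@[simp] theorem zero_hmul (ξ : Heis N) : hmul 0 ξ = ξ := by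
  apply Heis.ext_coord <;> simp [tc_hmul]

@[simp] theorem hinv_hmul_self (ξ : Heis N) : hmul (hinv ξ) ξ = 0 := by
  apply Heis.ext_coord <;> simp [tc_hmul]

@[simp] theorem hmul_hinv_self (ξ : Heis N) : hmul ξ (hinv ξ) = 0 := by
  apply Heis.ext_coord <;> simp [tc_hmul]

@[simp] theorem hinv_hmul_cancel (ξ η : Heis N) : hmul (hinv ξ) (hmul ξ η) = η := by
  rw [← hmul_assoc]; simp

@[simp] theorem hmul_hinv_cancel (ξ η : Heis N) : hmul ξ (hmul (hinv ξ) η) = η := by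
  rw [← hmul_assoc]; simp

@[simp] theorem hmul_cancel_hinv (ξ η : Heis N) : hmul (hmul ξ η) (hinv η) = ξ := by
  rw [hmul_assoc]; simp

@[simp] theorem hinv_hinv (ξ : Heis N) : hinv (hinv ξ) = ξ := by simp [hinv_eq_neg]

theorem hinv_hmul (ξ η : Heis N) : hinv (hmul ξ η) = hmul (hinv η) (hinv ξ) := by
  apply Heis.ext_coord
  · intro j; simp [add_comm]
  · intro j; simp [add_comm]
  · simp only [tc_hmul, xc_hinv, yc_hinv, tc_hinv, neg_mul, mul_neg, Finset.sum_neg_distrib]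
    ring_nf

/-- The horizontal directions: one for each `X_j` and one for each `Y_j`. -/
abbrev HDir (N : ℕ) : Type := Fin N ⊕ Fin N

/-- The horizontal left-invariant fields `X_j`, `Y_j`, as one family. -/
noncomputable def hField (i : HDir N) : Heis N → Heis N := Sum.elim fieldX fieldY i

/-- The horizontal unit vectors at the identity. -/
noncomputable def hVec (i : HDir N) : Heis N :=
  Sum.elim (fun j => mk (Pi.single j 1) 0 0) (fun j => mk 0 (Pi.single j 1) 0) i

theorem hmul_smul_hVec (i : HDir N) (ξ : Heis N) (s : ℝ) :
    hmul ξ (s • hVec i) = ξ + s • hField i ξ := by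
  rcases i with j | j
  · refine Eq.trans ?_ (hmul_curveX j ξ s)
    congr 1
    apply Heis.ext_coord
    · intro k; simp [hVec, Pi.single_apply]
    · intro k; simp [hVec]
    · simp [hVec]
  · refine Eq.trans ?_ (hmul_curveY j ξ s)
    congr 1
    apply Heis.ext_coord
    · intro k; simp [hVec]
    · intro k; simp [hVec, Pi.single_apply]
    · simp [hVec]

theorem smul_hVec_hmul (i : HDir N) (r s : ℝ) :
    hmul (r • hVec i) (s • hVec i) = (r + s) • hVec i := by
  rcases i with j | j
  · apply Heis.ext_coord
    · intro k; simp [hVec, add_mul]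
    · intro k; simp [hVec]
    · simp [hVec, tc_hmul]
  · apply Heis.ext_coord
    · intro k; simp [hVec]
    · intro k; simp [hVec, add_mul]
    · simp [hVec, tc_hmul]

theorem hmul_smul_hVec_add (i : HDir N) (ξ : Heis N) (r s : ℝ) :
    hmul ξ ((r + s) • hVec i) = hmul (hmul ξ (r • hVec i)) (s • hVec i) := by
  rw [hmul_assoc, smul_hVec_hmul]

/-- The central vector `(0, 0, 1)`. -/
noncomputable def tVec : Heis N := mk 0 0 1

/-- The commutator of the flows of `X_j` and `Y_j` moves along the centre. -/
theorem commutator_loop (j : Fin N) (h : ℝ) :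
    hmul (hmul (hmul (h • hVec (Sum.inl j)) (h • hVec (Sum.inr j))) ((-h) • hVec (Sum.inl j)))
      ((-h) • hVec (Sum.inr j)) = (-(4 * h ^ 2)) • (tVec : Heis N) := by
  apply Heis.ext_coord
  · intro k; simp [hVec, tVec]
  · intro k; simp [hVec, tVec]
  · simp [hVec, tVec, tc_hmul, Pi.single_apply]
    ring

end GroupStructure

/-! ### Continuity of the group operations. -/

section Continuity

@[fun_prop] theorem continuous_xc (j : Fin N) : Continuous fun ξ : Heis N => xc ξ j := by
  unfold xc; fun_prop

@[fun_prop] theorem continuous_yc (j : Fin N) : Continuous fun ξ : Heis N => yc ξ j := by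
  unfold yc; fun_prop

@[fun_prop] theorem continuous_tc : Continuous fun ξ : Heis N => tc ξ := by
  unfold tc; fun_prop

theorem continuous_mk {α : Type*} [TopologicalSpace α] {x y : α → Fin N → ℝ} {t : α → ℝ}
    (hx : ∀ j, Continuous fun a => x a j) (hy : ∀ j, Continuous fun a => y a j)
    (ht : Continuous t) : Continuous fun a => (mk (x a) (y a) (t a) : Heis N) := by
  unfold mk
  refine (PiLp.continuous_toLp 2 _).comp (continuous_pi ?_)
  rintro (i | i | i)
  · exact hx i
  · exact hy i
  · exact ht

@[fun_prop] theorem Continuous.hmul {α : Type*} [TopologicalSpace α] {f g : α → Heis N}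
    (hf : Continuous f) (hg : Continuous g) :
    Continuous fun a => HeisChoquard.hmul (f a) (g a) := by
  have hfx := fun j => (continuous_xc j).comp hf
  have hfy := fun j => (continuous_yc j).comp hf
  have hft := continuous_tc.comp hf
  have hgx := fun j => (continuous_xc j).comp hg
  have hgy := fun j => (continuous_yc j).comp hg
  have hgt := continuous_tc.comp hg
  simp only [Function.comp_def] at hfx hfy hft hgx hgy hgt
  apply continuous_mk
  · intro j; exact (hfx j).add (hgx j)
  · intro j; exact (hfy j).add (hgy j)
  · fun_prop

@[fun_prop] theorem Continuous.hinv {α : Type*} [TopologicalSpace α] {f : α → Heis N}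
    (hf : Continuous f) : Continuous fun a => HeisChoquard.hinv (f a) := by
  simp only [hinv_eq_neg]; fun_prop

end Continuity

/-! ### Euclidean norm estimates for the group law. -/

section Norms

theorem abs_xc_le (ξ : Heis N) (j : Fin N) : |xc ξ j| ≤ ‖ξ‖ := PiLp.norm_apply_le ξ _
theorem abs_yc_le (ξ : Heis N) (j : Fin N) : |yc ξ j| ≤ ‖ξ‖ := PiLp.norm_apply_le ξ _
theorem abs_tc_le (ξ : Heis N) : |tc ξ| ≤ ‖ξ‖ := PiLp.norm_apply_le ξ _

@[simp] theorem norm_tVec : ‖(tVec : Heis N)‖ = 1 := by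
  simp [tVec, mk, EuclideanSpace.norm_eq, Fintype.sum_sum_type]

@[simp] theorem norm_hVec (i : HDir N) : ‖hVec i‖ = 1 := by
  rcases i with j | j <;>
    simp [hVec, mk, EuclideanSpace.norm_eq, Fintype.sum_sum_type, Pi.single_apply]

theorem norm_sq_eq (ξ : Heis N) :
    ‖ξ‖ ^ 2 = ∑ j, xc ξ j ^ 2 + (∑ j, yc ξ j ^ 2 + tc ξ ^ 2) := by
  simp [EuclideanSpace.norm_sq_eq, Fintype.sum_sum_type, xc, yc, tc]

/-- The bracket term of the group law. -/
noncomputable def bracket (ξ η : Heis N) : ℝ :=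
  ∑ j, xc η j * yc ξ j - ∑ j, xc ξ j * yc η j

theorem hmul_eq (ξ η : Heis N) : hmul ξ η = ξ + η + (2 * bracket ξ η) • tVec := by
  apply Heis.ext_coord
  · intro j; simp [tVec]
  · intro j; simp [tVec]
  · simp [tVec, tc_hmul, bracket]

theorem abs_bracket_le (ξ η : Heis N) : |bracket ξ η| ≤ ‖ξ‖ * ‖η‖ := by
  have h1 : bracket ξ η = inner ℝ ξ (mk (fun j => -yc η j) (xc η) 0) := by
    simp [bracket, mk, xc, yc, PiLp.inner_apply, Fintype.sum_sum_type, sub_eq_add_neg, mul_comm]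
    exact add_comm _ _
  have h2 : ‖mk (fun j => -yc η j) (xc η) 0‖ ≤ ‖η‖ := by
    apply le_of_sq_le_sq _ (norm_nonneg _)
    rw [norm_sq_eq, norm_sq_eq]
    simp
    nlinarith [sq_nonneg (tc η)]
  rw [h1]
  exact (abs_real_inner_le_norm _ _).trans (by gcongr)

theorem norm_hmul_le (ξ η : Heis N) : ‖hmul ξ η‖ ≤ ‖ξ‖ + ‖η‖ + 2 * (‖ξ‖ * ‖η‖) := by
  rw [hmul_eq]
  refine (norm_add_le _ _).trans (add_le_add (norm_add_le _ _) ?_)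
  rw [norm_smul, norm_tVec, mul_one, Real.norm_eq_abs, abs_mul, abs_two]
  have := abs_bracket_le ξ η
  linarith

@[simp] theorem norm_hinv (ξ : Heis N) : ‖hinv ξ‖ = ‖ξ‖ := by rw [hinv_eq_neg, norm_neg]

end Norms

/-! ### Invariance of Lebesgue measure under translations. -/

section MeasurePreservation

/-- `bracket` as a linear functional of its first argument. -/
noncomputable def bracketLin (η : Heis N) : Module.Dual ℝ (Heis N) where
  toFun ξ := 2 * bracket ξ η
  map_add' a b := by
    simp only [bracket, xc_add, yc_add, mul_add, add_mul, Finset.sum_add_distrib]; ring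
  map_smul' c a := by
    simp only [bracket, xc_smul, yc_smul, smul_eq_mul, RingHom.id_apply, mul_left_comm _ c,
      mul_assoc c, ← Finset.mul_sum]
    ring

theorem bracketLin_tVec (η : Heis N) : bracketLin η tVec = 0 := by
  simp [bracketLin, bracket, tVec]

/-- Up to a Euclidean translation, right multiplication is a shear in the central direction. The
functional defining it does not see that direction, so the determinant is 1. -/
theorem measurePreserving_transvection (η : Heis N) :
    MeasurePreserving (LinearMap.transvection (bracketLin η) tVec) := by
  have hd : LinearMap.det (LinearMap.transvection (bracketLin η) tVec) = 1 := by
    rw [LinearMap.transvection.det, bracketLin_tVec, add_zero]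
  refine ⟨(LinearMap.continuous_of_finiteDimensional _).measurable, ?_⟩
  rw [Measure.map_linearMap_addHaar_eq_smul_addHaar _ (by rw [hd]; norm_num), hd]
  simp

theorem measurePreserving_hmul_right (η : Heis N) :
    MeasurePreserving fun ξ : Heis N => hmul ξ η := by
  have h : (fun ξ : Heis N => hmul ξ η) =
      (fun ξ => ξ + η) ∘ LinearMap.transvection (bracketLin η) tVec := by
    funext ξ
    simp only [hmul_eq, Function.comp, LinearMap.transvection.apply, bracketLin,
      LinearMap.coe_mk, AddHom.coe_mk]
    abel
  rw [h]
  exact (measurePreserving_add_right _ η).comp (measurePreserving_transvection η)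

theorem measurePreserving_hinv : MeasurePreserving (hinv : Heis N → Heis N) := by
  have h : (hinv : Heis N → Heis N) = Neg.neg := funext hinv_eq_neg
  rw [h]
  exact Measure.measurePreserving_neg _

theorem measurePreserving_hmul_left (η : Heis N) :
    MeasurePreserving fun ξ : Heis N => hmul η ξ := by
  have h : (fun ξ : Heis N => hmul η ξ) = hinv ∘ (fun ξ => hmul ξ (hinv η)) ∘ hinv := by
    funext ξ
    simp [hinv_hmul]
  rw [h]
  exact measurePreserving_hinv.comp
    ((measurePreserving_hmul_right _).comp measurePreserving_hinv)

/-- Right translation as a homeomorphism. -/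
noncomputable def hmulRightHomeo (η : Heis N) : Heis N ≃ₜ Heis N where
  toFun ξ := hmul ξ η
  invFun ξ := hmul ξ (hinv η)
  left_inv ξ := by simp
  right_inv ξ := by simp [hmul_assoc]
  continuous_toFun := by fun_prop
  continuous_invFun := by fun_prop

/-- Left translation as a homeomorphism. -/
noncomputable def hmulLeftHomeo (η : Heis N) : Heis N ≃ₜ Heis N where
  toFun ξ := hmul η ξ
  invFun ξ := hmul (hinv η) ξ
  left_inv ξ := by simp
  right_inv ξ := by simp
  continuous_toFun := by fun_prop
  continuous_invFun := by fun_prop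

theorem integral_hmul_right (f : Heis N → ℝ) (η : Heis N) :
    ∫ ξ, f (hmul ξ η) = ∫ ξ, f ξ :=
  (measurePreserving_hmul_right η).integral_comp (hmulRightHomeo η).measurableEmbedding f

theorem integral_hmul_left (f : Heis N → ℝ) (η : Heis N) :
    ∫ ξ, f (hmul η ξ) = ∫ ξ, f ξ :=
  (measurePreserving_hmul_left η).integral_comp (hmulLeftHomeo η).measurableEmbedding f

theorem lintegral_hmul_right (f : Heis N → ENNReal) (η : Heis N) :
    ∫⁻ ξ, f (hmul ξ η) = ∫⁻ ξ, f ξ :=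
  (measurePreserving_hmul_right η).lintegral_comp_emb (hmulRightHomeo η).measurableEmbedding f

theorem lintegral_hmul_left (f : Heis N → ENNReal) (η : Heis N) :
    ∫⁻ ξ, f (hmul η ξ) = ∫⁻ ξ, f ξ :=
  (measurePreserving_hmul_left η).lintegral_comp_emb (hmulLeftHomeo η).measurableEmbedding f

end MeasurePreservation

/-! ### Dilations and their Jacobian. -/

section Dilations

/-- The dilation `(x, y, t) ↦ (θ x, θ y, θ² t)`. -/
noncomputable def dil (θ : ℝ) (ξ : Heis N) : Heis N :=
  mk (fun j => θ * xc ξ j) (fun j => θ * yc ξ j) (θ ^ 2 * tc ξ)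

@[simp] theorem xc_dil (θ : ℝ) (ξ : Heis N) (j : Fin N) : xc (dil θ ξ) j = θ * xc ξ j := rfl
@[simp] theorem yc_dil (θ : ℝ) (ξ : Heis N) (j : Fin N) : yc (dil θ ξ) j = θ * yc ξ j := rfl
@[simp] theorem tc_dil (θ : ℝ) (ξ : Heis N) : tc (dil θ ξ) = θ ^ 2 * tc ξ := rfl

theorem dil_hmul (θ : ℝ) (ξ η : Heis N) : dil θ (hmul ξ η) = hmul (dil θ ξ) (dil θ η) := by
  apply Heis.ext_coord
  · intro j; simp [mul_add]
  · intro j; simp [mul_add]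
  · have h : ∀ a b c : ℝ, θ * a * (θ * b) = θ ^ 2 * (a * b) := fun a b _ => by ring
    simp only [tc_dil, tc_hmul, xc_dil, yc_dil, h _ _ 0, ← Finset.mul_sum]
    ring

theorem dil_hinv (θ : ℝ) (ξ : Heis N) : dil θ (hinv ξ) = hinv (dil θ ξ) := by
  apply Heis.ext_coord <;> simp

theorem dil_dil (θ σ : ℝ) (ξ : Heis N) : dil θ (dil σ ξ) = dil (θ * σ) ξ := by
  apply Heis.ext_coord
  · intro j; simp [mul_assoc]
  · intro j; simp [mul_assoc]
  · simp; ring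

@[simp] theorem dil_one (ξ : Heis N) : dil 1 ξ = ξ := by
  apply Heis.ext_coord <;> simp

theorem dil_smul_hVec (θ s : ℝ) (i : HDir N) : dil θ (s • hVec i) = (θ * s) • hVec i := by
  rcases i with j | j <;> apply Heis.ext_coord <;> simp [hVec, mul_assoc]

@[fun_prop] theorem Continuous.dil {α : Type*} [TopologicalSpace α] {g : α → ℝ} {f : α → Heis N}
    (hg : Continuous g) (hf : Continuous f) :
    Continuous fun a => HeisChoquard.dil (g a) (f a) := by
  have hfx := fun j => (continuous_xc j).comp hf
  have hfy := fun j => (continuous_yc j).comp hf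
  have hft := continuous_tc.comp hf
  simp only [Function.comp_def] at hfx hfy hft
  apply continuous_mk
  · intro j; exact hg.mul (hfx j)
  · intro j; exact hg.mul (hfy j)
  · exact (hg.pow 2).mul hft

/-- A dilation as a homeomorphism. -/
noncomputable def dilHomeo (θ : ℝ) (hθ : 0 < θ) : Heis N ≃ₜ Heis N where
  toFun := dil θ
  invFun := dil θ⁻¹
  left_inv ξ := by rw [dil_dil, inv_mul_cancel₀ hθ.ne', dil_one]
  right_inv ξ := by rw [dil_dil, mul_inv_cancel₀ hθ.ne', dil_one]
  continuous_toFun := by fun_prop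
  continuous_invFun := by fun_prop

/-- A dilation as a linear map. -/
noncomputable def dilLin (θ : ℝ) : Heis N →ₗ[ℝ] Heis N where
  toFun := dil θ
  map_add' a b := by apply Heis.ext_coord <;> simp [mul_add]
  map_smul' c a := by apply Heis.ext_coord <;> simp [mul_left_comm]

theorem det_dilLin (θ : ℝ) : LinearMap.det (dilLin (N := N) θ) = θ ^ (2 * N + 2) := by
  let b := (EuclideanSpace.basisFun (Fin N ⊕ Fin N ⊕ Unit) ℝ).toBasis
  have h : LinearMap.toMatrix b b (dilLin (N := N) θ) =
      Matrix.diagonal (Sum.elim (fun _ => θ) (Sum.elim (fun _ => θ) fun _ => θ ^ 2)) := by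
    ext i k
    rw [LinearMap.toMatrix_apply]
    rcases i with i | i | i <;> rcases k with k | k | k <;>
      simp [b, dilLin, dil, mk, xc, yc, tc, Matrix.diagonal_apply]
  rw [← LinearMap.det_toMatrix b, h, Matrix.det_diagonal]
  simp [Fintype.prod_sum_type]
  ring

theorem map_dil_volume (θ : ℝ) (hθ : 0 < θ) :
    Measure.map (dil θ) (volume : Measure (Heis N)) =
      ENNReal.ofReal ((θ ^ (2 * N + 2))⁻¹) • (volume : Measure (Heis N)) := by
  have h := Measure.map_linearMap_addHaar_eq_smul_addHaar (volume : Measure (Heis N))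
    (f := dilLin θ) (by rw [det_dilLin]; positivity)
  rw [det_dilLin, abs_of_pos (by positivity)] at h
  exact h

theorem lintegral_dil (θ : ℝ) (hθ : 0 < θ) (f : Heis N → ENNReal) :
    ∫⁻ ξ, f (dil θ ξ) = ENNReal.ofReal ((θ ^ (2 * N + 2))⁻¹) * ∫⁻ ξ, f ξ := by
  have h := (dilHomeo (N := N) θ hθ).measurableEmbedding.lintegral_map (μ := volume) f
  change ∫⁻ a, f a ∂(Measure.map (dil θ) volume) = ∫⁻ ξ, f (dil θ ξ) at h
  rw [← h, map_dil_volume θ hθ, lintegral_smul_measure, smul_eq_mul]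

theorem integral_dil (θ : ℝ) (hθ : 0 < θ) (f : Heis N → ℝ) :
    ∫ ξ, f (dil θ ξ) = (θ ^ (2 * N + 2))⁻¹ * ∫ ξ, f ξ := by
  have h := (dilHomeo (N := N) θ hθ).measurableEmbedding.integral_map (μ := volume) f
  change ∫ a, f a ∂(Measure.map (dil θ) volume) = ∫ ξ, f (dil θ ξ) at h
  rw [← h, map_dil_volume θ hθ, integral_smul_measure, smul_eq_mul,
    ENNReal.toReal_ofReal (by positivity)]

end Dilations

/-! ### Signed powers and a quadratic remainder estimate. -/

section SignedPower

/-- The signed power `|s|^(r-1) s`. -/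
noncomputable def spow (r s : ℝ) : ℝ := |s| ^ (r - 1) * s

@[simp] theorem spow_zero (r : ℝ) : spow r 0 = 0 := by simp [spow]

theorem spow_neg (r s : ℝ) : spow r (-s) = -spow r s := by simp [spow]

theorem abs_spow {r : ℝ} (hr : 0 < r) (s : ℝ) : |spow r s| = |s| ^ r := by
  rcases eq_or_ne s 0 with rfl | hs
  · simp [Real.zero_rpow hr.ne']
  · have h : 0 < |s| := abs_pos.mpr hs
    rw [spow, abs_mul, abs_of_nonneg (by positivity), ← Real.rpow_add_one h.ne']
    congr 1; ring

theorem spow_of_pos {s : ℝ} (hs : 0 < s) (r : ℝ) : spow r s = s ^ r := by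
  rw [spow, abs_of_pos hs, ← Real.rpow_add_one hs.ne']
  congr 1; ring

theorem spow_eq_zero {r : ℝ} (hr : 0 < r) {s : ℝ} : spow r s = 0 ↔ s = 0 := by
  rw [← abs_eq_zero, abs_spow hr, Real.rpow_eq_zero (abs_nonneg _) hr.ne', abs_eq_zero]

theorem spow_sub_one_mul_self {q : ℝ} (hq : 1 < q) (s : ℝ) :
    spow (q - 1) s * s = |s| ^ q := by
  rcases eq_or_ne s 0 with rfl | hs
  · simp [Real.zero_rpow (by linarith : q ≠ 0)]
  · have h : 0 < |s| := abs_pos.mpr hs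
    rw [spow, mul_assoc, ← abs_mul_abs_self s, ← mul_assoc, ← Real.rpow_add_one h.ne',
      ← Real.rpow_add_one h.ne']
    congr 1; ring

theorem sq_spow_half {q : ℝ} (hq : 0 < q) (s : ℝ) : spow (q / 2) s ^ 2 = |s| ^ q := by
  rw [← sq_abs, abs_spow (by linarith), ← Real.rpow_natCast, ← Real.rpow_mul (abs_nonneg _)]
  congr 1; push_cast; ring

theorem hasDerivAt_spow (r : ℝ) {s : ℝ} (hs : s ≠ 0) :
    HasDerivAt (spow r) (r * |s| ^ (r - 1)) s := by
  have h0 : 0 < |s| := abs_pos.mpr hs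
  have h1 : HasDerivAt (fun s : ℝ => |s| ^ (r - 1)) _ s :=
    (hasDerivAt_abs hs).rpow_const (p := r - 1) (Or.inl h0.ne')
  have h2 := h1.mul (hasDerivAt_id s)
  refine h2.congr_deriv (Eq.symm ?_)
  have h3 : (SignType.sign s : ℝ) * s = |s| := sign_mul_self s
  have h4 : |s| ^ (r - 1 - 1) * |s| = |s| ^ (r - 1) := by
    rw [← Real.rpow_add_one h0.ne']; congr 1; ring
  change _ = _ * s + |s| ^ (r - 1) * 1
  calc r * |s| ^ (r - 1) = (r - 1) * (|s| ^ (r - 1 - 1) * |s|) + |s| ^ (r - 1) := by rw [h4]; ring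
    _ = _ := by rw [← h3]; ring

theorem continuous_spow {r : ℝ} (hr : 0 < r) : Continuous (spow r) := by
  rw [continuous_iff_continuousAt]
  intro s
  rcases eq_or_ne s 0 with rfl | hs
  · rw [ContinuousAt, spow_zero, tendsto_zero_iff_abs_tendsto_zero]
    have h : Filter.Tendsto (fun s : ℝ => |s| ^ r) (nhds 0) (nhds (|(0 : ℝ)| ^ r)) :=
      ((continuous_abs.rpow_const fun _ => Or.inr hr.le).tendsto 0)
    rw [abs_zero, Real.zero_rpow hr.ne'] at h
    exact h.congr fun s => (abs_spow hr s).symm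
  · exact (hasDerivAt_spow r hs).continuousAt

/-- For `m ≥ 1` this is weaker than Bernoulli's inequality. For `m ≤ 1` the reverse Bernoulli
inequality is applied to `r^(1-m)` in `r = r^(1-m) r^m`, and the quadratic term absorbs the loss. -/
theorem one_add_mul_sub_sq_le_rpow {m r : ℝ} (hm : 0 < m) (hr : 0 < r) :
    1 + m * (r - 1) - (r - 1) ^ 2 ≤ r ^ m := by
  rcases le_total 1 m with h | h
  · have := one_add_mul_self_le_rpow_one_add (s := r - 1) (by linarith) h
    rw [add_sub_cancel] at this
    nlinarith [sq_nonneg (r - 1)]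
  · have h1 := rpow_one_add_le_one_add_mul_self (s := r - 1) (by linarith) (p := 1 - m)
      (by linarith) (by linarith)
    rw [add_sub_cancel] at h1
    have h2 : r ^ (1 - m) * r ^ m = r := by rw [← Real.rpow_add hr]; simp
    have h3 : 0 < r ^ m := Real.rpow_pos_of_pos hr m
    have h4 : 0 < r ^ (1 - m) := Real.rpow_pos_of_pos hr _
    have hk : 0 < 1 + (1 - m) * (r - 1) := h4.trans_le h1
    have h5 : r ≤ (1 + (1 - m) * (r - 1)) * r ^ m := by
      calc r = r ^ (1 - m) * r ^ m := h2.symm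
        _ ≤ _ := by gcongr
    have h6 : (1 + (1 - m) * (r - 1)) * (1 + m * (r - 1) - (r - 1) ^ 2) ≤ r := by
      have : r - (1 + (1 - m) * (r - 1)) * (1 + m * (r - 1) - (r - 1) ^ 2) =
          (r - 1) ^ 2 * (m ^ 2 + (1 - m) * r) := by ring
      have h7 : 0 ≤ (r - 1) ^ 2 * (m ^ 2 + (1 - m) * r) := by
        have : 0 ≤ 1 - m := by linarith
        positivity
      linarith
    exact le_of_mul_le_mul_left (h6.trans h5) hk

/-- In terms of half powers, `|s|^q` is a square, and the remainder is of second order even for `q <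
2`, where `|s|^q` is not twice differentiable at 0. -/
theorem rpow_remainder_of_pos {q : ℝ} (hq : 1 < q) {a : ℝ} (ha : 0 < a) (b : ℝ) :
    |b| ^ q - |a| ^ q - q * (spow (q - 1) a * (b - a)) ≤
      (2 * q + 1) * (spow (q / 2) b - spow (q / 2) a) ^ 2 := by
  have hq0 : 0 < q := by linarith
  have ha1 : a ^ (q - 1) * a = a ^ q := by rw [← Real.rpow_add_one ha.ne']; congr 1; ring
  rcases le_or_gt b 0 with hb | hb
  · obtain ⟨c, rfl⟩ : ∃ c, b = -c := ⟨-b, by ring⟩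
    have hc : 0 ≤ c := by linarith
    rw [spow_neg, spow_of_pos ha, spow_of_pos ha, abs_neg, abs_of_nonneg hc, abs_of_pos ha]
    -- For opposite signs the increment of the half power is the sum of the two moduli, so its
    -- square dominates `a^q + c^q` and a crude Young inequality suffices.
    have hyoung : a ^ (q - 1) * c ≤ a ^ q + c ^ q := by
      rcases le_total a c with h | h
      · rcases hc.eq_or_lt with rfl | hc'
        · simp; positivity
        calc a ^ (q - 1) * c ≤ c ^ (q - 1) * c := by
              gcongr
          _ = c ^ q := by rw [← Real.rpow_add_one hc'.ne']; congr 1; ring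
          _ ≤ _ := by have : 0 ≤ a ^ q := by positivity
                      linarith
      · calc a ^ (q - 1) * c ≤ a ^ (q - 1) * a := by gcongr
          _ = a ^ q := ha1
          _ ≤ _ := by have : 0 ≤ c ^ q := by positivity
                      linarith
    have hc2 : 0 ≤ spow (q / 2) c := by unfold spow; positivity
    have ha2 : 0 ≤ a ^ (q / 2) := by positivity
    have e1 : spow (q / 2) c ^ 2 = c ^ q := by rw [sq_spow_half hq0, abs_of_nonneg hc]
    have e2 : (a ^ (q / 2)) ^ 2 = a ^ q := by
      rw [← spow_of_pos ha, sq_spow_half hq0, abs_of_pos ha]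
    have hcq : 0 ≤ c ^ q := by positivity
    have haq : 0 ≤ a ^ q := by positivity
    have h1 : c ^ q - a ^ q - q * (a ^ (q - 1) * (-c - a)) ≤ (2 * q + 1) * (a ^ q + c ^ q) := by
      have : c ^ q - a ^ q - q * (a ^ (q - 1) * (-c - a)) =
          c ^ q - a ^ q + q * (a ^ (q - 1) * c) + q * (a ^ (q - 1) * a) := by ring
      rw [this, ha1]
      nlinarith
    refine h1.trans (mul_le_mul_of_nonneg_left ?_ (by linarith))
    rw [← e1, ← e2]
    nlinarith [mul_nonneg hc2 ha2]
  · rw [spow_of_pos ha, spow_of_pos ha, spow_of_pos hb, abs_of_pos ha, abs_of_pos hb]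
    -- With `r` the quotient of the half powers, homogeneity reduces the claim to one variable, and
    -- `b / a = r^(2/q)` calls for the Bernoulli-type bound with `m = 2/q`.
    set r : ℝ := (b / a) ^ (q / 2) with hr
    have hba : 0 < b / a := by positivity
    have hrpos : 0 < r := by positivity
    have e1 : r ^ (2 / q) = b / a := by
      rw [hr, ← Real.rpow_mul hba.le]
      rw [show q / 2 * (2 / q) = 1 by field_simp, Real.rpow_one]
    have e2 : b ^ (q / 2) = a ^ (q / 2) * r := by
      rw [hr, Real.div_rpow hb.le ha.le]; field_simp
    have e3 : (a ^ (q / 2)) ^ 2 = a ^ q := by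
      rw [← spow_of_pos ha, sq_spow_half hq0, abs_of_pos ha]
    have e4 : b ^ q = a ^ q * r ^ 2 := by
      rw [← e3, ← mul_pow, ← e2, ← spow_of_pos hb (q / 2), sq_spow_half hq0, abs_of_pos hb]
    have e5 : a ^ (q - 1) * (b - a) = a ^ q * (r ^ (2 / q) - 1) := by
      rw [e1, ← ha1]; field_simp
    have hbern := one_add_mul_sub_sq_le_rpow (m := 2 / q) (by positivity) hrpos
    have h2 : q * (1 + 2 / q * (r - 1) - (r - 1) ^ 2) ≤ q * r ^ (2 / q) := by gcongr
    have h3 : q * (1 + 2 / q * (r - 1) - (r - 1) ^ 2) = q + 2 * (r - 1) - q * (r - 1) ^ 2 := by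
      field_simp
    rw [e5, e4, e2]
    have haq : 0 ≤ a ^ q := by positivity
    calc a ^ q * r ^ 2 - a ^ q - q * (a ^ q * (r ^ (2 / q) - 1))
        = a ^ q * (r ^ 2 - 1 + q - q * r ^ (2 / q)) := by ring
      _ ≤ a ^ q * ((2 * q + 1) * (r - 1) ^ 2) := by
          gcongr
          nlinarith [sq_nonneg (r - 1)]
      _ = (2 * q + 1) * (a ^ (q / 2) * r - a ^ (q / 2)) ^ 2 := by rw [← e3]; ring

/-- The first-order Taylor remainder of `|s|^q` is controlled by the square of the increment of the
signed power of exponent `q / 2`. -/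
theorem rpow_remainder_le {q : ℝ} (hq : 1 < q) (a b : ℝ) :
    |b| ^ q - |a| ^ q - q * (spow (q - 1) a * (b - a)) ≤
      (2 * q + 1) * (spow (q / 2) b - spow (q / 2) a) ^ 2 := by
  rcases lt_trichotomy a 0 with ha | rfl | ha
  · have h := rpow_remainder_of_pos hq (neg_pos.mpr ha) (-b)
    simp only [spow_neg, abs_neg] at h
    calc _ = |b| ^ q - |a| ^ q - q * (-spow (q - 1) a * (-b - -a)) := by ring
      _ ≤ _ := h
      _ = _ := by ring
  · simp only [abs_zero, spow_zero, Real.zero_rpow (by linarith : q ≠ 0), sub_zero, zero_mul,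
      mul_zero]
    rw [← sq_spow_half (by linarith : 0 < q) b]
    nlinarith [sq_nonneg (spow (q / 2) b)]
  · exact rpow_remainder_of_pos hq ha b

end SignedPower

/-! ### A continuously differentiable truncation near zero. -/

section SoftThreshold

/-- A continuously differentiable truncation of the identity that vanishes for `|y| ≤ ε`. -/
noncomputable def softThr (ε y : ℝ) : ℝ := (max (|y| - ε) 0) ^ 2 / y

/-- The derivative of `softThr`. -/
noncomputable def softThrDeriv (ε y : ℝ) : ℝ := 1 - (ε / max |y| ε) ^ 2

theorem softThr_eq_zero {ε y : ℝ} (h : |y| ≤ ε) : softThr ε y = 0 := by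
  simp [softThr, max_eq_right (sub_nonpos.mpr h)]

theorem softThrDeriv_eq_zero {ε y : ℝ} (hε : 0 < ε) (h : |y| ≤ ε) : softThrDeriv ε y = 0 := by
  simp [softThrDeriv, max_eq_right h, div_self hε.ne']

theorem hasDerivAt_max_zero_sq (s : ℝ) :
    HasDerivAt (fun s : ℝ => max s 0 ^ 2) (2 * max s 0) s := by
  rcases lt_trichotomy s 0 with h | rfl | h
  · rw [max_eq_right h.le, mul_zero]
    refine (hasDerivAt_const s (0 : ℝ)).congr_of_eventuallyEq ?_
    filter_upwards [gt_mem_nhds h] with x hx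
    simp [max_eq_right hx.le]
  · rw [max_self, mul_zero]
    have hO : (fun s : ℝ => max s 0 ^ 2) =O[nhds 0] fun s => s ^ 2 := by
      refine Asymptotics.IsBigO.of_bound 1 (Filter.Eventually.of_forall fun s => ?_)
      rw [one_mul, norm_pow, norm_pow]
      gcongr
      rw [Real.norm_eq_abs, Real.norm_eq_abs, abs_of_nonneg (le_max_right _ _)]
      exact max_le (le_abs_self s) (abs_nonneg s)
    rw [hasDerivAt_iff_isLittleO]
    have ho : (fun s : ℝ => s ^ 2) =o[nhds 0] fun s => s := by
      simpa using Asymptotics.isLittleO_pow_pow (𝕜 := ℝ) (m := 1) (n := 2) (by norm_num)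
    simpa using hO.trans_isLittleO ho
  · rw [max_eq_left h.le]
    have h1 : HasDerivAt (fun s : ℝ => s ^ 2) (2 * s) s := by simpa using hasDerivAt_pow 2 s
    refine h1.congr_of_eventuallyEq ?_
    filter_upwards [lt_mem_nhds h] with x hx
    simp [max_eq_left hx.le]

theorem softThr_neg (ε y : ℝ) : softThr ε (-y) = -softThr ε y := by
  simp [softThr, div_neg]

theorem softThrDeriv_neg (ε y : ℝ) : softThrDeriv ε (-y) = softThrDeriv ε y := by
  simp [softThrDeriv]

theorem hasDerivAt_softThr_of_pos {ε y : ℝ} (hε : 0 < ε) (hy : 0 < y) :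
    HasDerivAt (softThr ε) (softThrDeriv ε y) y := by
  have h1 : HasDerivAt (fun y : ℝ => max (y - ε) 0 ^ 2) (2 * max (y - ε) 0) y := by
    exact ((hasDerivAt_max_zero_sq (y - ε)).comp y ((hasDerivAt_id y).sub_const ε)).congr_deriv
      (mul_one _)
  have h2 := h1.div (hasDerivAt_id y) hy.ne'
  have h3 : HasDerivAt (softThr ε)
      ((2 * max (y - ε) 0 * id y - max (y - ε) 0 ^ 2 * 1) / id y ^ 2) y := by
    refine h2.congr_of_eventuallyEq ?_
    filter_upwards [lt_mem_nhds hy] with x hx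
    simp [softThr, abs_of_pos hx]
  refine h3.congr_deriv (Eq.symm ?_)
  simp only [softThrDeriv, abs_of_pos hy, id]
  rcases le_total y ε with h | h
  · rw [max_eq_right h, max_eq_right (by linarith), div_self hε.ne']; simp
  · rw [max_eq_left h, max_eq_left (by linarith)]
    field_simp; ring

theorem hasDerivAt_softThr {ε : ℝ} (hε : 0 < ε) (y : ℝ) :
    HasDerivAt (softThr ε) (softThrDeriv ε y) y := by
  rcases lt_trichotomy y 0 with h | rfl | h
  · have h1 := (hasDerivAt_softThr_of_pos hε (neg_pos.mpr h)).comp y (hasDerivAt_neg y)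
    have h2 := h1.neg
    rw [softThrDeriv_neg] at h2
    refine (h2.congr_deriv (by ring)).congr_of_eventuallyEq (Filter.Eventually.of_forall fun x => ?_)
    simp [softThr_neg]
  · rw [softThrDeriv_eq_zero hε (by simpa using hε.le)]
    refine (hasDerivAt_const (0 : ℝ) (0 : ℝ)).congr_of_eventuallyEq ?_
    have : {x : ℝ | |x| < ε} ∈ nhds 0 :=
      (isOpen_lt continuous_abs continuous_const).mem_nhds (by simpa using hε)
    filter_upwards [this] with x hx
    exact softThr_eq_zero (le_of_lt hx)
  · exact hasDerivAt_softThr_of_pos hε h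

theorem continuous_softThr {ε : ℝ} (hε : 0 < ε) : Continuous (softThr ε) :=
  continuous_iff_continuousAt.mpr fun y => (hasDerivAt_softThr hε y).continuousAt

theorem continuous_softThrDeriv {ε : ℝ} (hε : 0 < ε) : Continuous (softThrDeriv ε) := by
  unfold softThrDeriv
  refine continuous_const.sub ((continuous_const.div (by fun_prop) fun y => ?_).pow 2)
  exact (hε.trans_le (le_max_right _ _)).ne'

theorem softThrDeriv_nonneg {ε : ℝ} (hε : 0 < ε) (y : ℝ) : 0 ≤ softThrDeriv ε y := by
  have h0 : 0 < max |y| ε := hε.trans_le (le_max_right _ _)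
  have h1 : ε / max |y| ε ≤ 1 := (div_le_one h0).mpr (le_max_right _ _)
  have h2 : 0 ≤ ε / max |y| ε := by positivity
  unfold softThrDeriv
  nlinarith

theorem softThrDeriv_le_one (ε y : ℝ) : softThrDeriv ε y ≤ 1 := by
  unfold softThrDeriv
  nlinarith [sq_nonneg (ε / max |y| ε)]

/-- Monotonicity in the level keeps the derivative of a difference of two truncations between 0 and
`1 - softThrDeriv ε`, uniformly in the smaller level. -/
theorem softThrDeriv_anti {δ ε : ℝ} (hδ : 0 < δ) (h : δ ≤ ε) (y : ℝ) :
    softThrDeriv ε y ≤ softThrDeriv δ y := by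
  have hε : 0 < ε := hδ.trans_le h
  have h0 : 0 < max |y| ε := hε.trans_le (le_max_right _ _)
  have h1 : 0 < max |y| δ := hδ.trans_le (le_max_right _ _)
  have h2 : δ / max |y| δ ≤ ε / max |y| ε := by
    rw [div_le_div_iff₀ h1 h0]
    rcases le_total |y| ε with hy | hy
    · rw [max_eq_right hy, mul_comm]
      exact mul_le_mul_of_nonneg_left (le_max_right _ _) hε.le
    · rw [max_eq_left hy, max_eq_left (h.trans hy)]
      exact mul_le_mul_of_nonneg_right h (abs_nonneg _)
  unfold softThrDeriv
  have : (δ / max |y| δ) ^ 2 ≤ (ε / max |y| ε) ^ 2 := by gcongr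
  linarith

theorem abs_softThr_sub_le {ε : ℝ} (hε : 0 < ε) (y : ℝ) : |softThr ε y - y| ≤ 2 * ε := by
  rcases le_or_gt |y| ε with h | h
  · rw [softThr_eq_zero h, zero_sub, abs_neg]; linarith
  · have hy : y ≠ 0 := by rintro rfl; simp at h; linarith
    rw [softThr, max_eq_left (by linarith)]
    have h0 : 0 < |y| := hε.trans h
    have h1 : (|y| - ε) ^ 2 / y - y = (ε * (ε - 2 * |y|)) / y := by
      field_simp; nlinarith [sq_abs y]
    rw [h1, abs_div, div_le_iff₀ h0, abs_mul, abs_of_pos hε, abs_of_neg (by linarith)]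
    nlinarith

theorem abs_softThr_le {ε : ℝ} (hε : 0 < ε) (y : ℝ) : |softThr ε y| ≤ |y| := by
  rcases le_or_gt |y| ε with h | h
  · rw [softThr_eq_zero h]; simp
  · have h0 : 0 < |y| := hε.trans h
    rw [softThr, max_eq_left (by linarith), abs_div, div_le_iff₀ h0, abs_of_nonneg (by positivity)]
    nlinarith

theorem tendsto_softThr (y : ℝ) :
    Filter.Tendsto (fun ε => softThr ε y) (nhdsWithin 0 (Set.Ioi 0)) (nhds y) := by
  rw [tendsto_iff_norm_sub_tendsto_zero]
  have h : Filter.Tendsto (fun ε : ℝ => 2 * ε) (nhdsWithin 0 (Set.Ioi 0)) (nhds 0) := by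
    have : Filter.Tendsto (fun ε : ℝ => 2 * ε) (nhds 0) (nhds (2 * 0)) :=
      (continuous_const.mul continuous_id).tendsto 0
    rw [mul_zero] at this
    exact this.mono_left nhdsWithin_le_nhds
  refine squeeze_zero' (Filter.Eventually.of_forall fun _ => norm_nonneg _) ?_ h
  filter_upwards [self_mem_nhdsWithin] with ε hε
  exact abs_softThr_sub_le hε y

theorem tendsto_softThrDeriv {y : ℝ} (hy : y ≠ 0) :
    Filter.Tendsto (fun ε => softThrDeriv ε y) (nhdsWithin 0 (Set.Ioi 0)) (nhds 1) := by
  have h : ContinuousAt (fun ε : ℝ => 1 - (ε / max |y| ε) ^ 2) 0 := by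
    refine continuousAt_const.sub ((continuousAt_id.div (by fun_prop) ?_).pow 2)
    exact ((abs_pos.mpr hy).trans_le (le_max_left _ _)).ne'
  have h2 := h.tendsto
  simp only [zero_div, ne_eq, OfNat.ofNat_ne_zero, not_false_eq_true, zero_pow, sub_zero] at h2
  exact h2.mono_left nhdsWithin_le_nhds

end SoftThreshold

/-! ### Horizontal differentiation and integration by parts. -/

section HorizontalC1

theorem hasLineDerivAt_hField_iff {f : Heis N → ℝ} {f' : ℝ} {ξ : Heis N} {i : HDir N} :
    HasLineDerivAt ℝ f f' ξ (hField i ξ) ↔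
      HasDerivAt (fun s : ℝ => f (hmul ξ (s • hVec i))) f' 0 := by
  simp only [hmul_smul_hVec]
  rfl

theorem hasDerivAt_flow {f : Heis N → ℝ} {f' : ℝ} {ξ : Heis N} {i : HDir N} {s : ℝ}
    (h : HasLineDerivAt ℝ f f' (hmul ξ (s • hVec i)) (hField i (hmul ξ (s • hVec i)))) :
    HasDerivAt (fun r : ℝ => f (hmul ξ (r • hVec i))) f' s := by
  have h1 := hasLineDerivAt_hField_iff.mp h
  rw [← sub_self s] at h1
  have h2 := h1.comp_sub_const s s
  refine h2.congr_of_eventuallyEq (Filter.Eventually.of_forall fun r => ?_)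
  simp only [← hmul_smul_hVec_add]
  congr 3; ring

/-- `w` is continuous with compact support, and it has continuous derivatives `D i` along the
horizontal fields. -/
structure HorizontalC1 (w : Heis N → ℝ) (D : HDir N → Heis N → ℝ) : Prop where
  cont : Continuous w
  supp : HasCompactSupport w
  dcont : ∀ i, Continuous (D i)
  hasDeriv : ∀ i ξ, HasLineDerivAt ℝ w (D i ξ) ξ (hField i ξ)

theorem hasLineDerivAt_zero_of_eventuallyEq {f : Heis N → ℝ} {ξ v : Heis N}
    (h : f =ᶠ[nhds ξ] 0) : HasLineDerivAt ℝ f 0 ξ v := by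
  have h0 : HasLineDerivAt ℝ (0 : Heis N → ℝ) 0 ξ v :=
    hasDerivAt_const (0 : ℝ) (0 : ℝ)
  exact h0.congr_of_eventuallyEq h

theorem HorizontalC1.deriv_eq_zero {w : Heis N → ℝ} {D : HDir N → Heis N → ℝ}
    (hw : HorizontalC1 w D) (i : HDir N) {ξ : Heis N} (hξ : ξ ∉ tsupport w) : D i ξ = 0 :=
  (hw.hasDeriv i ξ).unique
    (hasLineDerivAt_zero_of_eventuallyEq (notMem_tsupport_iff_eventuallyEq.mp hξ))

theorem HorizontalC1.dsupp {w : Heis N → ℝ} {D : HDir N → Heis N → ℝ}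
    (hw : HorizontalC1 w D) (i : HDir N) : HasCompactSupport (D i) :=
  HasCompactSupport.intro hw.supp fun _ hξ => hw.deriv_eq_zero i hξ

theorem HorizontalC1.sub {w w' : Heis N → ℝ} {D D' : HDir N → Heis N → ℝ}
    (hw : HorizontalC1 w D) (hw' : HorizontalC1 w' D') :
    HorizontalC1 (fun ξ => w ξ - w' ξ) (fun i ξ => D i ξ - D' i ξ) where
  cont := hw.cont.sub hw'.cont
  supp := hw.supp.sub hw'.supp
  dcont i := (hw.dcont i).sub (hw'.dcont i)
  hasDeriv i ξ := HasDerivAt.sub (hw.hasDeriv i ξ) (hw'.hasDeriv i ξ)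

theorem HorizontalC1.hasDerivAt_flow {w : Heis N → ℝ} {D : HDir N → Heis N → ℝ}
    (hw : HorizontalC1 w D) (i : HDir N) (ξ : Heis N) (s : ℝ) :
    HasDerivAt (fun r : ℝ => w (hmul ξ (r • hVec i))) (D i (hmul ξ (s • hVec i))) s :=
  HeisChoquard.hasDerivAt_flow (hw.hasDeriv i _)

/-- The integral of a derivative along a horizontal field vanishes. -/
theorem integral_lineDeriv_hField_eq_zero {Φ Ψ : Heis N → ℝ} (i : HDir N) (hΦ : Continuous Φ)
    (hc : HasCompactSupport Φ) (hΨ : Continuous Ψ)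
    (h : ∀ ξ, HasLineDerivAt ℝ Φ (Ψ ξ) ξ (hField i ξ)) : ∫ ξ, Ψ ξ = 0 := by
  have hΨc : HasCompactSupport Ψ := HasCompactSupport.intro hc fun ξ hξ =>
    (h ξ).unique (hasLineDerivAt_zero_of_eventuallyEq (notMem_tsupport_iff_eventuallyEq.mp hξ))
  have hΦi := hΦ.integrable_of_hasCompactSupport hc (μ := volume)
  have hΨi := hΨ.integrable_of_hasCompactSupport hΨc (μ := volume)
  have hcont : Continuous fun p : Heis N × ℝ => Ψ (hmul p.1 (p.2 • hVec i)) := by fun_prop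
  have hftc : ∀ ξ, Φ (hmul ξ ((1 : ℝ) • hVec i)) - Φ ξ =
      ∫ r in Set.Ioc (0 : ℝ) 1, Ψ (hmul ξ (r • hVec i)) := by
    intro ξ
    rw [← intervalIntegral.integral_of_le zero_le_one,
      intervalIntegral.integral_eq_sub_of_hasDerivAt (fun r _ => hasDerivAt_flow (h _))]
    · simp
    · exact Continuous.intervalIntegrable (by fun_prop) _ _
  -- Right translation preserves the measure, so the increment of `Φ` over unit flow time integrates
  -- to zero. By Fubini and the same invariance this integral is also that of `Ψ`.
  have h0 : ∫ ξ, (Φ (hmul ξ ((1 : ℝ) • hVec i)) - Φ ξ) = 0 := by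
    rw [integral_sub _ hΦi, integral_hmul_right, sub_self]
    exact (measurePreserving_hmul_right ((1 : ℝ) • hVec i)).integrable_comp_of_integrable hΦi
  simp only [hftc] at h0
  have hint : Integrable (Function.uncurry fun (ξ : Heis N) (r : ℝ) => Ψ (hmul ξ (r • hVec i)))
      (volume.prod (volume.restrict (Set.Ioc (0 : ℝ) 1))) := by
    refine (integrable_prod_iff' hcont.aestronglyMeasurable).mpr ⟨Filter.Eventually.of_forall fun r =>
      (measurePreserving_hmul_right (r • hVec i)).integrable_comp_of_integrable hΨi, ?_⟩
    have : ∀ r : ℝ, ∫ ξ, ‖Function.uncurry (fun (ξ : Heis N) (r : ℝ) =>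
        Ψ (hmul ξ (r • hVec i))) (ξ, r)‖ = ∫ ξ, ‖Ψ ξ‖ := fun r =>
      integral_hmul_right (fun ξ => ‖Ψ ξ‖) (r • hVec i)
    exact (integrable_const (∫ ξ, ‖Ψ ξ‖)).congr
      (Filter.Eventually.of_forall fun r => (this r).symm)
  rw [integral_integral_swap hint] at h0
  simp only [integral_hmul_right] at h0
  simpa using h0

theorem HorizontalC1.comp_dil {w : Heis N → ℝ} {D : HDir N → Heis N → ℝ}
    (hw : HorizontalC1 w D) {θ : ℝ} (hθ : 0 < θ) :
    HorizontalC1 (fun ξ => w (dil θ ξ)) (fun i ξ => θ * D i (dil θ ξ)) where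
  cont := hw.cont.comp (by fun_prop)
  supp := hw.supp.comp_homeomorph (dilHomeo θ hθ)
  dcont i := continuous_const.mul ((hw.dcont i).comp (by fun_prop))
  hasDeriv i ξ := by
    rw [hasLineDerivAt_hField_iff]
    simp only [dil_hmul, dil_smul_hVec]
    have h1 := hasLineDerivAt_hField_iff.mp (hw.hasDeriv i (dil θ ξ))
    have h2 : HasDerivAt (fun s : ℝ => θ * s) θ 0 := by
      simpa using (hasDerivAt_id (0 : ℝ)).const_mul θ
    rw [← mul_zero θ] at h1
    exact (h1.comp (0 : ℝ) h2).congr_deriv (mul_comm _ _)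

/-- `y` is continuous with compact support, and where it does not vanish it has continuous
derivatives `D i` along the horizontal fields. -/
structure HorizontalC1OffZero (y : Heis N → ℝ) (D : HDir N → Heis N → ℝ) : Prop where
  cont : Continuous y
  supp : HasCompactSupport y
  dcont : ∀ i, ContinuousOn (D i) {ξ | y ξ ≠ 0}
  hasDeriv : ∀ i ξ, y ξ ≠ 0 → HasLineDerivAt ℝ y (D i ξ) ξ (hField i ξ)

theorem HorizontalC1OffZero.isOpen {y : Heis N → ℝ} {D : HDir N → Heis N → ℝ}
    (hy : HorizontalC1OffZero y D) : IsOpen {ξ | y ξ ≠ 0} :=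
  isOpen_ne_fun hy.cont continuous_const

/-- Near a zero of `y` the truncation vanishes identically, so neither differentiability of `y` nor
any control of `D` is needed there. -/
theorem HorizontalC1OffZero.comp_softThr {y : Heis N → ℝ} {D : HDir N → Heis N → ℝ}
    (hy : HorizontalC1OffZero y D) {ε : ℝ} (hε : 0 < ε) :
    HorizontalC1 (fun ξ => softThr ε (y ξ)) (fun i ξ => softThrDeriv ε (y ξ) * D i ξ) := by
  have hnear : ∀ ξ, y ξ = 0 → ∀ᶠ ζ in nhds ξ, |y ζ| ≤ ε := by
    intro ξ hξ
    have : {ζ | |y ζ| < ε} ∈ nhds ξ :=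
      (isOpen_lt hy.cont.abs continuous_const).mem_nhds (by simpa [hξ] using hε)
    filter_upwards [this] with ζ hζ using le_of_lt hζ
  refine ⟨(continuous_softThr hε).comp hy.cont, ?_, ?_, ?_⟩
  · refine hy.supp.comp_left (g := HeisChoquard.softThr ε) ?_
    exact softThr_eq_zero (by simpa using hε.le)
  · intro i
    rw [continuous_iff_continuousAt]
    intro ξ
    rcases eq_or_ne (y ξ) 0 with h | h
    · have : (fun ζ => softThrDeriv ε (y ζ) * D i ζ) =ᶠ[nhds ξ] fun _ => 0 := by
        filter_upwards [hnear ξ h] with ζ hζ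
        rw [softThrDeriv_eq_zero hε hζ, zero_mul]
      exact continuousAt_const.congr this.symm
    · exact ((continuous_softThrDeriv hε).comp hy.cont).continuousAt.mul
        ((hy.dcont i).continuousAt (hy.isOpen.mem_nhds h))
  · intro i ξ
    rcases eq_or_ne (y ξ) 0 with h | h
    · rw [h, softThrDeriv_eq_zero hε (by simpa using hε.le), zero_mul]
      refine hasLineDerivAt_zero_of_eventuallyEq ?_
      filter_upwards [hnear ξ h] with ζ hζ using softThr_eq_zero hζ
    · have h1 := hasLineDerivAt_hField_iff.mp (hy.hasDeriv i ξ h)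
      rw [hasLineDerivAt_hField_iff]
      have h2 : HasDerivAt (HeisChoquard.softThr ε) (softThrDeriv ε (y ξ))
          (y (hmul ξ ((0 : ℝ) • hVec i))) := by
        simpa using hasDerivAt_softThr hε (y ξ)
      exact h2.comp (0 : ℝ) h1

/-- When `y` vanishes off `Ω`, this puts the closed support inside the open set `Ω`, so integration
by parts applies with no boundary regularity. -/
theorem tsupport_softThr_subset {y : Heis N → ℝ} (hy : Continuous y) {ε : ℝ} (hε : 0 < ε) :
    tsupport (fun ξ => softThr ε (y ξ)) ⊆ {ξ | y ξ ≠ 0} := by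
  have hcl : IsClosed {ξ | ε ≤ |y ξ|} := isClosed_le continuous_const hy.abs
  refine (closure_minimal ?_ hcl).trans ?_
  · intro ξ hξ
    by_contra h
    exact hξ (softThr_eq_zero (not_le.mp h).le)
  · intro ξ hξ h
    rw [Set.mem_ofPred_eq, h, abs_zero] at hξ
    linarith

/-- Integration by parts along a horizontal field, against a compactly supported test function. -/
theorem integral_mul_lineDeriv {Ω : Set (Heis N)} (hΩ : IsOpen Ω) {P R : Heis N → ℝ}
    (i : HDir N) (hP : ContinuousOn P Ω) (hR : ContinuousOn R Ω)
    (hPR : ∀ ξ ∈ Ω, HasLineDerivAt ℝ P (R ξ) ξ (hField i ξ))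
    {v : Heis N → ℝ} {D : HDir N → Heis N → ℝ} (hv : HorizontalC1 v D) (hsub : tsupport v ⊆ Ω) :
    ∫ ξ, P ξ * D i ξ = -∫ ξ, R ξ * v ξ := by
  have hD : ∀ ξ, ξ ∉ tsupport v → D i ξ = 0 := fun ξ hξ => hv.deriv_eq_zero i hξ
  have hDsub : tsupport (D i) ⊆ tsupport v :=
    closure_minimal (fun ξ hξ => by by_contra h; exact hξ (hD ξ h)) (isClosed_tsupport v)
  have c1 : Continuous fun ξ => P ξ * v ξ :=
    (hP.mul hv.cont.continuousOn).continuous_of_tsupport_subset hΩ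
      ((tsupport_mul_subset_right).trans hsub)
  have c2 : Continuous fun ξ => R ξ * v ξ :=
    (hR.mul hv.cont.continuousOn).continuous_of_tsupport_subset hΩ
      ((tsupport_mul_subset_right).trans hsub)
  have c3 : Continuous fun ξ => P ξ * D i ξ :=
    (hP.mul (hv.dcont i).continuousOn).continuous_of_tsupport_subset hΩ
      ((tsupport_mul_subset_right).trans (hDsub.trans hsub))
  have s1 : HasCompactSupport fun ξ => P ξ * v ξ := hv.supp.mul_left
  have s2 : HasCompactSupport fun ξ => R ξ * v ξ := hv.supp.mul_left
  have s3 : HasCompactSupport fun ξ => P ξ * D i ξ := (hv.dsupp i).mul_left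
  have h := integral_lineDeriv_hField_eq_zero i (Ψ := fun ξ => R ξ * v ξ + P ξ * D i ξ) c1 s1
    (c2.add c3) (fun ξ => by
    by_cases hξ : ξ ∈ tsupport v
    · have h1 := hasLineDerivAt_hField_iff.mp (hPR ξ (hsub hξ))
      have h2 := hasLineDerivAt_hField_iff.mp (hv.hasDeriv i ξ)
      rw [hasLineDerivAt_hField_iff]
      refine (h1.mul h2).congr_deriv ?_
      simp
    · rw [hD ξ hξ, image_eq_zero_of_notMem_tsupport hξ, mul_zero, mul_zero, add_zero]
      refine hasLineDerivAt_zero_of_eventuallyEq ?_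
      filter_upwards [notMem_tsupport_iff_eventuallyEq.mp hξ] with ζ hζ
      simp [hζ])
  rw [integral_add (c2.integrable_of_hasCompactSupport s2)
    (c3.integrable_of_hasCompactSupport s3)] at h
  linarith

end HorizontalC1

/-! ### Mean-square increments along horizontal and central directions. -/

section TranslationIncrements

/-- The square integral of a function. -/
noncomputable def sqInt (f : Heis N → ℝ) : ℝ≥0∞ := ∫⁻ ξ, ENNReal.ofReal (f ξ ^ 2)

/-- The square integral of the increment of `w` under the right translation by `η`. -/
noncomputable def transIncr (w : Heis N → ℝ) (η : Heis N) : ℝ≥0∞ :=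
  sqInt fun ξ => w (hmul ξ η) - w ξ

/-- The square integral of the increment of `w` under the dilation by `θ`. -/
noncomputable def dilIncr (w : Heis N → ℝ) (θ : ℝ) : ℝ≥0∞ :=
  sqInt fun ξ => w (dil θ ξ) - w ξ

theorem ofReal_add_sq_le (a b : ℝ) :
    ENNReal.ofReal ((a + b) ^ 2) ≤ 2 * ENNReal.ofReal (a ^ 2) + 2 * ENNReal.ofReal (b ^ 2) := by
  have h : (2 : ℝ≥0∞) = ENNReal.ofReal 2 := by simp
  rw [h, ← ENNReal.ofReal_mul zero_le_two, ← ENNReal.ofReal_mul zero_le_two,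
    ← ENNReal.ofReal_add (by positivity) (by positivity)]
  apply ENNReal.ofReal_le_ofReal
  nlinarith [sq_nonneg (a - b)]

theorem sqInt_add_le {f g : Heis N → ℝ} (hf : Continuous f) :
    sqInt (fun ξ => f ξ + g ξ) ≤ 2 * sqInt f + 2 * sqInt g := by
  have m1 : Measurable fun ξ => 2 * ENNReal.ofReal (f ξ ^ 2) := by
    have := hf.measurable
    fun_prop
  unfold sqInt
  rw [← lintegral_const_mul' _ _ (by simp), ← lintegral_const_mul' _ _ (by simp),
    ← lintegral_add_left m1]
  exact lintegral_mono fun ξ => ofReal_add_sq_le _ _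

theorem sqInt_hmul_right (f : Heis N → ℝ) (η : Heis N) :
    sqInt (fun ξ => f (hmul ξ η)) = sqInt f :=
  lintegral_hmul_right (fun ξ => ENNReal.ofReal (f ξ ^ 2)) η

theorem sqInt_lt_top {f : Heis N → ℝ} (hf : Continuous f) (hc : HasCompactSupport f) :
    sqInt f < ∞ := by
  have h : Integrable fun ξ => f ξ ^ 2 := by
    have hf2 : Continuous fun ξ => f ξ ^ 2 := by fun_prop
    exact hf2.integrable_of_hasCompactSupport (HasCompactSupport.intro hc fun ξ hξ => by
      rw [image_eq_zero_of_notMem_tsupport hξ]; norm_num)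
  exact h.lintegral_lt_top

theorem transIncr_hmul {w : Heis N → ℝ} (hw : Continuous w) (η η' : Heis N) :
    transIncr w (hmul η η') ≤ 2 * transIncr w η + 2 * transIncr w η' := by
  have h : transIncr w (hmul η η') =
      sqInt fun ξ => (w (hmul ξ η) - w ξ) +
        (fun ζ => w (hmul ζ η') - w ζ) (hmul ξ η) := by
    unfold transIncr
    congr 1; funext ξ
    rw [← hmul_assoc]; ring
  rw [h]
  refine (sqInt_add_le (by fun_prop)).trans (le_of_eq ?_)
  rw [sqInt_hmul_right (fun ζ => w (hmul ζ η') - w ζ) η]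
  rfl

theorem transIncr_hinv (w : Heis N → ℝ) (η : Heis N) :
    transIncr w (hinv η) = transIncr w η := by
  unfold transIncr
  rw [← sqInt_hmul_right (fun ξ => w (hmul ξ η) - w ξ) (hinv η)]
  unfold sqInt
  congr 1; funext ξ
  simp only [hmul_assoc, hinv_hmul_self, hmul_zero]
  congr 1; ring

theorem sq_integral_unitInterval_le {f : ℝ → ℝ} (hf : Continuous f) :
    ENNReal.ofReal ((∫ r in Set.Ioc (0 : ℝ) 1, f r) ^ 2) ≤
      ∫⁻ r in Set.Ioc (0 : ℝ) 1, ENNReal.ofReal (f r ^ 2) := by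
  have hi : ∀ g : ℝ → ℝ, Continuous g → IntegrableOn g (Set.Ioc 0 1) := fun g hg =>
    (hg.integrableOn_Icc (a := 0) (b := 1)).mono_set Set.Ioc_subset_Icc_self
  rw [← ofReal_integral_eq_lintegral_ofReal (hi (fun r => f r ^ 2) (hf.pow 2))
    (Filter.Eventually.of_forall fun r => sq_nonneg _)]
  apply ENNReal.ofReal_le_ofReal
  set m := ∫ r in Set.Ioc (0 : ℝ) 1, f r with hm
  -- Cauchy–Schwarz on the unit interval, as nonnegativity of the variance.
  have h0 : 0 ≤ ∫ r in Set.Ioc (0 : ℝ) 1, (f r ^ 2 - 2 * m * f r + m ^ 2) :=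
    integral_nonneg fun r => by
      have : f r ^ 2 - 2 * m * f r + m ^ 2 = (f r - m) ^ 2 := by ring
      simp only [this]; positivity
  rw [integral_add (hi (fun r => f r ^ 2 - 2 * m * f r) (by fun_prop))
    (hi (fun _ => m ^ 2) continuous_const),
    integral_sub (hi (fun r => f r ^ 2) (hf.pow 2)) (hi (fun r => 2 * m * f r) (by fun_prop)),
    integral_const_mul, ← hm] at h0
  simp at h0
  nlinarith

/-- The increment is the integral of `D i` along the flow. After Cauchy–Schwarz and Fubini, each
right translate of `D i` has the same square integral. -/
theorem HorizontalC1.transIncr_flow_le {w : Heis N → ℝ} {D : HDir N → Heis N → ℝ}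
    (hw : HorizontalC1 w D) (i : HDir N) (s : ℝ) :
    transIncr w (s • hVec i) ≤ ENNReal.ofReal (s ^ 2) * sqInt (D i) := by
  have hD := hw.dcont i
  have hpt : ∀ ξ, w (hmul ξ (s • hVec i)) - w ξ =
      s * ∫ r in Set.Ioc (0 : ℝ) 1, D i (hmul ξ ((r * s) • hVec i)) := by
    intro ξ
    have hder : ∀ r : ℝ, HasDerivAt (fun r : ℝ => w (hmul ξ ((r * s) • hVec i)))
        (s * D i (hmul ξ ((r * s) • hVec i))) r := by
      intro r
      have h1 := (hw.hasDerivAt_flow i ξ (r * s)).comp r ((hasDerivAt_id r).mul_const s)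
      exact h1.congr_deriv (by ring)
    rw [← integral_const_mul, ← intervalIntegral.integral_of_le zero_le_one,
      intervalIntegral.integral_eq_sub_of_hasDerivAt (fun r _ => hder r)]
    · simp
    · exact Continuous.intervalIntegrable (by fun_prop) _ _
  have hpt2 : ∀ ξ, ENNReal.ofReal ((w (hmul ξ (s • hVec i)) - w ξ) ^ 2) ≤
      ENNReal.ofReal (s ^ 2) *
        ∫⁻ r in Set.Ioc (0 : ℝ) 1, ENNReal.ofReal (D i (hmul ξ ((r * s) • hVec i)) ^ 2) := by
    intro ξ
    rw [hpt, mul_pow, ENNReal.ofReal_mul (sq_nonneg _)]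
    gcongr
    exact sq_integral_unitInterval_le (by fun_prop)
  have hmeas : Measurable fun p : Heis N × ℝ =>
      ENNReal.ofReal (D i (hmul p.1 ((p.2 * s) • hVec i)) ^ 2) := by
    have : Continuous fun p : Heis N × ℝ => D i (hmul p.1 ((p.2 * s) • hVec i)) ^ 2 := by fun_prop
    exact ENNReal.measurable_ofReal.comp this.measurable
  calc transIncr w (s • hVec i)
      ≤ ∫⁻ ξ, ENNReal.ofReal (s ^ 2) *
        ∫⁻ r in Set.Ioc (0 : ℝ) 1, ENNReal.ofReal (D i (hmul ξ ((r * s) • hVec i)) ^ 2) :=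
        lintegral_mono hpt2
    _ = ENNReal.ofReal (s ^ 2) * ∫⁻ ξ,
        ∫⁻ r in Set.Ioc (0 : ℝ) 1, ENNReal.ofReal (D i (hmul ξ ((r * s) • hVec i)) ^ 2) :=
        lintegral_const_mul' _ _ (by simp)
    _ = ENNReal.ofReal (s ^ 2) * ∫⁻ r in Set.Ioc (0 : ℝ) 1,
        ∫⁻ ξ, ENNReal.ofReal (D i (hmul ξ ((r * s) • hVec i)) ^ 2) := by
        rw [lintegral_lintegral_swap hmeas.aemeasurable]
    _ = ENNReal.ofReal (s ^ 2) * sqInt (D i) := by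
        congr 1
        have : ∀ r : ℝ, ∫⁻ ξ, ENNReal.ofReal (D i (hmul ξ ((r * s) • hVec i)) ^ 2) =
            sqInt (D i) := fun r => sqInt_hmul_right _ _
        simp [this]

theorem hinv_smul_tVec (τ : ℝ) : hinv (τ • (tVec : Heis N)) = (-τ) • tVec := by
  rw [hinv_eq_neg, neg_smul]

/-- A central translation is a commutator of four horizontal ones of length `√|τ|/2`. Each costs the
square of its length, hence the linear growth in `|τ|`. The loop produces negative `τ`; inversion
covers the other sign. -/
theorem HorizontalC1.transIncr_center_le {w : Heis N → ℝ} {D : HDir N → Heis N → ℝ}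
    (hw : HorizontalC1 w D) (j : Fin N) (τ : ℝ) :
    transIncr w (τ • tVec) ≤ ENNReal.ofReal |τ| * (6 * ∑ i, sqInt (D i)) := by
  have key : transIncr w ((-|τ|) • tVec) ≤ ENNReal.ofReal |τ| * (6 * ∑ i, sqInt (D i)) := by
    set h : ℝ := Real.sqrt |τ| / 2 with hh
    have hsq : h ^ 2 = |τ| / 4 := by
      rw [hh, div_pow, Real.sq_sqrt (abs_nonneg _)]; norm_num
    have hloop := commutator_loop j h
    rw [show -(4 * h ^ 2) = -|τ| by rw [hsq]; ring] at hloop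
    rw [← hloop]
    set K := ∑ i, sqInt (D i) with hK
    have hX : ∀ s : ℝ, s ^ 2 = |τ| / 4 → ∀ i, transIncr w (s • hVec i) ≤
        ENNReal.ofReal (|τ| / 4) * K := by
      intro s hs i
      refine (hw.transIncr_flow_le i s).trans ?_
      rw [hs]
      gcongr
      exact Finset.single_le_sum (f := fun i => sqInt (D i)) (fun _ _ => zero_le)
        (Finset.mem_univ i)
    have hn : (-h) ^ 2 = |τ| / 4 := by rw [neg_sq, hsq]
    set M := ENNReal.ofReal (|τ| / 4) * K with hM
    have e1 := (transIncr_hmul hw.cont (h • hVec (Sum.inl j)) (h • hVec (Sum.inr j))).trans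
      (add_le_add (mul_le_mul_right (hX h hsq _) 2) (mul_le_mul_right (hX h hsq _) 2))
    have e2 := (transIncr_hmul hw.cont _ ((-h) • hVec (Sum.inl j))).trans
      (add_le_add (mul_le_mul_right e1 2) (mul_le_mul_right (hX _ hn _) 2))
    have e3 := (transIncr_hmul hw.cont _ ((-h) • hVec (Sum.inr j))).trans
      (add_le_add (mul_le_mul_right e2 2) (mul_le_mul_right (hX _ hn _) 2))
    refine e3.trans ?_
    -- Three uses of quasi-subadditivity give 22, rounded up to 24 so that `4 · (|τ|/4)` leaves the
    -- factor 6.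
    calc 2 * (2 * (2 * M + 2 * M) + 2 * M) + 2 * M = 22 * M := by ring
      _ ≤ 24 * M := by gcongr; norm_num
      _ = (ENNReal.ofReal 4 * ENNReal.ofReal (|τ| / 4)) * (6 * K) := by
          rw [hM, show ENNReal.ofReal 4 = 4 by simp]; ring
      _ = ENNReal.ofReal |τ| * (6 * K) := by
          rw [← ENNReal.ofReal_mul (by norm_num)]; congr 2; ring
  rcases le_total 0 τ with h | h
  · rw [abs_of_nonneg h] at key
    rw [← transIncr_hinv, hinv_smul_tVec, abs_of_nonneg h]
    exact key
  · rw [abs_of_nonpos h, neg_neg] at key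
    rwa [abs_of_nonpos h]

theorem exists_bound_of_hasCompactSupport {f : Heis N → ℝ} (hc : HasCompactSupport f) :
    ∃ R : ℝ, 1 ≤ R ∧ ∀ ξ, f ξ ≠ 0 → ‖ξ‖ ≤ R := by
  obtain ⟨R, hR⟩ := hc.isCompact.isBounded.subset_closedBall (0 : Heis N)
  refine ⟨max R 1, le_max_right _ _, fun ξ hξ => ?_⟩
  have := hR (subset_tsupport _ hξ)
  rw [mem_closedBall_zero_iff] at this
  exact this.trans (le_max_left _ _)

theorem norm_le_of_hmul {ξ η : Heis N} {R : ℝ} (hη : ‖η‖ ≤ 1) (h : ‖hmul ξ η‖ ≤ R) :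
    ‖ξ‖ ≤ 3 * R + 1 := by
  have h1 := norm_hmul_le (hmul ξ η) (hinv η)
  rw [hmul_cancel_hinv, norm_hinv] at h1
  nlinarith [norm_nonneg (hmul ξ η), norm_nonneg η]

/-- The Euclidean displacement caused by right translation grows with `ξ`, so uniform continuity
alone is not enough; compact support removes the large `ξ`. -/
theorem exists_osc_le {f : Heis N → ℝ} (hf : Continuous f) (hc : HasCompactSupport f)
    {ε : ℝ} (hε : 0 < ε) :
    ∃ δ > 0, ∀ η : Heis N, ‖η‖ ≤ δ → ∀ ξ, |f (hmul ξ η) - f ξ| ≤ ε := by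
  obtain ⟨R, hR1, hR⟩ := exists_bound_of_hasCompactSupport hc
  have hu := hc.uniformContinuous_of_continuous hf
  obtain ⟨δ, hδ, hd⟩ := Metric.uniformContinuous_iff.mp hu ε hε
  set R' := 3 * R + 1 with hR'
  refine ⟨min 1 (δ / (2 * (1 + 2 * R'))), by positivity, fun η hη ξ => ?_⟩
  have hη1 : ‖η‖ ≤ 1 := hη.trans (min_le_left _ _)
  have hη2 : ‖η‖ ≤ δ / (2 * (1 + 2 * R')) := hη.trans (min_le_right _ _)
  rcases le_or_gt ‖ξ‖ R' with h | h
  · have hdist : dist (hmul ξ η) ξ < δ := by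
      rw [dist_eq_norm, hmul_eq]
      have e : ξ + η + (2 * bracket ξ η) • tVec - ξ = η + (2 * bracket ξ η) • tVec := by abel
      rw [e]
      have h1 : ‖η + (2 * bracket ξ η) • (tVec : Heis N)‖ ≤ ‖η‖ + 2 * (‖ξ‖ * ‖η‖) := by
        refine (norm_add_le _ _).trans ?_
        rw [norm_smul, norm_tVec, mul_one, Real.norm_eq_abs, abs_mul, abs_two]
        linarith [abs_bracket_le ξ η]
      have h2 : ‖η‖ + 2 * (‖ξ‖ * ‖η‖) ≤ (1 + 2 * R') * ‖η‖ := by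
        nlinarith [norm_nonneg η]
      have h3 : (1 + 2 * R') * ‖η‖ ≤ (1 + 2 * R') * (δ / (2 * (1 + 2 * R'))) := by gcongr
      have h4 : (1 + 2 * R') * (δ / (2 * (1 + 2 * R'))) = δ / 2 := by
        have : 0 < 1 + 2 * R' := by positivity
        field_simp
      linarith
    have := hd hdist
    rw [Real.dist_eq] at this
    exact this.le
  · have h1 : f ξ = 0 := by
      by_contra hne
      linarith [hR ξ hne]
    have h2 : f (hmul ξ η) = 0 := by
      by_contra hne
      linarith [norm_le_of_hmul hη1 (hR _ hne)]
    rw [h1, h2]; simpa using hε.le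

/-- First-order expansion along one leg of the loop, with the derivative frozen at the base point
`ξ` rather than at the start of the leg. The mean value inequality is applied to `w` minus its
linear part. -/
theorem HorizontalC1.abs_flow_sub_le {w : Heis N → ℝ} {D : HDir N → Heis N → ℝ}
    (hw : HorizontalC1 w D) (i : HDir N) {ε δ : ℝ}
    (hD : ∀ η : Heis N, ‖η‖ ≤ δ → ∀ ξ, |D i (hmul ξ η) - D i ξ| ≤ ε) (ξ η : Heis N) {h : ℝ}
    (hη : ∀ r : ℝ, |r| ≤ |h| → ‖hmul η (r • hVec i)‖ ≤ δ) :
    |w (hmul (hmul ξ η) (h • hVec i)) - w (hmul ξ η) - h * D i ξ| ≤ ε * |h| := by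
  have hder : ∀ r ∈ Metric.closedBall (0 : ℝ) |h|, HasDerivWithinAt
      (fun r : ℝ => w (hmul (hmul ξ η) (r • hVec i)) - r * D i ξ)
      (D i (hmul (hmul ξ η) (r • hVec i)) - D i ξ) (Metric.closedBall 0 |h|) r := by
    intro r _
    have h1 := (hw.hasDerivAt_flow i (hmul ξ η) r).sub ((hasDerivAt_id r).mul_const (D i ξ))
    exact (h1.congr_deriv (by simp)).hasDerivWithinAt
  have hb : ∀ r ∈ Metric.closedBall (0 : ℝ) |h|,
      ‖D i (hmul (hmul ξ η) (r • hVec i)) - D i ξ‖ ≤ ε := by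
    intro r hr
    rw [hmul_assoc]
    exact hD _ (hη r (by simpa using hr)) ξ
  have := (convex_closedBall (0 : ℝ) |h|).norm_image_sub_le_of_norm_hasDerivWithin_le hder hb
    (x := 0) (y := h) (by simp) (by simp)
  simp only [zero_smul, hmul_zero, zero_mul, sub_zero, Real.norm_eq_abs] at this
  convert this using 2
  ring

theorem norm_hmul_smul_hVec_le (η : Heis N) (i : HDir N) {r : ℝ} (hr : |r| ≤ 1) :
    ‖hmul η (r • hVec i)‖ ≤ 3 * ‖η‖ + |r| := by
  have h := norm_hmul_le η (r • hVec i)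
  rw [norm_smul, norm_hVec, mul_one, Real.norm_eq_abs] at h
  nlinarith [norm_nonneg η, abs_nonneg r]

/-- Around the commutator loop the linear terms cancel, and only the oscillation of the horizontal
derivatives remains; it is small by continuity. -/
theorem HorizontalC1.exists_abs_center_le {w : Heis N → ℝ} {D : HDir N → Heis N → ℝ}
    (hw : HorizontalC1 w D) (j : Fin N) {ε : ℝ} (hε : 0 < ε) :
    ∃ τ₀ > 0, ∀ τ : ℝ, 0 ≤ τ → τ ≤ τ₀ → ∀ ξ, |w (hmul ξ ((-τ) • tVec)) - w ξ| ≤ ε * √τ := by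
  obtain ⟨δ₁, hδ₁, h₁⟩ := exists_osc_le (hw.dcont (Sum.inl j)) (hw.dsupp _) (half_pos hε)
  obtain ⟨δ₂, hδ₂, h₂⟩ := exists_osc_le (hw.dcont (Sum.inr j)) (hw.dsupp _) (half_pos hε)
  -- Each leg at most triples the norm and adds `h`: the loop vertices have norms at most `h`, `4h`,
  -- `13h`, and points on the last leg at most `40h`. The cap 40 ensures `h ≤ 1`.
  set δ := min (min δ₁ δ₂) 40 with hδ
  have hδ0 : 0 < δ := by positivity
  have hX := fun (η : Heis N) (hη : ‖η‖ ≤ δ) =>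
    h₁ η (hη.trans ((min_le_left _ _).trans (min_le_left _ _)))
  have hY := fun (η : Heis N) (hη : ‖η‖ ≤ δ) =>
    h₂ η (hη.trans ((min_le_left _ _).trans (min_le_right _ _)))
  refine ⟨(δ / 40) ^ 2, by positivity, fun τ hτ0 hτ ξ => ?_⟩
  set h : ℝ := √τ / 2 with hh
  have h0 : 0 ≤ h := by positivity
  have hsq : h ^ 2 = τ / 4 := by rw [hh, div_pow, Real.sq_sqrt hτ0]; norm_num
  have hsqrt : √τ ≤ δ / 40 := Real.sqrt_le_iff.mpr ⟨by positivity, hτ⟩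
  have hδ40 : δ ≤ 40 := min_le_right _ _
  have h1 : h ≤ 1 := by linarith
  have h40 : 40 * h ≤ δ := by linarith
  have habs : |h| = h := abs_of_nonneg h0
  have hnabs : |-h| = h := by rw [abs_neg, habs]
  set a : Heis N := h • hVec (Sum.inl j) with ha
  set b : Heis N := h • hVec (Sum.inr j) with hb
  set a' : Heis N := (-h) • hVec (Sum.inl j) with ha'
  set b' : Heis N := (-h) • hVec (Sum.inr j) with hb'
  have na : ‖a‖ ≤ h := by rw [ha, norm_smul, norm_hVec, mul_one, Real.norm_eq_abs, habs]
  have nab : ‖hmul a b‖ ≤ 4 * h := by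
    have := norm_hmul_smul_hVec_le a (Sum.inr j) (r := h) (by linarith)
    rw [habs] at this; linarith
  have nabc : ‖hmul (hmul a b) a'‖ ≤ 13 * h := by
    have := norm_hmul_smul_hVec_le (hmul a b) (Sum.inl j) (r := -h) (by linarith)
    rw [hnabs] at this; linarith
  have step : ∀ (η : Heis N) (i : HDir N) (s : ℝ), ‖η‖ ≤ 13 * h → |s| = h →
      ∀ r : ℝ, |r| ≤ |s| → ‖hmul η (r • hVec i)‖ ≤ δ := by
    intro η i s hη hs r hr
    have := norm_hmul_smul_hVec_le η i (r := r) (by linarith)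
    linarith
  have s1 := hw.abs_flow_sub_le (Sum.inl j) hX ξ 0 (h := h)
    (step _ _ _ (by simp; positivity) habs)
  have s2 := hw.abs_flow_sub_le (Sum.inr j) hY ξ a (h := h) (step _ _ _ (by linarith) habs)
  have s3 := hw.abs_flow_sub_le (Sum.inl j) hX ξ (hmul a b) (h := -h)
    (step _ _ _ (by linarith) hnabs)
  have s4 := hw.abs_flow_sub_le (Sum.inr j) hY ξ (hmul (hmul a b) a') (h := -h)
    (step _ _ _ nabc hnabs)
  rw [habs] at s1 s2
  rw [hnabs] at s3 s4
  have hloop := commutator_loop j h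
  rw [show -(4 * h ^ 2) = -τ by rw [hsq]; ring] at hloop
  rw [← hloop]
  rw [hmul_zero, ← ha] at s1
  rw [hmul_assoc, ← hb] at s2
  rw [hmul_assoc, ← ha'] at s3
  rw [hmul_assoc, ← hb'] at s4
  rw [← ha, ← hb, ← ha', ← hb']
  have e : ε * √τ = 4 * (ε / 2 * h) := by rw [hh]; ring
  rw [e]
  -- The linear terms, with coefficients `h, h, -h, -h` and derivatives all taken at `ξ`, cancel;
  -- four errors `(ε/2) h` with `h = √τ/2` add up to `ε √τ`.
  rw [abs_le] at s1 s2 s3 s4 ⊢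
  constructor <;> linarith

/-- The pointwise bound `o(√|τ|)` is squared and integrated over a ball containing all points where
either value of `w` is nonzero. -/
theorem exists_transIncr_center_le {w : Heis N → ℝ} {D : HDir N → Heis N → ℝ}
    (hw : HorizontalC1 w D) (j : Fin N) {ε : ℝ} (hε : 0 < ε) :
    ∃ τ₀ > 0, ∀ τ : ℝ, |τ| ≤ τ₀ →
      transIncr w (τ • tVec) ≤ ENNReal.ofReal |τ| * ENNReal.ofReal ε := by
  obtain ⟨R, hR1, hR⟩ := exists_bound_of_hasCompactSupport hw.supp
  set V : ℝ := (volume (Metric.closedBall (0 : Heis N) (3 * R + 1))).toReal with hV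
  have hVfin : volume (Metric.closedBall (0 : Heis N) (3 * R + 1)) ≠ ∞ :=
    measure_closedBall_lt_top.ne
  have hV0 : 0 ≤ V := ENNReal.toReal_nonneg
  obtain ⟨τ₀, hτ₀, hb⟩ := hw.exists_abs_center_le j (ε := √(ε / (V + 1))) (by positivity)
  refine ⟨min τ₀ 1, by positivity, fun τ hτ => ?_⟩
  have key : transIncr w ((-|τ|) • tVec) ≤ ENNReal.ofReal |τ| * ENNReal.ofReal ε := by
    have hpt : ∀ ξ, ENNReal.ofReal ((w (hmul ξ ((-|τ|) • tVec)) - w ξ) ^ 2) ≤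
        (Metric.closedBall (0 : Heis N) (3 * R + 1)).indicator
          (fun _ => ENNReal.ofReal (ε / (V + 1) * |τ|)) ξ := by
      intro ξ
      by_cases hξ : ξ ∈ Metric.closedBall (0 : Heis N) (3 * R + 1)
      · rw [Set.indicator_of_mem hξ]
        apply ENNReal.ofReal_le_ofReal
        have h1 := hb |τ| (abs_nonneg _) (hτ.trans (min_le_left _ _)) ξ
        calc _ = |w (hmul ξ ((-|τ|) • tVec)) - w ξ| ^ 2 := (sq_abs _).symm
          _ ≤ (√(ε / (V + 1)) * √|τ|) ^ 2 := by gcongr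
          _ = _ := by rw [mul_pow, Real.sq_sqrt (by positivity), Real.sq_sqrt (abs_nonneg _)]
      · rw [Set.indicator_of_notMem hξ]
        rw [mem_closedBall_zero_iff, not_le] at hξ
        have h1 : w ξ = 0 := by
          by_contra hne
          linarith [hR ξ hne]
        have h2 : w (hmul ξ ((-|τ|) • tVec)) = 0 := by
          by_contra hne
          have := norm_le_of_hmul (η := (-|τ|) • (tVec : Heis N))
            (by rw [norm_smul, norm_tVec, mul_one, norm_neg, Real.norm_eq_abs, abs_abs]
                exact hτ.trans (min_le_right _ _)) (hR _ hne)
          linarith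
        rw [h1, h2]; simp
    refine (lintegral_mono hpt).trans ?_
    rw [lintegral_indicator Metric.isClosed_closedBall.measurableSet, setLIntegral_const,
      ← ENNReal.ofReal_toReal hVfin, ← hV, ← ENNReal.ofReal_mul (by positivity),
      ← ENNReal.ofReal_mul (abs_nonneg _)]
    apply ENNReal.ofReal_le_ofReal
    calc ε / (V + 1) * |τ| * V = |τ| * (ε * (V / (V + 1))) := by ring
      _ ≤ |τ| * (ε * 1) := by
          gcongr
          rw [div_le_one (by positivity)]; linarith
      _ = _ := by ring
  rcases le_total 0 τ with h | h
  · rw [abs_of_nonneg h] at key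
    rw [← transIncr_hinv, hinv_smul_tVec, abs_of_nonneg h]
    exact key
  · rw [abs_of_nonpos h, neg_neg] at key
    rwa [abs_of_nonpos h]

end TranslationIncrements

/-! ### Mean-square increments under arbitrary small translations. -/

section SmallTranslations

/-- The horizontal coordinates of a point. -/
def hCoord (ξ : Heis N) (i : HDir N) : ℝ := Sum.elim (xc ξ) (yc ξ) i

theorem abs_hCoord_le (ξ : Heis N) (i : HDir N) : |hCoord ξ i| ≤ ‖ξ‖ := by
  rcases i with j | j
  · exact abs_xc_le ξ j
  · exact abs_yc_le ξ j

theorem hCoord_hmul_smul_hVec (ξ : Heis N) (i k : HDir N) (a : ℝ) :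
    hCoord (hmul ξ (a • hVec i)) k = hCoord ξ k + if k = i then a else 0 := by
  rcases i with i | i <;> rcases k with k | k <;>
    simp [hCoord, hVec, Pi.single_apply]

theorem eq_smul_tVec_of_hCoord {ξ : Heis N} (h : ∀ i, hCoord ξ i = 0) : ξ = tc ξ • tVec := by
  apply Heis.ext_coord
  · intro j; simpa [tVec, hCoord] using h (Sum.inl j)
  · intro j; simpa [tVec, hCoord] using h (Sum.inr j)
  · simp [tVec]

/-- A quasi-subadditive function on the group is controlled by its values on the horizontal and
the central one-parameter subgroups. -/
theorem exists_quasi_subadditive_bound_aux (S : Finset (HDir N)) :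
    ∃ c : ℝ, 1 ≤ c ∧ ∃ C : ℝ, 0 ≤ C ∧ ∀ (E : Heis N → ℝ≥0∞) (K K' : ℝ≥0∞) (τ₀ : ℝ),
      (∀ η η', E (hmul η η') ≤ 2 * E η + 2 * E η') →
      (∀ i s, E (s • hVec i) ≤ ENNReal.ofReal (s ^ 2) * K) →
      (∀ τ : ℝ, |τ| ≤ τ₀ → E (τ • tVec) ≤ ENNReal.ofReal |τ| * K') →
      ∀ η : Heis N, (∀ i, i ∉ S → hCoord η i = 0) → c * ‖η‖ ≤ τ₀ → c * ‖η‖ ≤ 1 →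
        E η ≤ ENNReal.ofReal C *
          (ENNReal.ofReal ‖η‖ * K' + ENNReal.ofReal (‖η‖ ^ 2) * K) := by
  induction S using Finset.induction_on with
  | empty =>
    refine ⟨1, le_rfl, 1, zero_le_one, fun E K K' τ₀ _ _ hT η h0 hτ _ => ?_⟩
    have hη := eq_smul_tVec_of_hCoord fun i => h0 i (by simp)
    rw [one_mul] at hτ
    have h1 := hT (tc η) ((abs_tc_le η).trans hτ)
    rw [← hη] at h1
    rw [ENNReal.ofReal_one, one_mul]
    refine h1.trans (le_trans ?_ le_self_add)
    gcongr
    exact abs_tc_le η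
  | insert i S hi ih =>
    obtain ⟨c, hc, C, hC, H⟩ := ih
    -- Removing one horizontal coordinate enlarges the norm at most 4 times, hence the bracket at
    -- most 16 times. Quasi-subadditivity doubles this and adds 2 for the horizontal leg.
    refine ⟨4 * c, by linarith, 32 * C + 2, by positivity,
      fun E K K' τ₀ hmul' hflow hT η h0 hτ h1 => ?_⟩
    set a := hCoord η i with ha
    have habs : |a| ≤ ‖η‖ := abs_hCoord_le η i
    have hη1 : ‖η‖ ≤ 1 := by nlinarith [norm_nonneg η]
    set η' := hmul η ((-a) • hVec i) with hη'
    have hback : η = hmul η' (a • hVec i) := by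
      rw [hη', hmul_assoc, smul_hVec_hmul]; simp
    have hnorm : ‖η'‖ ≤ 4 * ‖η‖ := by
      have := norm_hmul_smul_hVec_le η i (r := -a) (by rw [abs_neg]; linarith)
      rw [abs_neg] at this
      linarith
    have hz : ∀ k, k ∉ S → hCoord η' k = 0 := by
      intro k hk
      rw [hη', hCoord_hmul_smul_hVec]
      by_cases hki : k = i
      · subst hki; simp [← ha]
      · rw [if_neg hki, add_zero]
        exact h0 k (by simp [hki, hk])
    have hle : c * ‖η'‖ ≤ 4 * c * ‖η‖ := by nlinarith
    have hE' := H E K K' τ₀ hmul' hflow hT η' hz (hle.trans hτ) (hle.trans h1)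
    have hEa : E (a • hVec i) ≤ ENNReal.ofReal (‖η‖ ^ 2) * K := by
      refine (hflow i a).trans ?_
      gcongr ENNReal.ofReal ?_ * K
      rw [← sq_abs a]; gcongr
    set A := ENNReal.ofReal ‖η‖ * K' with hA
    set B := ENNReal.ofReal (‖η‖ ^ 2) * K with hB
    have hAB : ENNReal.ofReal ‖η'‖ * K' + ENNReal.ofReal (‖η'‖ ^ 2) * K ≤ 16 * (A + B) := by
      have e1 : ENNReal.ofReal ‖η'‖ ≤ 16 * ENNReal.ofReal ‖η‖ := by
        rw [show (16 : ℝ≥0∞) = ENNReal.ofReal 16 by simp, ← ENNReal.ofReal_mul (by norm_num)]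
        apply ENNReal.ofReal_le_ofReal
        linarith [norm_nonneg η]
      have e2 : ENNReal.ofReal (‖η'‖ ^ 2) ≤ 16 * ENNReal.ofReal (‖η‖ ^ 2) := by
        rw [show (16 : ℝ≥0∞) = ENNReal.ofReal 16 by simp, ← ENNReal.ofReal_mul (by norm_num)]
        apply ENNReal.ofReal_le_ofReal
        calc ‖η'‖ ^ 2 ≤ (4 * ‖η‖) ^ 2 := by gcongr
          _ = 16 * ‖η‖ ^ 2 := by ring
      calc _ ≤ 16 * ENNReal.ofReal ‖η‖ * K' + 16 * ENNReal.ofReal (‖η‖ ^ 2) * K := by gcongr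
        _ = 16 * (A + B) := by rw [hA, hB]; ring
    calc E η ≤ 2 * E η' + 2 * E (a • hVec i) := by
          conv_lhs => rw [hback]
          exact hmul' _ _
      _ ≤ 2 * (ENNReal.ofReal C * (16 * (A + B))) + 2 * (A + B) := by
          gcongr
          · exact hE'.trans (by gcongr)
          · exact hEa.trans le_add_self
      _ = (32 * ENNReal.ofReal C + 2) * (A + B) := by ring
      _ = ENNReal.ofReal (32 * C + 2) * (A + B) := by
          rw [ENNReal.ofReal_add (by positivity) (by norm_num), ENNReal.ofReal_mul (by norm_num)]
          simp

theorem exists_quasi_subadditive_bound (N : ℕ) :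
    ∃ c : ℝ, 1 ≤ c ∧ ∃ C : ℝ, 0 ≤ C ∧ ∀ (E : Heis N → ℝ≥0∞) (K K' : ℝ≥0∞) (τ₀ : ℝ),
      (∀ η η', E (hmul η η') ≤ 2 * E η + 2 * E η') →
      (∀ i s, E (s • hVec i) ≤ ENNReal.ofReal (s ^ 2) * K) →
      (∀ τ : ℝ, |τ| ≤ τ₀ → E (τ • tVec) ≤ ENNReal.ofReal |τ| * K') →
      ∀ η : Heis N, c * ‖η‖ ≤ τ₀ → c * ‖η‖ ≤ 1 →
        E η ≤ ENNReal.ofReal C *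
          (ENNReal.ofReal ‖η‖ * K' + ENNReal.ofReal (‖η‖ ^ 2) * K) := by
  obtain ⟨c, hc, C, hC, H⟩ := exists_quasi_subadditive_bound_aux (Finset.univ : Finset (HDir N))
  exact ⟨c, hc, C, hC, fun E K K' τ₀ h1 h2 h3 η => H E K K' τ₀ h1 h2 h3 η (by simp)⟩

theorem HorizontalC1.transIncr_flow_le_sum {w : Heis N → ℝ} {D : HDir N → Heis N → ℝ}
    (hw : HorizontalC1 w D) (i : HDir N) (s : ℝ) :
    transIncr w (s • hVec i) ≤ ENNReal.ofReal (s ^ 2) * ∑ i, sqInt (D i) := by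
  refine (hw.transIncr_flow_le i s).trans ?_
  gcongr
  exact Finset.single_le_sum (f := fun i => sqInt (D i)) (fun _ _ => zero_le)
    (Finset.mem_univ i)

/-- The increments of a horizontally differentiable function grow at most like the square root of
the size of the translation, in mean square. -/
theorem exists_transIncr_le (hN : 1 ≤ N) : ∃ δ > 0, ∃ C : ℝ, 0 ≤ C ∧
    ∀ (w : Heis N → ℝ) (D : HDir N → Heis N → ℝ), HorizontalC1 w D →
      ∀ η : Heis N, ‖η‖ ≤ δ →
        transIncr w η ≤ ENNReal.ofReal (C * ‖η‖) * ∑ i, sqInt (D i) := by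
  obtain ⟨c, hc, C, hC, H⟩ := exists_quasi_subadditive_bound N
  -- The central part contributes 6, and the horizontal part contributes 1 because `‖η‖² ≤ ‖η‖`.
  refine ⟨1 / c, by positivity, 7 * C, by positivity, fun w D hw η hη => ?_⟩
  have hcη : c * ‖η‖ ≤ 1 := by
    rw [le_div_iff₀ (by linarith)] at hη; linarith
  have hη1 : ‖η‖ ≤ 1 := by nlinarith [norm_nonneg η]
  have h := H (transIncr w) (∑ i, sqInt (D i)) (6 * ∑ i, sqInt (D i)) 1
    (transIncr_hmul hw.cont) hw.transIncr_flow_le_sum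
    (fun τ _ => hw.transIncr_center_le ⟨0, hN⟩ τ) η hcη hcη
  refine h.trans ?_
  set K := ∑ i, sqInt (D i)
  have h2 : ENNReal.ofReal (‖η‖ ^ 2) ≤ ENNReal.ofReal ‖η‖ := by
    apply ENNReal.ofReal_le_ofReal
    nlinarith [norm_nonneg η]
  calc _ ≤ ENNReal.ofReal C * (ENNReal.ofReal ‖η‖ * (6 * K) + ENNReal.ofReal ‖η‖ * K) := by
        gcongr
    _ = 7 * ENNReal.ofReal C * ENNReal.ofReal ‖η‖ * K := by ring
    _ = ENNReal.ofReal (7 * C * ‖η‖) * K := by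
        rw [ENNReal.ofReal_mul (by positivity), ENNReal.ofReal_mul (by norm_num)]; simp

/-- The increments of a given horizontally differentiable function are of smaller order than the
square root of the size of the translation, in mean square. -/
theorem HorizontalC1.exists_transIncr_le_small (hN : 1 ≤ N) {w : Heis N → ℝ}
    {D : HDir N → Heis N → ℝ} (hw : HorizontalC1 w D) {ε : ℝ} (hε : 0 < ε) :
    ∃ δ > 0, ∀ η : Heis N, ‖η‖ ≤ δ → transIncr w η ≤ ENNReal.ofReal (ε * ‖η‖) := by
  obtain ⟨c, hc, C, hC, H⟩ := exists_quasi_subadditive_bound N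
  have hKfin : ∑ i, sqInt (D i) ≠ ∞ :=
    (ENNReal.sum_lt_top.mpr fun i _ => sqInt_lt_top (hw.dcont i) (hw.dsupp i)).ne
  set K := (∑ i, sqInt (D i)).toReal with hK
  have hK0 : 0 ≤ K := ENNReal.toReal_nonneg
  set ε' := ε / (2 * (C + 1)) with hε'
  have hε'0 : 0 < ε' := by positivity
  obtain ⟨τ₀, hτ₀, hT⟩ := exists_transIncr_center_le hw ⟨0, hN⟩ hε'0
  -- The first two entries keep `η` in the range of the general bound; the third makes the quadratic
  -- term `‖η‖² K` at most `ε' ‖η‖`.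
  refine ⟨min (min (τ₀ / c) (1 / c)) (ε' / (K + 1)), by positivity, fun η hη => ?_⟩
  have hc0 : 0 < c := by linarith
  have h1 : c * ‖η‖ ≤ τ₀ := by
    have := hη.trans ((min_le_left _ _).trans (min_le_left _ _))
    rw [le_div_iff₀ hc0] at this; linarith
  have h2 : c * ‖η‖ ≤ 1 := by
    have := hη.trans ((min_le_left _ _).trans (min_le_right _ _))
    rw [le_div_iff₀ hc0] at this; linarith
  have h3 : ‖η‖ * (K + 1) ≤ ε' := by
    have := hη.trans (min_le_right _ _)
    rwa [le_div_iff₀ (by positivity)] at this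
  refine (H (transIncr w) _ _ τ₀ (transIncr_hmul hw.cont) hw.transIncr_flow_le_sum hT η h1 h2).trans
    ?_
  rw [← ENNReal.ofReal_toReal hKfin, ← hK, ← ENNReal.ofReal_mul (norm_nonneg _),
    ← ENNReal.ofReal_mul (by positivity), ← ENNReal.ofReal_add (by positivity) (by positivity),
    ← ENNReal.ofReal_mul hC]
  apply ENNReal.ofReal_le_ofReal
  have h4 : ‖η‖ * K ≤ ε' := by nlinarith [norm_nonneg η]
  calc C * (‖η‖ * ε' + ‖η‖ ^ 2 * K) = C * ‖η‖ * (ε' + ‖η‖ * K) := by ring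
    _ ≤ C * ‖η‖ * (ε' + ε') := by gcongr
    _ ≤ (C + 1) * ‖η‖ * (ε' + ε') := by gcongr; linarith
    _ = ε * ‖η‖ := by rw [hε']; field_simp; ring

end SmallTranslations

/-! ### From translation increments to dilation increments. -/

section SmallDilations

/-- The point `ξ⁻¹ · δ_θ ξ`. -/
theorem hinv_hmul_dil (θ : ℝ) (ξ : Heis N) :
    hmul (hinv ξ) (dil θ ξ) =
      mk (fun j => (θ - 1) * xc ξ j) (fun j => (θ - 1) * yc ξ j) ((θ ^ 2 - 1) * tc ξ) := by
  apply Heis.ext_coord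
  · intro j; simp; ring
  · intro j; simp; ring
  · have : ∀ j, θ * xc ξ j * -yc ξ j = -xc ξ j * (θ * yc ξ j) := fun j => by ring
    simp [tc_hmul, this]; ring

theorem norm_hinv_hmul_dil_le {θ : ℝ} (h1 : 1 ≤ θ) (h2 : θ ≤ 2) (ξ : Heis N) :
    ‖hmul (hinv ξ) (dil θ ξ)‖ ≤ 3 * (θ - 1) * ‖ξ‖ := by
  have hθ : 0 ≤ θ - 1 := by linarith
  apply le_of_sq_le_sq _ (by positivity)
  rw [hinv_hmul_dil, norm_sq_eq, mul_pow _ ‖ξ‖, norm_sq_eq]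
  simp only [xc_mk, yc_mk, tc_mk, mul_pow, ← Finset.mul_sum]
  have hx : 0 ≤ ∑ j, xc ξ j ^ 2 := Finset.sum_nonneg fun _ _ => sq_nonneg _
  have hy : 0 ≤ ∑ j, yc ξ j ^ 2 := Finset.sum_nonneg fun _ _ => sq_nonneg _
  have e1 : (θ - 1) ^ 2 ≤ 3 ^ 2 * (θ - 1) ^ 2 := by nlinarith [sq_nonneg (θ - 1)]
  have e2 : (θ ^ 2 - 1) ^ 2 ≤ 3 ^ 2 * (θ - 1) ^ 2 := by
    have : θ ^ 2 - 1 = (θ + 1) * (θ - 1) := by ring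
    rw [this, mul_pow]
    gcongr
    linarith
  nlinarith [mul_le_mul_of_nonneg_right e1 hx, mul_le_mul_of_nonneg_right e1 hy,
    mul_le_mul_of_nonneg_right e2 (sq_nonneg (tc ξ))]

/-- Averaging over a small ball of translations bounds the increment under a dilation by the
increments under translations. -/
theorem dilIncr_le_of_transIncr_le {w : Heis N → ℝ} (hw : Continuous w) {R : ℝ} (hR1 : 1 ≤ R)
    (hR : ∀ ξ, w ξ ≠ 0 → ‖ξ‖ ≤ R) {θ : ℝ} (h1 : 1 < θ) (h2 : 24 * (θ - 1) * R ≤ 1) {m : ℝ≥0∞}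
    (hm : ∀ η : Heis N, ‖η‖ ≤ 18 * (θ - 1) * R → transIncr w η ≤ m) :
    dilIncr w θ ≤ (2 * ENNReal.ofReal (3 ^ (2 * N + 1)) + 2) * m := by
  have hθ2 : θ ≤ 2 := by nlinarith
  have hθ0 : 0 < θ := by linarith
  -- `H` bounds the norm of `ζ = ξ⁻¹ · δ_θ ξ` when `‖ξ‖ ≤ 2R`. Since `ζ` depends on `ξ`, the
  -- increment is not that of a single translation; it is split at `ξ · η` and averaged over `η ∈
  -- B`.
  set H : ℝ := 6 * (θ - 1) * R with hH
  have hH0 : 0 < H := by have : 0 < θ - 1 := by linarith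
                         positivity
  have hH4 : H ≤ 1 / 4 := by linarith
  set B := Metric.closedBall (0 : Heis N) H with hB
  set B' := Metric.closedBall (0 : Heis N) (3 * H) with hB'
  have hBm : MeasurableSet B := Metric.isClosed_closedBall.measurableSet
  have hvol : volume B' = ENNReal.ofReal (3 ^ (2 * N + 1)) * volume B := by
    have hdim : Module.finrank ℝ (Heis N) = 2 * N + 1 := by
      simp [Heis]; ring
    have := Measure.addHaar_closedBall_mul_of_pos (volume : Measure (Heis N)) (0 : Heis N)
      (r := 3) (by norm_num) H
    rw [hdim] at this
    rw [hB', this, hB, Measure.addHaar_closedBall_center]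
  have hB0 : volume B ≠ 0 := (Metric.measure_closedBall_pos volume 0 hH0).ne'
  have hBfin : volume B ≠ ∞ := measure_closedBall_lt_top.ne
  set f : Heis N → Heis N → ℝ≥0∞ := fun ξ η =>
    ENNReal.ofReal ((w (dil θ ξ) - w (hmul (dil θ ξ) η)) ^ 2) with hf
  have hfm : Measurable (Function.uncurry f) := by
    have : Continuous fun p : Heis N × Heis N =>
        (w (dil θ p.1) - w (hmul (dil θ p.1) p.2)) ^ 2 := by fun_prop
    exact ENNReal.measurable_ofReal.comp this.measurable
  set g : Heis N → Heis N → ℝ≥0∞ := fun ξ η =>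
    ENNReal.ofReal ((w (hmul ξ η) - w ξ) ^ 2) with hg
  have hgm : Measurable (Function.uncurry g) := by
    have : Continuous fun p : Heis N × Heis N => (w (hmul p.1 p.2) - w p.1) ^ 2 := by fun_prop
    exact ENNReal.measurable_ofReal.comp this.measurable
  have hpt : ∀ ξ, volume B * ENNReal.ofReal ((w (dil θ ξ) - w ξ) ^ 2) ≤
      2 * (∫⁻ η in B', f ξ η) + 2 * ∫⁻ η in B, g ξ η := by
    intro ξ
    rcases le_or_gt ‖ξ‖ (2 * R) with hξ | hξ
    · set ζ := hmul (hinv ξ) (dil θ ξ) with hζ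
      have hζn : ‖ζ‖ ≤ H := by
        refine (norm_hinv_hmul_dil_le h1.le hθ2 ξ).trans ?_
        have : 0 ≤ θ - 1 := by linarith
        calc 3 * (θ - 1) * ‖ξ‖ ≤ 3 * (θ - 1) * (2 * R) := by gcongr
          _ = H := by rw [hH]; ring
      have hξζ : dil θ ξ = hmul ξ ζ := by rw [hζ, hmul_hinv_cancel]
      have hsplit : ∀ η, ENNReal.ofReal ((w (dil θ ξ) - w ξ) ^ 2) ≤
          2 * ENNReal.ofReal ((w (dil θ ξ) - w (hmul ξ η)) ^ 2) + 2 * g ξ η := fun η => by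
        refine le_trans (le_of_eq ?_) (ofReal_add_sq_le _ _)
        congr 1; ring
      -- Substituting `ζ η` for `η` turns `ξ η` into `(δ_θ ξ) η`, a translation independent of `ξ`,
      -- at the cost of enlarging the ball.
      have hshift : ∫⁻ η in B, ENNReal.ofReal ((w (dil θ ξ) - w (hmul ξ η)) ^ 2) ≤
          ∫⁻ η in B', f ξ η := by
        rw [← lintegral_indicator hBm, ← lintegral_indicator Metric.isClosed_closedBall.measurableSet,
          ← lintegral_hmul_left _ ζ]
        refine lintegral_mono fun η => ?_
        by_cases hmem : hmul ζ η ∈ B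
        · have hη : η ∈ B' := by
            rw [hB', mem_closedBall_zero_iff]
            rw [hB, mem_closedBall_zero_iff] at hmem
            -- This gives `‖η‖ ≤ H + H + 2H² ≤ 3H`, because `H ≤ 1/4`.
            have h3 := norm_hmul_le (hinv ζ) (hmul ζ η)
            rw [hinv_hmul_cancel, norm_hinv] at h3
            nlinarith [norm_nonneg ζ, norm_nonneg (hmul ζ η)]
          rw [Set.indicator_of_mem hmem, Set.indicator_of_mem hη]
          simp only [hf]
          rw [hξζ, hmul_assoc ξ ζ η]
        · rw [Set.indicator_of_notMem hmem]
          exact zero_le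
      have m1 : Measurable fun η =>
          2 * ENNReal.ofReal ((w (dil θ ξ) - w (hmul ξ η)) ^ 2) := by
        have : Continuous fun η => (w (dil θ ξ) - w (hmul ξ η)) ^ 2 := by fun_prop
        exact (ENNReal.measurable_ofReal.comp this.measurable).const_mul 2
      calc volume B * ENNReal.ofReal ((w (dil θ ξ) - w ξ) ^ 2)
          = ∫⁻ _ in B, ENNReal.ofReal ((w (dil θ ξ) - w ξ) ^ 2) := by
            rw [setLIntegral_const, mul_comm]
        _ ≤ ∫⁻ η in B, (2 * ENNReal.ofReal ((w (dil θ ξ) - w (hmul ξ η)) ^ 2) + 2 * g ξ η) :=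
            lintegral_mono hsplit
        _ = 2 * (∫⁻ η in B, ENNReal.ofReal ((w (dil θ ξ) - w (hmul ξ η)) ^ 2)) +
            2 * ∫⁻ η in B, g ξ η := by
            rw [lintegral_add_left m1, lintegral_const_mul' _ _ (by simp),
              lintegral_const_mul' _ _ (by simp)]
        _ ≤ _ := by gcongr
    · have e1 : w ξ = 0 := by
        by_contra hne
        linarith [hR ξ hne]
      have e2 : w (dil θ ξ) = 0 := by
        by_contra hne
        have h3 := hR _ hne
        have h4 : ‖ξ‖ ≤ ‖dil θ ξ‖ := by
          apply le_of_sq_le_sq _ (norm_nonneg _)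
          rw [norm_sq_eq, norm_sq_eq]
          simp only [xc_dil, yc_dil, tc_dil, mul_pow]
          have hsq : 1 ≤ θ ^ 2 := by nlinarith
          have hsq4 : 1 ≤ (θ ^ 2) ^ 2 := by nlinarith
          rw [← Finset.mul_sum, ← Finset.mul_sum]
          have hx : 0 ≤ ∑ j, xc ξ j ^ 2 := Finset.sum_nonneg fun _ _ => sq_nonneg _
          have hy : 0 ≤ ∑ j, yc ξ j ^ 2 := Finset.sum_nonneg fun _ _ => sq_nonneg _
          refine add_le_add ?_ (add_le_add ?_ ?_)
          · exact le_mul_of_one_le_left hx hsq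
          · exact le_mul_of_one_le_left hy hsq
          · exact le_mul_of_one_le_left (sq_nonneg _) hsq4
        linarith
      rw [e1, e2]; simp
  have hsum : volume B * dilIncr w θ ≤
      volume B * ((2 * ENNReal.ofReal (3 ^ (2 * N + 1)) + 2) * m) := by
    have hf1 : Measurable fun ξ => 2 * ∫⁻ η in B', f ξ η :=
      (hfm.lintegral_prod_right').const_mul 2
    calc volume B * dilIncr w θ
        = ∫⁻ ξ, volume B * ENNReal.ofReal ((w (dil θ ξ) - w ξ) ^ 2) :=
          (lintegral_const_mul' _ _ hBfin).symm
      _ ≤ ∫⁻ ξ, (2 * (∫⁻ η in B', f ξ η) + 2 * ∫⁻ η in B, g ξ η) := lintegral_mono hpt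
      _ = 2 * (∫⁻ η in B', ∫⁻ ξ, f ξ η) + 2 * ∫⁻ η in B, ∫⁻ ξ, g ξ η := by
          rw [lintegral_add_left hf1, lintegral_const_mul' _ _ (by simp),
            lintegral_const_mul' _ _ (by simp), lintegral_lintegral_swap hfm.aemeasurable,
            lintegral_lintegral_swap hgm.aemeasurable]
      _ ≤ 2 * (∫⁻ _ in B', m) + 2 * ∫⁻ _ in B, m := by
          gcongr 2 * ?_ + 2 * ?_
          · refine setLIntegral_mono measurable_const fun η hη => ?_
            have e := lintegral_dil θ hθ0
              fun ζ => ENNReal.ofReal ((w ζ - w (hmul ζ η)) ^ 2)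
            have e3 : ∫⁻ ζ, ENNReal.ofReal ((w ζ - w (hmul ζ η)) ^ 2) = transIncr w η := by
              unfold transIncr sqInt
              congr 1; funext ζ; congr 1; ring
            rw [e3] at e
            rw [show (∫⁻ ξ, f ξ η) = _ from e]
            have e4 : ENNReal.ofReal ((θ ^ (2 * N + 2))⁻¹) ≤ 1 := by
              rw [ENNReal.ofReal_le_one]
              exact inv_le_one_of_one_le₀ (one_le_pow₀ h1.le)
            calc _ ≤ 1 * transIncr w η := by gcongr
              _ ≤ m := by
                rw [one_mul]
                apply hm
                rw [hB', mem_closedBall_zero_iff] at hη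
                linarith
          · refine setLIntegral_mono measurable_const fun η hη => hm η ?_
            rw [hB, mem_closedBall_zero_iff] at hη
            linarith
      _ = volume B * ((2 * ENNReal.ofReal (3 ^ (2 * N + 1)) + 2) * m) := by
          rw [setLIntegral_const, setLIntegral_const, hvol]; ring
  exact (ENNReal.mul_le_mul_iff_right hB0 hBfin).mp hsum

end SmallDilations

/-! ### Dilation increments under a square integrable horizontal gradient. -/

section DilationIncrements

theorem sqInt_le_of_tendsto {f : ℕ → Heis N → ℝ} {g : Heis N → ℝ} {M : ℝ≥0∞}
    (hf : ∀ n, Measurable (f n)) (hM : ∀ n, sqInt (f n) ≤ M)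
    (hlim : ∀ ξ, Filter.Tendsto (fun n => f n ξ) Filter.atTop (nhds (g ξ))) : sqInt g ≤ M := by
  have h1 : ∀ ξ, Filter.liminf (fun n => ENNReal.ofReal (f n ξ ^ 2)) Filter.atTop =
      ENNReal.ofReal (g ξ ^ 2) := fun ξ =>
    (ENNReal.tendsto_ofReal ((hlim ξ).pow 2)).liminf_eq
  unfold sqInt
  calc ∫⁻ ξ, ENNReal.ofReal (g ξ ^ 2)
      = ∫⁻ ξ, Filter.liminf (fun n => ENNReal.ofReal (f n ξ ^ 2)) Filter.atTop := by simp only [h1]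
    _ ≤ Filter.liminf (fun n => ∫⁻ ξ, ENNReal.ofReal (f n ξ ^ 2)) Filter.atTop :=
        lintegral_liminf_le fun n => by have := hf n; fun_prop
    _ ≤ M := Filter.liminf_le_of_le (by isBoundedDefault) fun b hb => by
        obtain ⟨n, hn⟩ := hb.exists
        exact hn.trans (hM n)

/-- The constants depend only on the radius of the support, not on `w`; this uniformity is what
allows passing to limits of approximations. -/
theorem exists_dilIncr_le (hN : 1 ≤ N) {R : ℝ} (hR1 : 1 ≤ R) : ∃ θ₀ > (1 : ℝ), ∃ C : ℝ, 0 ≤ C ∧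
    ∀ (w : Heis N → ℝ) (D : HDir N → Heis N → ℝ), HorizontalC1 w D →
      (∀ ξ, w ξ ≠ 0 → ‖ξ‖ ≤ R) → ∀ θ, 1 < θ → θ < θ₀ →
        dilIncr w θ ≤ ENNReal.ofReal (C * (θ - 1)) * ∑ i, sqInt (D i) := by
  obtain ⟨δ, hδ, C, hC, H⟩ := exists_transIncr_le hN
  have hR0 : 0 < R := by linarith
  refine ⟨1 + min (1 / (24 * R)) (δ / (18 * R)), by
      have : 0 < min (1 / (24 * R)) (δ / (18 * R)) := by positivity
      linarith,
    (2 * 3 ^ (2 * N + 1) + 2) * (C * (18 * R)), by positivity,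
    fun w D hw hR θ h1 h2 => ?_⟩
  have e1 : θ - 1 ≤ 1 / (24 * R) := by
    linarith [min_le_left (1 / (24 * R)) (δ / (18 * R))]
  have e2 : θ - 1 ≤ δ / (18 * R) := by
    linarith [min_le_right (1 / (24 * R)) (δ / (18 * R))]
  rw [le_div_iff₀ (by positivity)] at e1 e2
  have hθ : 0 < θ - 1 := by linarith
  refine (dilIncr_le_of_transIncr_le hw.cont hR1 hR h1 (by linarith)
    (m := ENNReal.ofReal (C * (18 * (θ - 1) * R)) * ∑ i, sqInt (D i)) fun η hη => ?_).trans ?_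
  · refine (H w D hw η (by linarith)).trans ?_
    gcongr
  · rw [← mul_assoc]
    gcongr
    rw [show (2 : ℝ≥0∞) = ENNReal.ofReal 2 by simp, ← ENNReal.ofReal_mul (by norm_num),
      ← ENNReal.ofReal_add (by positivity) (by norm_num), ← ENNReal.ofReal_mul (by positivity)]
    apply ENNReal.ofReal_le_ofReal
    apply le_of_eq; ring

theorem HorizontalC1.exists_dilIncr_le_small (hN : 1 ≤ N) {w : Heis N → ℝ}
    {D : HDir N → Heis N → ℝ} (hw : HorizontalC1 w D) {ε : ℝ} (hε : 0 < ε) :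
    ∃ θ₀ > (1 : ℝ), ∀ θ, 1 < θ → θ < θ₀ → dilIncr w θ ≤ ENNReal.ofReal (ε * (θ - 1)) := by
  obtain ⟨R, hR1, hR⟩ := exists_bound_of_hasCompactSupport hw.supp
  have hR0 : 0 < R := by linarith
  set A : ℝ := (2 * 3 ^ (2 * N + 1) + 2) * (18 * R) with hA
  have hA0 : 0 < A := by positivity
  obtain ⟨δ, hδ, H⟩ := hw.exists_transIncr_le_small hN (ε := ε / A) (by positivity)
  refine ⟨1 + min (1 / (24 * R)) (δ / (18 * R)), by
      have : 0 < min (1 / (24 * R)) (δ / (18 * R)) := by positivity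
      linarith, fun θ h1 h2 => ?_⟩
  have e1 : θ - 1 ≤ 1 / (24 * R) := by
    linarith [min_le_left (1 / (24 * R)) (δ / (18 * R))]
  have e2 : θ - 1 ≤ δ / (18 * R) := by
    linarith [min_le_right (1 / (24 * R)) (δ / (18 * R))]
  rw [le_div_iff₀ (by positivity)] at e1 e2
  have hθ : 0 < θ - 1 := by linarith
  refine (dilIncr_le_of_transIncr_le hw.cont hR1 hR h1 (by linarith)
    (m := ENNReal.ofReal (ε / A * (18 * (θ - 1) * R))) fun η hη => ?_).trans ?_
  · refine (H η (by linarith)).trans ?_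
    gcongr
  · rw [show (2 : ℝ≥0∞) = ENNReal.ofReal 2 by simp, ← ENNReal.ofReal_mul (by norm_num),
      ← ENNReal.ofReal_add (by positivity) (by norm_num), ← ENNReal.ofReal_mul (by positivity)]
    apply ENNReal.ofReal_le_ofReal
    apply le_of_eq
    rw [hA]; field_simp

theorem HorizontalC1OffZero.measurable_deriv {y : Heis N → ℝ} {D : HDir N → Heis N → ℝ}
    (hy : HorizontalC1OffZero y D) (hD : ∀ i ξ, y ξ = 0 → D i ξ = 0) (i : HDir N) :
    Measurable (D i) := by
  classical
  have h := ContinuousOn.measurable_piecewise (hy.dcont i)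
    (continuousOn_const (c := (0 : ℝ)) (s := {ξ | y ξ ≠ 0}ᶜ)) hy.isOpen.measurableSet
  convert h using 1
  funext ξ
  by_cases hξ : y ξ = 0
  · rw [Set.piecewise_eq_of_notMem _ _ _ (by simpa using hξ), hD i ξ hξ]
  · rw [Set.piecewise_eq_of_mem _ _ _ hξ]

theorem HorizontalC1OffZero.tendsto_sqInt_sub {y : Heis N → ℝ} {D : HDir N → Heis N → ℝ}
    (hy : HorizontalC1OffZero y D) (hD : ∀ i ξ, y ξ = 0 → D i ξ = 0) (i : HDir N)
    (hfin : sqInt (D i) ≠ ∞) :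
    Filter.Tendsto (fun ε => sqInt fun ξ => (1 - softThrDeriv ε (y ξ)) * D i ξ)
      (nhdsWithin 0 (Set.Ioi 0)) (nhds 0) := by
  have hm := hy.measurable_deriv hD i
  have hym := hy.cont.measurable
  have h0 : ∫⁻ _ : Heis N, (0 : ℝ≥0∞) = 0 := lintegral_zero
  rw [← h0]
  refine tendsto_lintegral_filter_of_dominated_convergence
    (fun ξ => ENNReal.ofReal (D i ξ ^ 2)) ?_ ?_ hfin ?_
  · filter_upwards [self_mem_nhdsWithin] with ε hε
    have := (continuous_softThrDeriv hε).measurable.comp hym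
    simp only [Function.comp_def] at this
    fun_prop
  · filter_upwards [self_mem_nhdsWithin] with ε hε
    refine Filter.Eventually.of_forall fun ξ => ENNReal.ofReal_le_ofReal ?_
    have h1 := softThrDeriv_nonneg hε (y ξ)
    have h2 := softThrDeriv_le_one ε (y ξ)
    rw [mul_pow]
    have : (1 - softThrDeriv ε (y ξ)) ^ 2 ≤ 1 := by nlinarith
    nlinarith [sq_nonneg (D i ξ)]
  · refine Filter.Eventually.of_forall fun ξ => ?_
    by_cases hξ : y ξ = 0
    · simp [hD i ξ hξ]
    · have h1 := tendsto_softThrDeriv hξ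
      have h2 : Filter.Tendsto (fun ε => ((1 - softThrDeriv ε (y ξ)) * D i ξ) ^ 2)
          (nhdsWithin 0 (Set.Ioi 0)) (nhds (((1 - 1) * D i ξ) ^ 2)) :=
        ((h1.const_sub 1).mul_const _).pow 2
      simpa using ENNReal.tendsto_ofReal h2

/-- The increments under dilations of a compactly supported function with square integrable
horizontal gradient are `o(θ - 1)` in mean square. -/
theorem HorizontalC1OffZero.exists_dilIncr_le_small (hN : 1 ≤ N) {y : Heis N → ℝ}
    {D : HDir N → Heis N → ℝ} (hy : HorizontalC1OffZero y D)
    (hD : ∀ i ξ, y ξ = 0 → D i ξ = 0) (hfin : ∀ i, sqInt (D i) ≠ ∞) {ε : ℝ} (hε : 0 < ε) :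
    ∃ θ₀ > (1 : ℝ), ∀ θ, 1 < θ → θ < θ₀ → dilIncr y θ ≤ ENNReal.ofReal (ε * (θ - 1)) := by
  obtain ⟨R, hR1, hR⟩ := exists_bound_of_hasCompactSupport hy.supp
  -- These constants are fixed before the level `δ`, which is then chosen so that the tail of the
  -- gradient, multiplied by `C`, is small.
  obtain ⟨θ₁, hθ₁, C, hC, H⟩ := exists_dilIncr_le hN hR1
  have htail : Filter.Tendsto
      (fun δ => ∑ i, sqInt fun ξ => (1 - softThrDeriv δ (y ξ)) * D i ξ)
      (nhdsWithin 0 (Set.Ioi 0)) (nhds 0) := by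
    have := tendsto_finsetSum (Finset.univ : Finset (HDir N))
      fun i _ => hy.tendsto_sqInt_sub hD i (hfin i)
    simpa using this
  set κ : ℝ := ε / (4 * (C + 1)) with hκ
  have hκ0 : 0 < κ := by positivity
  have hev := htail.eventually (gt_mem_nhds (ENNReal.ofReal_pos.mpr hκ0))
  obtain ⟨δ, hδκ, hδ⟩ := (hev.and self_mem_nhdsWithin).exists
  have hδκ' : ∑ i, sqInt (fun ξ => (1 - softThrDeriv δ (y ξ)) * D i ξ) ≤ ENNReal.ofReal κ :=
    le_of_lt hδκ
  have hwδ := hy.comp_softThr hδ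
  obtain ⟨θ₂, hθ₂, H2⟩ := hwδ.exists_dilIncr_le_small hN (ε := ε / 4) (by positivity)
  refine ⟨min θ₁ θ₂, lt_min hθ₁ hθ₂, fun θ h1 h2 => ?_⟩
  have hθ0 : 0 < θ - 1 := by linarith
  set z : Heis N → ℝ := fun ξ => y ξ - softThr δ (y ξ) with hz
  have hzc : Continuous z := hy.cont.sub hwδ.cont
  -- The tail `z` need not be differentiable at zeros of `y`. It is the limit of differences of two
  -- truncations, whose gradients are dominated by the same tail, and Fatou's lemma passes the
  -- uniform bound to `z`.
  have hz_le : dilIncr z θ ≤ ENNReal.ofReal (C * (θ - 1)) * ENNReal.ofReal κ := by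
    set e : ℕ → ℝ := fun n => δ / (n + 1) with he
    have hepos : ∀ n, 0 < e n := fun n => by positivity
    have hele : ∀ n, e n ≤ δ := fun n => div_le_self hδ.le (by
      have : (0 : ℝ) ≤ n := n.cast_nonneg
      linarith)
    have helim : Filter.Tendsto e Filter.atTop (nhdsWithin 0 (Set.Ioi 0)) := by
      refine tendsto_nhdsWithin_iff.mpr ⟨?_, Filter.Eventually.of_forall hepos⟩
      have := (tendsto_one_div_add_atTop_nhds_zero_nat (𝕜 := ℝ)).const_mul δ
      simpa [he, div_eq_mul_inv] using this
    set f : ℕ → Heis N → ℝ := fun n ξ => softThr (e n) (y ξ) - softThr δ (y ξ) with hf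
    have hf1 : ∀ n, HorizontalC1 (f n) _ := fun n => (hy.comp_softThr (hepos n)).sub hwδ
    refine sqInt_le_of_tendsto (f := fun n ξ => f n (dil θ ξ) - f n ξ) (fun n => ?_) (fun n => ?_)
      fun ξ => ?_
    · have hc : Continuous (f n) := (hf1 n).cont
      exact Continuous.measurable (by fun_prop)
    · refine (H (f n) _ (hf1 n) (fun ξ hξ => hR ξ fun h0 => hξ ?_) θ h1
        (h2.trans_le (min_le_left _ _))).trans ?_
      · simp [hf, h0, softThr]
      · gcongr
        refine le_trans (Finset.sum_le_sum fun i _ => ?_) hδκ'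
        refine lintegral_mono fun ξ => ENNReal.ofReal_le_ofReal ?_
        have a1 := softThrDeriv_anti (hepos n) (hele n) (y ξ)
        have a2 := softThrDeriv_le_one (e n) (y ξ)
        simp only [← sub_mul, mul_pow]
        gcongr
    · have hl : ∀ ζ, Filter.Tendsto (fun n => f n ζ) Filter.atTop (nhds (z ζ)) := fun ζ =>
        ((tendsto_softThr (y ζ)).comp helim).sub_const _
      exact (hl _).sub (hl _)
  have hsum : dilIncr y θ ≤ 2 * dilIncr z θ + 2 * dilIncr (fun ξ => softThr δ (y ξ)) θ := by
    have e1 : dilIncr y θ = sqInt fun ξ => (z (dil θ ξ) - z ξ) +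
        (softThr δ (y (dil θ ξ)) - softThr δ (y ξ)) := by
      unfold dilIncr
      congr 1; funext ξ
      simp only [hz]; ring
    rw [e1]
    exact sqInt_add_le (by fun_prop)
  refine hsum.trans ?_
  calc _ ≤ 2 * (ENNReal.ofReal (C * (θ - 1)) * ENNReal.ofReal κ) +
        2 * ENNReal.ofReal (ε / 4 * (θ - 1)) := by
        gcongr
        exact H2 θ h1 (h2.trans_le (min_le_right _ _))
    _ = ENNReal.ofReal (2 * (C * (θ - 1) * κ) + 2 * (ε / 4 * (θ - 1))) := by
        rw [← ENNReal.ofReal_mul (by positivity), show (2 : ℝ≥0∞) = ENNReal.ofReal 2 by simp,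
          ← ENNReal.ofReal_mul (by norm_num), ← ENNReal.ofReal_mul (by norm_num),
          ← ENNReal.ofReal_add (by positivity) (by positivity)]
    _ ≤ ENNReal.ofReal (ε * (θ - 1)) := by
        apply ENNReal.ofReal_le_ofReal
        have : C * κ ≤ ε / 4 := by
          rw [hκ, mul_div_assoc', div_le_div_iff₀ (by positivity) (by norm_num)]
          nlinarith
        nlinarith

end DilationIncrements

/-! ### Convolution energies with an integrable symmetric kernel. -/

section Convolution

/-- The potential of `p` for the convolution kernel `k`. -/
noncomputable def kernelPot (k p : Heis N → ℝ) (ξ : Heis N) : ℝ :=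
  ∫ η, p η * k (hmul (hinv η) ξ)

theorem integrable_kernel {k p r : Heis N → ℝ} (hkm : Measurable k) (hk : Integrable k)
    (hp : Continuous p) (hpc : HasCompactSupport p) (hr : Continuous r) {M : ℝ}
    (hM : ∀ ξ, |r ξ| ≤ M) :
    Integrable (Function.uncurry fun ξ η : Heis N => p η * r ξ * k (hmul (hinv η) ξ))
      (volume.prod volume) := by
  have hpi : Integrable p := hp.integrable_of_hasCompactSupport hpc
  have hmeas : Measurable (Function.uncurry fun ξ η : Heis N =>
      p η * r ξ * k (hmul (hinv η) ξ)) := by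
    have h1 : Continuous fun z : Heis N × Heis N => p z.2 * r z.1 := by fun_prop
    have h2 : Continuous fun z : Heis N × Heis N => hmul (hinv z.2) z.1 := by fun_prop
    exact h1.measurable.mul (hkm.comp h2.measurable)
  have hkt : ∀ η : Heis N, Integrable fun ξ => k (hmul (hinv η) ξ) := fun η =>
    (measurePreserving_hmul_left (hinv η)).integrable_comp_of_integrable hk
  have hslice : ∀ η : Heis N, Integrable fun ξ => p η * r ξ * k (hmul (hinv η) ξ) := by
    intro η
    refine (hkt η).bdd_mul (c := |p η| * M) (by fun_prop) (Filter.Eventually.of_forall fun ξ => ?_)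
    rw [Real.norm_eq_abs, abs_mul]
    gcongr
    exact hM ξ
  refine (integrable_prod_iff' hmeas.aestronglyMeasurable).mpr
    ⟨Filter.Eventually.of_forall hslice, ?_⟩
  refine Integrable.mono' (hpi.norm.mul_const (M * ∫ ξ, ‖k ξ‖))
    (hmeas.aestronglyMeasurable.norm.prod_swap.integral_prod_right')
    (Filter.Eventually.of_forall fun η => ?_)
  rw [Real.norm_of_nonneg (integral_nonneg fun _ => norm_nonneg _)]
  have e : ∫ ξ, ‖k ξ‖ = ∫ ξ, ‖k (hmul (hinv η) ξ)‖ :=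
    (integral_hmul_left (fun ξ => ‖k ξ‖) (hinv η)).symm
  rw [e, ← integral_const_mul, ← integral_const_mul]
  refine integral_mono (hslice η).norm (((hkt η).norm.const_mul M).const_mul ‖p η‖) fun ξ => ?_
  simp only [Function.uncurry, norm_mul]
  rw [mul_assoc]
  gcongr
  exact hM ξ

theorem exists_abs_le_of_hasCompactSupport {f : Heis N → ℝ} (hf : Continuous f)
    (hc : HasCompactSupport f) : ∃ M : ℝ, 0 ≤ M ∧ ∀ ξ, |f ξ| ≤ M := by
  obtain ⟨M, hM⟩ := hf.bounded_above_of_compact_support hc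
  exact ⟨max M 0, le_max_right _ _, fun ξ => (hM ξ).trans (le_max_left _ _)⟩

theorem integrable_kernelPot_mul {k p r : Heis N → ℝ} (hkm : Measurable k) (hk : Integrable k)
    (hp : Continuous p) (hpc : HasCompactSupport p) (hr : Continuous r)
    (hrc : HasCompactSupport r) : Integrable fun ξ => kernelPot k p ξ * r ξ := by
  obtain ⟨M, _, hM⟩ := exists_abs_le_of_hasCompactSupport hr hrc
  refine (integrable_kernel hkm hk hp hpc hr hM).integral_prod_left.congr
    (Filter.Eventually.of_forall fun ξ => ?_)
  simp only [Function.uncurry, kernelPot]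
  rw [← integral_mul_const]
  congr 1; funext η; ring

theorem integral_kernelPot_mul (k p r : Heis N → ℝ) :
    ∫ ξ, kernelPot k p ξ * r ξ = ∫ ξ, ∫ η, p η * r ξ * k (hmul (hinv η) ξ) := by
  congr 1; funext ξ
  rw [kernelPot, ← integral_mul_const]
  congr 1; funext η; ring

theorem abs_kernelPot_le {k p : Heis N → ℝ} (hk : Integrable k) (hk0 : ∀ ζ, 0 ≤ k ζ)
    (hsymm : ∀ ζ, k (hinv ζ) = k ζ) {M : ℝ} (hM : ∀ ξ, |p ξ| ≤ M) (ξ : Heis N) :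
    |kernelPot k p ξ| ≤ M * ∫ ζ, k ζ := by
  have hs : ∀ η, k (hmul (hinv η) ξ) = k (hmul (hinv ξ) η) := fun η => by
    rw [← hsymm, hinv_hmul, hinv_hinv]
  have hi : Integrable fun η => k (hmul (hinv ξ) η) :=
    (measurePreserving_hmul_left (hinv ξ)).integrable_comp_of_integrable hk
  unfold kernelPot
  simp only [hs]
  rw [← integral_hmul_left k (hinv ξ), ← integral_const_mul]
  refine (norm_integral_le_integral_norm (fun η => p η * k (hmul (hinv ξ) η))).trans ?_
  refine integral_mono_of_nonneg (Filter.Eventually.of_forall fun _ => norm_nonneg _)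
    (hi.const_mul M) (Filter.Eventually.of_forall fun η => ?_)
  simp only [norm_mul, Real.norm_eq_abs]
  rw [abs_of_nonneg (hk0 _)]
  exact mul_le_mul_of_nonneg_right (hM η) (hk0 _)

theorem integral_kernelPot_mul_comm {k p r : Heis N → ℝ} (hkm : Measurable k) (hk : Integrable k)
    (hsymm : ∀ ζ, k (hinv ζ) = k ζ) (hp : Continuous p) (hpc : HasCompactSupport p)
    (hr : Continuous r) (hrc : HasCompactSupport r) :
    ∫ ξ, kernelPot k p ξ * r ξ = ∫ ξ, kernelPot k r ξ * p ξ := by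
  obtain ⟨M, _, hM⟩ := exists_abs_le_of_hasCompactSupport hr hrc
  rw [integral_kernelPot_mul, integral_kernelPot_mul,
    integral_integral_swap (integrable_kernel hkm hk hp hpc hr hM)]
  congr 1; funext η; congr 1; funext ξ
  rw [← hsymm, hinv_hmul, hinv_hinv]; ring

/-- Schur's test: `d(ξ) d(η) ≤ (d(ξ)² + d(η)²)/2`, and the two halves integrate to the same value.
This makes the error in the mixed energy quadratic without any positive definiteness of the kernel.
-/
theorem integral_kernelPot_mul_self_le {k d : Heis N → ℝ} (hkm : Measurable k)
    (hk : Integrable k) (hk0 : ∀ ζ, 0 ≤ k ζ) (hsymm : ∀ ζ, k (hinv ζ) = k ζ)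
    (hd : Continuous d) (hdc : HasCompactSupport d) :
    ∫ ξ, kernelPot k d ξ * d ξ ≤ (∫ ζ, k ζ) * ∫ ξ, d ξ ^ 2 := by
  obtain ⟨M, _, hM⟩ := exists_abs_le_of_hasCompactSupport hd hdc
  have hd2 : Continuous fun ξ => d ξ ^ 2 := by fun_prop
  have hd2c : HasCompactSupport fun ξ => d ξ ^ 2 := HasCompactSupport.intro hdc fun ξ hξ => by
    rw [image_eq_zero_of_notMem_tsupport hξ]; norm_num
  have i0 := integrable_kernel hkm hk hd hdc hd hM
  have i1 := integrable_kernel hkm hk hd2 hd2c (r := fun _ => 1) continuous_const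
    (M := 1) (by simp)
  have i2 := i1.swap
  have hval : ∫ η : Heis N, ∫ ξ : Heis N, d η ^ 2 * 1 * k (hmul (hinv η) ξ) =
      (∫ ζ, k ζ) * ∫ ξ, d ξ ^ 2 := by
    rw [← integral_const_mul]
    congr 1; funext η
    rw [integral_const_mul, integral_hmul_left]; ring
  rw [integral_kernelPot_mul, integral_integral i0]
  have h1 : ∫ z, Function.uncurry (fun ξ η : Heis N => d η ^ 2 * 1 * k (hmul (hinv η) ξ)) z
      ∂(volume.prod volume) = (∫ ζ, k ζ) * ∫ ξ, d ξ ^ 2 := by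
    rw [← hval, ← integral_integral_swap i1, integral_integral i1]
    rfl
  have h2 : ∫ z, (Function.uncurry (fun ξ η : Heis N => d η ^ 2 * 1 * k (hmul (hinv η) ξ)) ∘
      Prod.swap) z ∂(volume.prod volume) = (∫ ζ, k ζ) * ∫ ξ, d ξ ^ 2 := by
    rw [← h1]
    exact integral_prod_swap _
  have h3 : (∫ ζ, k ζ) * ∫ ξ, d ξ ^ 2 = ∫ z, (1 / 2 *
      Function.uncurry (fun ξ η : Heis N => d η ^ 2 * 1 * k (hmul (hinv η) ξ)) z + 1 / 2 *
      (Function.uncurry (fun ξ η : Heis N => d η ^ 2 * 1 * k (hmul (hinv η) ξ)) ∘ Prod.swap) z)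
      ∂(volume.prod volume) := by
    rw [integral_add (i1.const_mul _) (i2.const_mul _), integral_const_mul, integral_const_mul,
      h1, h2]
    ring
  rw [h3]
  refine integral_mono i0 ((i1.const_mul _).add (i2.const_mul _)) fun z => ?_
  obtain ⟨ξ, η⟩ := z
  have e : k (hmul (hinv ξ) η) = k (hmul (hinv η) ξ) := by
    rw [← hsymm, hinv_hmul, hinv_hinv]
  simp only [Function.uncurry, Function.comp, Prod.swap, mul_one, e]
  nlinarith [mul_nonneg (sq_nonneg (d ξ - d η)) (hk0 (hmul (hinv η) ξ))]

/-- A lower bound for the mixed energy of `p` and `r` by their self energies. -/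
theorem kernelPot_mixed_ge {k p r : Heis N → ℝ} (hkm : Measurable k)
    (hk : Integrable k) (hk0 : ∀ ζ, 0 ≤ k ζ) (hsymm : ∀ ζ, k (hinv ζ) = k ζ)
    (hp : Continuous p) (hpc : HasCompactSupport p) (hr : Continuous r)
    (hrc : HasCompactSupport r) :
    (∫ ξ, kernelPot k p ξ * p ξ) + (∫ ξ, kernelPot k r ξ * r ξ) -
      (∫ ζ, k ζ) * ∫ ξ, (p ξ - r ξ) ^ 2 ≤ 2 * ∫ ξ, kernelPot k p ξ * r ξ := by
  have h := integral_kernelPot_mul_self_le hkm hk hk0 hsymm (hp.sub hr) (hpc.sub hrc)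
  have hsub : ∀ ξ, kernelPot k (p - r) ξ = kernelPot k p ξ - kernelPot k r ξ := by
    intro ξ
    have hs : ∀ η, k (hmul (hinv η) ξ) = k (hmul (hinv ξ) η) := fun η => by
      rw [← hsymm, hinv_hmul, hinv_hinv]
    have hi : Integrable fun η => k (hmul (hinv η) ξ) := by
      simp only [hs]
      exact (measurePreserving_hmul_left (hinv ξ)).integrable_comp_of_integrable hk
    have hint : ∀ f : Heis N → ℝ, Continuous f → HasCompactSupport f →
        Integrable fun η => f η * k (hmul (hinv η) ξ) := by
      intro f hf hfc
      obtain ⟨M, _, hM⟩ := exists_abs_le_of_hasCompactSupport hf hfc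
      exact hi.bdd_mul (c := M) hf.aestronglyMeasurable (Filter.Eventually.of_forall hM)
    unfold kernelPot
    rw [← integral_sub (hint p hp hpc) (hint r hr hrc)]
    congr 1; funext η
    simp only [Pi.sub_apply]; ring
  have ipp := integrable_kernelPot_mul hkm hk hp hpc hp hpc
  have ipr := integrable_kernelPot_mul hkm hk hp hpc hr hrc
  have irp := integrable_kernelPot_mul hkm hk hr hrc hp hpc
  have irr := integrable_kernelPot_mul hkm hk hr hrc hr hrc
  have hcomm := integral_kernelPot_mul_comm hkm hk hsymm hp hpc hr hrc
  have hexp : ∫ ξ, kernelPot k (p - r) ξ * (p - r) ξ =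
      (∫ ξ, kernelPot k p ξ * p ξ) - (∫ ξ, kernelPot k p ξ * r ξ) -
        ((∫ ξ, kernelPot k r ξ * p ξ) - ∫ ξ, kernelPot k r ξ * r ξ) := by
    have e1 := integral_sub (ipp.sub ipr) (irp.sub irr)
    simp only [Pi.sub_apply] at e1
    rw [← integral_sub ipp ipr, ← integral_sub irp irr, ← e1]
    congr 1; funext ξ
    rw [hsub]
    simp only [Pi.sub_apply]; ring
  rw [hexp] at h
  simp only [Pi.sub_apply] at h
  linarith

end Convolution

/-! ### The homogeneous norm and local integrability of the Riesz kernel. -/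

section HomogeneousNorm

theorem continuous_hnorm : Continuous (hnorm : Heis N → ℝ) := by
  unfold hnorm
  refine Continuous.rpow_const (by fun_prop) fun _ => Or.inr (by norm_num)

theorem hnorm_nonneg (ξ : Heis N) : 0 ≤ hnorm ξ := by unfold hnorm; positivity

theorem hnorm_hinv (ξ : Heis N) : hnorm (hinv ξ) = hnorm ξ := by simp [hnorm]

theorem hnorm_pow_four (ξ : Heis N) :
    hnorm ξ ^ 4 = tc ξ ^ 2 + (∑ j, (xc ξ j ^ 2 + yc ξ j ^ 2)) ^ 2 := by
  rw [hnorm, ← Real.rpow_natCast, ← Real.rpow_mul (by positivity)]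
  norm_num

theorem hnorm_dil {θ : ℝ} (hθ : 0 ≤ θ) (ξ : Heis N) : hnorm (dil θ ξ) = θ * hnorm ξ := by
  have h : hnorm (dil θ ξ) ^ 4 = (θ * hnorm ξ) ^ 4 := by
    rw [mul_pow, hnorm_pow_four, hnorm_pow_four]
    simp only [xc_dil, yc_dil, tc_dil, mul_pow, ← mul_add, ← Finset.mul_sum]
    ring
  exact (pow_left_inj₀ (hnorm_nonneg _) (mul_nonneg hθ (hnorm_nonneg _)) (by norm_num)).mp h

theorem sq_xc_add_sq_yc_le (ξ : Heis N) (j : Fin N) : xc ξ j ^ 2 + yc ξ j ^ 2 ≤ hnorm ξ ^ 2 := by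
  have h1 : xc ξ j ^ 2 + yc ξ j ^ 2 ≤ ∑ j, (xc ξ j ^ 2 + yc ξ j ^ 2) :=
    Finset.single_le_sum (f := fun j => xc ξ j ^ 2 + yc ξ j ^ 2) (fun _ _ => by positivity)
      (Finset.mem_univ j)
  refine h1.trans (le_of_sq_le_sq ?_ (by positivity))
  have := hnorm_pow_four ξ
  nlinarith [sq_nonneg (tc ξ)]

theorem abs_xc_le_hnorm (ξ : Heis N) (j : Fin N) : |xc ξ j| ≤ hnorm ξ :=
  abs_le_of_sq_le_sq (by nlinarith [sq_xc_add_sq_yc_le ξ j, sq_nonneg (yc ξ j)]) (hnorm_nonneg ξ)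

theorem abs_yc_le_hnorm (ξ : Heis N) (j : Fin N) : |yc ξ j| ≤ hnorm ξ :=
  abs_le_of_sq_le_sq (by nlinarith [sq_xc_add_sq_yc_le ξ j, sq_nonneg (xc ξ j)]) (hnorm_nonneg ξ)

theorem abs_tc_le_hnorm_sq (ξ : Heis N) : |tc ξ| ≤ hnorm ξ ^ 2 := by
  refine abs_le_of_sq_le_sq ?_ (by positivity)
  have := hnorm_pow_four ξ
  nlinarith [sq_nonneg (∑ j, (xc ξ j ^ 2 + yc ξ j ^ 2))]

/-- The Riesz-type kernel `|ζ|^(-lam)`. -/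
noncomputable def rieszKernel (lam : ℝ) (ζ : Heis N) : ℝ := (hnorm ζ ^ lam)⁻¹

theorem rieszKernel_nonneg (lam : ℝ) (ζ : Heis N) : 0 ≤ rieszKernel lam ζ := by
  have := hnorm_nonneg ζ
  unfold rieszKernel; positivity

theorem rieszKernel_hinv (lam : ℝ) (ζ : Heis N) : rieszKernel lam (hinv ζ) = rieszKernel lam ζ := by
  rw [rieszKernel, hnorm_hinv, rieszKernel]

theorem rieszKernel_dil {lam θ : ℝ} (hθ : 0 < θ) (ζ : Heis N) :
    rieszKernel lam (dil θ ζ) = (θ ^ lam)⁻¹ * rieszKernel lam ζ := by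
  rw [rieszKernel, hnorm_dil hθ.le, Real.mul_rpow hθ.le (hnorm_nonneg ζ), mul_inv, rieszKernel]

theorem measurable_rieszKernel (lam : ℝ) : Measurable (rieszKernel lam : Heis N → ℝ) := by
  have := (continuous_hnorm (N := N)).measurable
  unfold rieszKernel
  fun_prop

/-- Each horizontal coordinate has weight 1 and `t` has weight 2, so the weights sum to `Q` and the
exponents to `lam`. Each one-variable exponent `lam / Q` is below 1 when `lam < Q`, so the kernel is
dominated by a product of locally integrable functions. -/
theorem prod_rpow_le_hnorm {lam : ℝ} (hlam : 0 < lam) (ξ : Heis N) :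
    ∏ i, |ξ i| ^ (lam / homDim N) ≤ hnorm ξ ^ lam := by
  have hQ : 0 < homDim N := by unfold homDim; positivity
  set a := lam / homDim N with ha
  have ha0 : 0 < a := by positivity
  set n := hnorm ξ with hn
  have hn0 : 0 ≤ n := hnorm_nonneg ξ
  have hx : ∏ j : Fin N, |ξ (Sum.inl j)| ^ a ≤ (n ^ a) ^ N := by
    have h := Finset.prod_le_prod (s := (Finset.univ : Finset (Fin N)))
      (f := fun j => |ξ (Sum.inl j)| ^ a) (g := fun _ => n ^ a) (fun j _ => by positivity)
      fun j _ => Real.rpow_le_rpow (abs_nonneg _) (abs_xc_le_hnorm ξ j) ha0.le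
    simpa using h
  have hy : ∏ j : Fin N, |ξ (Sum.inr (Sum.inl j))| ^ a ≤ (n ^ a) ^ N := by
    have h := Finset.prod_le_prod (s := (Finset.univ : Finset (Fin N)))
      (f := fun j => |ξ (Sum.inr (Sum.inl j))| ^ a) (g := fun _ => n ^ a)
      (fun j _ => by positivity)
      fun j _ => Real.rpow_le_rpow (abs_nonneg _) (abs_yc_le_hnorm ξ j) ha0.le
    simpa using h
  have ht : |ξ (Sum.inr (Sum.inr ()))| ^ a ≤ (n ^ a) ^ 2 := by
    have h := Real.rpow_le_rpow (abs_nonneg _) (abs_tc_le_hnorm_sq ξ) ha0.le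
    have e : (n ^ 2) ^ a = (n ^ a) ^ 2 := by
      rw [← Real.rpow_natCast, ← Real.rpow_natCast, ← Real.rpow_mul hn0, ← Real.rpow_mul hn0,
        mul_comm]
    rw [← e]; exact h
  have e : n ^ lam = (n ^ a) ^ N * ((n ^ a) ^ N * (n ^ a) ^ 2) := by
    rw [← pow_add, ← pow_add, ← Real.rpow_natCast, ← Real.rpow_mul hn0]
    congr 1
    rw [ha]
    unfold homDim at hQ ⊢
    push_cast
    field_simp
    ring
  rw [e]
  simp only [Fintype.prod_sum_type, Finset.univ_unique, Finset.prod_singleton]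
  have hb : 0 ≤ ∏ j : Fin N, |ξ (Sum.inr (Sum.inl j))| ^ a :=
    Finset.prod_nonneg fun _ _ => by positivity
  gcongr

theorem integrableOn_inv_abs_rpow {a : ℝ} (ha : a < 1) {R : ℝ} (hR : 0 ≤ R) :
    IntegrableOn (fun x : ℝ => (|x| ^ a)⁻¹) (Set.Ioc (-R) R) := by
  have h1 : IntervalIntegrable (fun x : ℝ => (|x| ^ a)⁻¹) volume 0 R := by
    refine (intervalIntegral.intervalIntegrable_rpow' (r := -a) (by linarith)).congr fun x hx => ?_
    rw [Set.uIoc_of_le hR] at hx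
    rw [abs_of_pos hx.1, Real.rpow_neg hx.1.le]
  have h2 : IntervalIntegrable (fun x : ℝ => (|x| ^ a)⁻¹) volume (-R) 0 := by
    have h3 := (IntervalIntegrable.iff_comp_neg (by simp)).mp h1
    simpa using h3.symm
  exact (intervalIntegrable_iff_integrableOn_Ioc_of_le (by linarith)).mp (h2.trans h1)

/-- The kernel `|ζ|^(-lam)` is locally integrable for `lam` below the homogeneous dimension. -/
theorem integrable_rieszKernel_indicator {lam : ℝ} (hlam : 0 < lam) (hlamQ : lam < homDim N)
    {R : ℝ} (hR : 0 ≤ R) :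
    Integrable ((Metric.closedBall (0 : Heis N) R).indicator (rieszKernel lam)) := by
  have hQ : 0 < homDim N := hlam.trans hlamQ
  set a := lam / homDim N with ha
  have ha1 : a < 1 := by rw [ha, div_lt_one hQ]; exact hlamQ
  set φ : ℝ → ℝ := (Set.Ioc (-(R + 1)) (R + 1)).indicator fun x => (|x| ^ a)⁻¹ with hφ
  have hφi : Integrable φ := (integrableOn_inv_abs_rpow ha1 (by linarith)).integrable_indicator
    measurableSet_Ioc
  have hprod : Integrable fun x : Fin N ⊕ Fin N ⊕ Unit → ℝ => ∏ i, φ (x i) :=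
    Integrable.fintype_prod (f := fun _ => φ) fun _ => hφi
  have hprod' : Integrable fun ξ : Heis N => ∏ i, φ (ξ i) :=
    (PiLp.volume_preserving_ofLp (Fin N ⊕ Fin N ⊕ Unit)).integrable_comp_of_integrable hprod
  -- Inverting the product bound needs a positive product: at a vanishing coordinate the convention
  -- `0⁻¹ = 0` would spoil the inequality.
  have hae : ∀ᵐ ξ : Heis N, ∀ i, ξ i ≠ 0 := by
    rw [Filter.eventually_all]
    intro i
    exact (PiLp.volume_preserving_ofLp (Fin N ⊕ Fin N ⊕ Unit)).quasiMeasurePreserving.ae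
      (Measure.ae_eval_ne (fun _ => volume) i 0)
  refine hprod'.mono' ((measurable_rieszKernel lam).indicator
    Metric.isClosed_closedBall.measurableSet).aestronglyMeasurable ?_
  filter_upwards [hae] with ξ hξ
  by_cases hmem : ξ ∈ Metric.closedBall (0 : Heis N) R
  · rw [Set.indicator_of_mem hmem, Real.norm_of_nonneg (rieszKernel_nonneg _ _)]
    rw [mem_closedBall_zero_iff] at hmem
    have e : ∀ i, φ (ξ i) = (|ξ i| ^ a)⁻¹ := fun i => by
      have h1 : |ξ i| ≤ R := (PiLp.norm_apply_le ξ i).trans hmem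
      rw [abs_le] at h1
      have h2 : ξ i ∈ Set.Ioc (-(R + 1)) (R + 1) := ⟨by linarith, by linarith⟩
      rw [hφ, Set.indicator_of_mem h2]
    simp only [e, Finset.prod_inv_distrib]
    refine inv_anti₀ (Finset.prod_pos fun i _ => ?_) (prod_rpow_le_hnorm hlam ξ)
    exact Real.rpow_pos_of_pos (abs_pos.mpr (hξ i)) _
  · rw [Set.indicator_of_notMem hmem, norm_zero]
    refine Finset.prod_nonneg fun i _ => Set.indicator_nonneg (fun x _ => by positivity) _

/-- Scaling of the energy of a dilated density. -/
theorem rieszEnergy_dil {lam θ : ℝ} (hθ : 0 < θ) (p : Heis N → ℝ) :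
    ∫ ξ, ∫ η, p (dil θ η) * p (dil θ ξ) * rieszKernel lam (hmul (hinv η) ξ) =
      θ ^ (lam - 2 * homDim N) * ∫ ξ, ∫ η, p η * p ξ * rieszKernel lam (hmul (hinv η) ξ) := by
  have h1 : ∀ ξ η : Heis N, rieszKernel lam (hmul (hinv η) ξ) =
      θ ^ lam * rieszKernel lam (hmul (hinv (dil θ η)) (dil θ ξ)) := by
    intro ξ η
    have : (θ ^ lam) ≠ 0 := (Real.rpow_pos_of_pos hθ _).ne'
    rw [← dil_hinv, ← dil_hmul, rieszKernel_dil hθ, mul_inv_cancel_left₀ this]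
  have h2 : ∀ ξ : Heis N, ∫ η, p (dil θ η) * p (dil θ ξ) * rieszKernel lam (hmul (hinv η) ξ) =
      (θ ^ lam * (θ ^ (2 * N + 2))⁻¹) *
        ∫ η, p η * p (dil θ ξ) * rieszKernel lam (hmul (hinv η) (dil θ ξ)) := by
    intro ξ
    rw [mul_assoc, ← integral_dil θ hθ, ← integral_const_mul]
    congr 1; funext η
    rw [h1 ξ η]; ring
  simp only [h2]
  rw [integral_const_mul,
    integral_dil θ hθ fun ξ => ∫ η, p η * p ξ * rieszKernel lam (hmul (hinv η) ξ), ← mul_assoc]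
  congr 1
  have e : θ ^ (lam - 2 * homDim N) = θ ^ lam * ((θ ^ (2 * N + 2))⁻¹ * (θ ^ (2 * N + 2))⁻¹) := by
    rw [Real.rpow_sub hθ, div_eq_mul_inv, ← mul_inv, ← pow_add, ← Real.rpow_natCast]
    congr 3
    unfold homDim; push_cast; ring
  rw [e]; ring

end HomogeneousNorm

/-! ### Horizontal derivatives on the zero set. -/

section CriticalPoints

/-- Infinitely many disjoint right translates of `E`, all of the same measure, lie in one ball of
finite measure. -/
theorem measure_eq_zero_of_disjoint_flow_translates {E : Set (Heis N)} (hE : MeasurableSet E)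
    (i : HDir N) {R : ℝ} (hR : ∀ ξ ∈ E, ‖ξ‖ ≤ R) {δ : ℝ} (hδ : 0 < δ)
    (hdisj : ∀ ξ ∈ E, ∀ s : ℝ, s ≠ 0 → |s| ≤ δ → hmul ξ (s • hVec i) ∉ E) : volume E = 0 := by
  set δ' := min δ 1 with hδ'
  have hδ'0 : 0 < δ' := by positivity
  set s : ℕ → ℝ := fun k => δ' / (k + 1) with hs
  have hs0 : ∀ k, 0 < s k := fun k => by positivity
  have hsδ : ∀ k, s k ≤ δ' := fun k => div_le_self hδ'0.le (by
    have : (0 : ℝ) ≤ k := k.cast_nonneg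
    linarith)
  have hinj : Function.Injective s := by
    intro k l hkl
    have h : δ' / ((k : ℝ) + 1) = δ' / ((l : ℝ) + 1) := hkl
    rw [div_eq_div_iff (by positivity) (by positivity)] at h
    have := mul_left_cancel₀ hδ'0.ne' h
    exact_mod_cast (by linarith : (k : ℝ) = l)
  set T : ℕ → Set (Heis N) := fun k => (fun ξ => hmul ξ (s k • hVec i)) ⁻¹' E with hT
  have hTm : ∀ k, MeasurableSet (T k) := fun k =>
    (measurePreserving_hmul_right (s k • hVec i)).measurable hE
  have hTv : ∀ k, volume (T k) = volume E := fun k =>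
    (measurePreserving_hmul_right (s k • hVec i)).measure_preimage hE.nullMeasurableSet
  have hTd : Pairwise (Function.onFun Disjoint T) := by
    intro k l hkl
    refine Set.disjoint_left.mpr fun ξ hk hl => ?_
    refine hdisj _ hk (s l - s k) (sub_ne_zero.mpr fun h => hkl (hinj h).symm) ?_ ?_
    · have h1 := hsδ k
      have h2 := hsδ l
      have h3 := min_le_left δ 1
      rw [abs_le]
      constructor <;> linarith [hs0 k, hs0 l]
    · rw [← hmul_smul_hVec_add, add_sub_cancel]
      exact hl
  have hsub : (⋃ k, T k) ⊆ Metric.closedBall 0 (3 * R + 1) := by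
    refine Set.iUnion_subset fun k ξ hξ => ?_
    rw [mem_closedBall_zero_iff]
    refine norm_le_of_hmul ?_ (hR _ hξ)
    rw [norm_smul, norm_hVec, mul_one, Real.norm_eq_abs, abs_of_pos (hs0 k)]
    exact (hsδ k).trans (min_le_right _ _)
  by_contra hne
  have h1 : volume (⋃ k, T k) = ∞ := by
    rw [measure_iUnion hTd hTm]
    simp only [hTv]
    exact ENNReal.tsum_const_eq_top_of_ne_zero hne
  exact (measure_closedBall_lt_top (x := (0 : Heis N)) (r := 3 * R + 1)).not_ge
    (h1 ▸ measure_mono hsub)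

/-- On its zero set, a continuous function has vanishing derivative along a horizontal field at
almost every point at which that derivative exists. -/
theorem ae_lineDeriv_eq_zero_of_eq_zero {y : Heis N → ℝ} (hy : Continuous y) (i : HDir N) :
    ∀ᵐ ξ, y ξ = 0 → ∀ f' : ℝ, HasLineDerivAt ℝ y f' ξ (hField i ξ) → f' = 0 := by
  -- Zeros with nonzero derivative are sorted by a quantitative lower bound on the growth of `|y|`
  -- along the flow. Two distinct points of `E n` cannot be close on one flow line, since `y`
  -- vanishes at both.
  set E : ℕ → Set (Heis N) := fun n => {ξ | ‖ξ‖ ≤ n ∧ y ξ = 0 ∧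
    ∀ s : ℝ, |s| ≤ 1 / ((n : ℝ) + 1) → |s| / (n + 1) ≤ |y (hmul ξ (s • hVec i))|} with hE
  have hclosed : ∀ n, IsClosed (E n) := by
    intro n
    have e : E n = {ξ | ‖ξ‖ ≤ n} ∩ ({ξ | y ξ = 0} ∩ ⋂ s : ℝ, ⋂ _ : |s| ≤ 1 / ((n : ℝ) + 1),
        {ξ | |s| / (n + 1) ≤ |y (hmul ξ (s • hVec i))|}) := by
      ext ξ; simp [hE]
    rw [e]
    refine (isClosed_le continuous_norm continuous_const).inter
      ((isClosed_eq hy continuous_const).inter ?_)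
    refine isClosed_iInter fun s => isClosed_iInter fun _ => ?_
    exact isClosed_le continuous_const (by fun_prop)
  have hzero : ∀ n, volume (E n) = 0 := by
    intro n
    have hn : 0 < 1 / ((n : ℝ) + 1) := by positivity
    refine measure_eq_zero_of_disjoint_flow_translates (hclosed n).measurableSet i
      (fun ξ hξ => hξ.1) hn fun ξ hξ s hs hsn hmem => ?_
    have h1 := hξ.2.2 s hsn
    rw [hmem.2.1, abs_zero] at h1
    have : 0 < |s| / ((n : ℝ) + 1) := by
      have := abs_pos.mpr hs
      positivity
    linarith
  have hU : volume (⋃ n, E n) = 0 := measure_iUnion_null hzero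
  refine measure_mono_null ?_ hU
  intro ξ hξ
  have hξ' : ¬ (y ξ = 0 → ∀ f' : ℝ, HasLineDerivAt ℝ y f' ξ (hField i ξ) → f' = 0) := hξ
  push Not at hξ'
  obtain ⟨hy0, f', hf', hne⟩ := hξ'
  have hd := hasLineDerivAt_hField_iff.mp hf'
  have hpos : 0 < |f'| := abs_pos.mpr hne
  have hlo := (hasDerivAt_iff_isLittleO.mp hd).bound (half_pos hpos)
  obtain ⟨δ, hδ, hball⟩ := Metric.eventually_nhds_iff.mp hlo
  obtain ⟨n, hn⟩ := exists_nat_gt (max ‖ξ‖ (max (1 / δ) (2 / |f'|)))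
  have n1 : ‖ξ‖ < n := (le_max_left _ _).trans_lt hn
  have n2 : 1 / δ < n := ((le_max_left _ _).trans (le_max_right _ _)).trans_lt hn
  have n3 : 2 / |f'| < n := ((le_max_right _ _).trans (le_max_right _ _)).trans_lt hn
  have nn : (0 : ℝ) < (n : ℝ) + 1 := by positivity
  refine Set.mem_iUnion.mpr ⟨n, n1.le, hy0, fun s hs => ?_⟩
  have hsδ : dist s 0 < δ := by
    rw [Real.dist_eq, sub_zero]
    refine hs.trans_lt ?_
    rw [div_lt_iff₀ nn]
    rw [div_lt_iff₀ hδ] at n2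
    linarith
  have h1 := hball hsδ
  simp only [zero_smul, hmul_zero, hy0, sub_zero, smul_eq_mul, Real.norm_eq_abs] at h1
  have h2 : |s * f'| ≤ |y (hmul ξ (s • hVec i))| + |f'| / 2 * |s| := by
    calc |s * f'| = |y (hmul ξ (s • hVec i)) - (y (hmul ξ (s • hVec i)) - s * f')| := by
          congr 1; ring
      _ ≤ _ := (abs_sub _ _).trans (by gcongr)
  rw [abs_mul] at h2
  rw [div_lt_iff₀ hpos] at n3
  rw [div_le_iff₀ nn]
  have h3 : |f'| / 2 * |s| ≤ |y (hmul ξ (s • hVec i))| := by linarith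
  nlinarith [abs_nonneg s]

end CriticalPoints

/-! ### Star-shapedness for dilations. -/

section StarShaped

theorem dil_eq (s : ℝ) (p : Heis N) :
    dil s p = s • (p - tc p • tVec) + s ^ 2 • (tc p • tVec) := by
  apply Heis.ext_coord <;> simp [sub_eq_add_neg, tVec]

theorem hasDerivAt_dil_one (p : Heis N) :
    HasDerivAt (fun s : ℝ => dil s p) (dilationField p) 1 := by
  have h1 : HasDerivAt (fun s : ℝ => s • (p - tc p • tVec)) ((1 : ℝ) • (p - tc p • tVec)) 1 :=
    (hasDerivAt_id (1 : ℝ)).smul_const _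
  have h2 : HasDerivAt (fun s : ℝ => s ^ 2 • (tc p • (tVec : Heis N)))
      ((2 : ℝ) • (tc p • tVec)) 1 := by
    have h3 : HasDerivAt (fun s : ℝ => s ^ 2) 2 1 := by simpa using hasDerivAt_pow 2 (1 : ℝ)
    exact h3.smul_const _
  have h4 := (h1.add h2).congr_deriv (g' := dilationField p) (by
    apply Heis.ext_coord
    · intro j; simp [dilationField, sub_eq_add_neg, tVec]
    · intro j; simp [dilationField, sub_eq_add_neg, tVec]
    · simp [dilationField, sub_eq_add_neg, tVec])
  exact h4.congr_of_eventuallyEq (Filter.Eventually.of_forall fun s => dil_eq s p)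

/-- At a boundary point of a strictly star-shaped domain, the dilations leave the domain. -/
theorem StrictlyStarShaped.exists_dil_notMem {Ω : Set (Heis N)} (hopen : IsOpen Ω)
    (hC2 : HasC2Boundary Ω) (hstar : StrictlyStarShaped Ω) {p : Heis N} (hp : p ∈ frontier Ω) :
    ∃ δ > 0, ∀ s : ℝ, 1 < s → s < 1 + δ → dil s p ∉ Ω := by
  obtain ⟨ρ, hρ⟩ := hC2 p hp
  have hin := hstar p hp _ ⟨ρ, hρ, rfl⟩
  obtain ⟨hg, U, hU, hpU, hsm, hΩU⟩ := hρ
  have hpΩ : p ∉ Ω := by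
    rw [frontier, hopen.interior_eq] at hp
    exact hp.2
  -- This sign suffices: `ρ` increases strictly along the dilation curve through `p`, so it is
  -- positive just beyond `p`.
  have hρp : 0 ≤ ρ p := by
    by_contra hneg
    have : p ∈ Ω ∩ U := by rw [hΩU]; exact ⟨hpU, not_le.mp hneg⟩
    exact hpΩ this.1
  have hdiff : DifferentiableAt ℝ ρ p :=
    (hsm.contDiffAt (hU.mem_nhds hpU)).differentiableAt (by norm_num)
  have hfd := hdiff.hasGradientAt.hasFDerivAt
  have hφ : HasDerivAt (fun s : ℝ => ρ (dil s p)) (inner ℝ (gradient ρ p) (dilationField p)) 1 := by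
    have hfd' : HasFDerivAt ρ ((InnerProductSpace.toDual ℝ (Heis N)) (gradient ρ p)) (dil 1 p) := by
      rw [dil_one]; exact hfd
    exact (hfd'.comp_hasDerivAt (1 : ℝ) (hasDerivAt_dil_one p)).congr_deriv (by simp)
  have hpos : 0 < inner ℝ (gradient ρ p) (dilationField p) := by
    rw [real_inner_smul_right, real_inner_comm] at hin
    exact pos_of_mul_pos_right hin (by positivity)
  have hslope := (hasDerivAt_iff_tendsto_slope.mp hφ).eventually (lt_mem_nhds hpos)
  have hUnear : ∀ᶠ s : ℝ in nhds 1, dil s p ∈ U := by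
    have hc : Continuous fun s : ℝ => dil s p := by fun_prop
    refine hc.continuousAt.eventually ?_
    simp only [dil_one]
    exact hU.mem_nhds hpU
  rw [eventually_nhdsWithin_iff] at hslope
  obtain ⟨δ, hδ, hball⟩ := Metric.eventually_nhds_iff.mp (hslope.and hUnear)
  refine ⟨δ, hδ, fun s h1 h2 hmem => ?_⟩
  obtain ⟨hs, hsU⟩ := hball (y := s) (by rw [Real.dist_eq, abs_of_pos] <;> linarith)
  have hs' := hs (ne_of_gt h1)
  have hneg : ρ (dil s p) < 0 := by
    have : dil s p ∈ Ω ∩ U := ⟨hmem, hsU⟩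
    rw [hΩU] at this
    exact this.2
  rw [slope_def_field, dil_one, div_pos_iff_of_pos_right (by linarith)] at hs'
  linarith

/-- At the largest parameter below 1 for which the dilation curve is outside `Ω`, the curve is at a
boundary point and then enters `Ω`. Strict star-shapedness says that it must leave `Ω` there. -/
theorem StrictlyStarShaped.dil_mem {Ω : Set (Heis N)} (hopen : IsOpen Ω)
    (hC2 : HasC2Boundary Ω) (hstar : StrictlyStarShaped Ω) {ξ : Heis N} (hξ : ξ ∈ Ω) {s : ℝ}
    (hs0 : 0 < s) (hs1 : s ≤ 1) : dil s ξ ∈ Ω := by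
  by_contra hne
  have hc : Continuous fun σ : ℝ => dil σ ξ := by fun_prop
  set A : Set ℝ := Set.Icc s 1 ∩ (fun σ : ℝ => dil σ ξ) ⁻¹' Ωᶜ with hA
  have hAcl : IsClosed A := isClosed_Icc.inter (hopen.isClosed_compl.preimage hc)
  have hAbdd : BddAbove A := ⟨1, fun σ hσ => hσ.1.2⟩
  have hmem : sSup A ∈ A := hAcl.csSup_mem ⟨s, ⟨le_rfl, hs1⟩, hne⟩ hAbdd
  set σ := sSup A with hσ
  have hσ0 : 0 < σ := hs0.trans_le hmem.1.1
  have hσ1 : σ < 1 := lt_of_le_of_ne hmem.1.2 fun h => hmem.2 (by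
    change dil σ ξ ∈ Ω
    rw [h, dil_one]; exact hξ)
  have hafter : ∀ r, σ < r → r ≤ 1 → dil r ξ ∈ Ω := fun r h1 h2 => by
    by_contra hr
    exact absurd (le_csSup hAbdd ⟨⟨hmem.1.1.trans h1.le, h2⟩, hr⟩) (not_le.mpr h1)
  have hfr : dil σ ξ ∈ frontier Ω := by
    rw [frontier, hopen.interior_eq]
    refine ⟨?_, hmem.2⟩
    refine mem_closure_of_tendsto (b := nhdsWithin σ (Set.Ioi σ))
      (hc.continuousAt.tendsto.mono_left nhdsWithin_le_nhds) ?_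
    filter_upwards [Ioo_mem_nhdsGT hσ1] with r hr
    exact hafter r hr.1 hr.2.le
  obtain ⟨δ, hδ, hexit⟩ := hstar.exists_dil_notMem hopen hC2 hfr
  -- The first bound stays in the exit interval; the second keeps `r σ ≤ 1`, where membership in `Ω`
  -- is known.
  set r := min (1 + δ / 2) (1 / σ) with hr
  have hr1 : 1 < r := lt_min (by linarith) ((one_lt_div hσ0).mpr hσ1)
  have hr2 : r < 1 + δ := (min_le_left _ _).trans_lt (by linarith)
  refine hexit r hr1 hr2 ?_
  rw [dil_dil]
  refine hafter _ (by nlinarith) ?_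
  have := min_le_right (1 + δ / 2) (1 / σ)
  rw [← hr, le_div_iff₀ hσ0] at this
  exact this

end StarShaped

/-! ### Testing against the dilate, the solution and its powers. -/

section Energy

/-- `U` is continuous and vanishes off the bounded open set `Ω`, in which it has bounded continuous
first and second derivatives `P i`, `R i` along the horizontal fields. -/
structure HorizontalC2On (Ω : Set (Heis N)) (U : Heis N → ℝ) (P R : HDir N → Heis N → ℝ) :
    Prop where
  isOpen : IsOpen Ω
  bdd : Bornology.IsBounded Ω
  cont : Continuous U
  zero : ∀ ξ, ξ ∉ Ω → U ξ = 0
  pcont : ∀ i, ContinuousOn (P i) Ω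
  rcont : ∀ i, ContinuousOn (R i) Ω
  hasDeriv : ∀ i, ∀ ξ ∈ Ω, HasLineDerivAt ℝ U (P i ξ) ξ (hField i ξ)
  hasDeriv₂ : ∀ i, ∀ ξ ∈ Ω, HasLineDerivAt ℝ (P i) (R i ξ) ξ (hField i ξ)
  pbound : ∀ i, ∃ M, ∀ ξ ∈ Ω, |P i ξ| ≤ M
  rbound : ∀ i, ∃ M, ∀ ξ ∈ Ω, |R i ξ| ≤ M

variable {Ω : Set (Heis N)} {U : Heis N → ℝ} {P R : HDir N → Heis N → ℝ}

theorem HorizontalC2On.mem (S : HorizontalC2On Ω U P R) {ξ : Heis N} (h : U ξ ≠ 0) : ξ ∈ Ω := by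
  by_contra hne
  exact h (S.zero ξ hne)

theorem HorizontalC2On.supp (S : HorizontalC2On Ω U P R) : HasCompactSupport U :=
  HasCompactSupport.of_support_subset_isCompact S.bdd.isCompact_closure
    fun _ hξ => subset_closure (S.mem hξ)

theorem HorizontalC2On.offZero (S : HorizontalC2On Ω U P R) : HorizontalC1OffZero U P where
  cont := S.cont
  supp := S.supp
  dcont i := (S.pcont i).mono fun _ hξ => S.mem hξ
  hasDeriv i ξ hξ := S.hasDeriv i ξ (S.mem hξ)

/-- The derivatives of the signed power `spow r ∘ U`, set to zero where `U` vanishes. -/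
noncomputable def spowDeriv (r : ℝ) (U : Heis N → ℝ) (P : HDir N → Heis N → ℝ) (i : HDir N)
    (ξ : Heis N) : ℝ :=
  {ξ | U ξ ≠ 0}.indicator (fun ξ => r * |U ξ| ^ (r - 1) * P i ξ) ξ

theorem spowDeriv_of_ne {r : ℝ} {i : HDir N} {ξ : Heis N} (h : U ξ ≠ 0) :
    spowDeriv r U P i ξ = r * |U ξ| ^ (r - 1) * P i ξ := Set.indicator_of_mem h _

theorem spowDeriv_of_eq_zero {r : ℝ} {i : HDir N} {ξ : Heis N} (h : U ξ = 0) :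
    spowDeriv r U P i ξ = 0 := Set.indicator_of_notMem (s := {ξ | U ξ ≠ 0}) (fun hne => absurd h hne) _

/-- The exponents used later, `q/2` and `q - 1`, can be below 1, and then the signed power is not
differentiable at 0. This is why differentiability is asked only off the zero set. -/
theorem HorizontalC2On.offZero_spow (S : HorizontalC2On Ω U P R) {r : ℝ} (hr : 0 < r) :
    HorizontalC1OffZero (fun ξ => spow r (U ξ)) (spowDeriv r U P) := by
  have hset : {ξ | spow r (U ξ) ≠ 0} = {ξ | U ξ ≠ 0} := by
    ext ξ; exact not_congr (spow_eq_zero hr)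
  refine ⟨(continuous_spow hr).comp S.cont, S.supp.comp_left (spow_zero r), fun i => ?_,
    fun i ξ hξ => ?_⟩
  · rw [hset]
    have hc : ContinuousOn (fun ξ => r * |U ξ| ^ (r - 1) * P i ξ) {ξ | U ξ ≠ 0} := by
      refine ((continuousOn_const).mul (ContinuousOn.rpow_const S.cont.abs.continuousOn
        fun ξ hξ => Or.inl (abs_ne_zero.mpr hξ))).mul (S.offZero.dcont i)
    exact hc.congr fun ξ hξ => spowDeriv_of_ne hξ
  · have hU : U ξ ≠ 0 := fun h => hξ (by rw [h, spow_zero])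
    rw [spowDeriv_of_ne hU, hasLineDerivAt_hField_iff]
    have h1 := hasLineDerivAt_hField_iff.mp (S.offZero.hasDeriv i ξ hU)
    have h2 : HasDerivAt (spow r) (r * |U ξ| ^ (r - 1)) (U (hmul ξ ((0 : ℝ) • hVec i))) := by
      simpa using hasDerivAt_spow r hU
    exact h2.comp (0 : ℝ) h1

theorem HorizontalC2On.integrable_indicator (S : HorizontalC2On Ω U P R) {f : Heis N → ℝ}
    (hf : ContinuousOn f Ω) {M : ℝ} (hM : ∀ ξ ∈ Ω, |f ξ| ≤ M) : Integrable (Ω.indicator f) := by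
  have hm := S.isOpen.measurableSet
  refine IntegrableOn.integrable_indicator ?_ hm
  exact IntegrableOn.of_bound S.bdd.measure_lt_top (hf.aestronglyMeasurable hm) M
    ((ae_restrict_iff' hm).mpr (Filter.Eventually.of_forall hM))

theorem HorizontalC2On.integrable_sq (S : HorizontalC2On Ω U P R) (i : HDir N) :
    Integrable fun ξ => Ω.indicator (P i) ξ ^ 2 := by
  obtain ⟨M, hM⟩ := S.pbound i
  have h := S.integrable_indicator (f := fun ξ => P i ξ ^ 2) ((S.pcont i).pow 2) (M := M ^ 2)
    fun ξ hξ => by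
      rw [abs_pow]
      have := hM ξ hξ
      gcongr
  refine h.congr (Filter.Eventually.of_forall fun ξ => ?_)
  by_cases hξ : ξ ∈ Ω <;> simp [hξ]

/-- The Dirichlet energy of `U` on `Ω`. -/
noncomputable def energy (Ω : Set (Heis N)) (P : HDir N → Heis N → ℝ) : ℝ :=
  ∑ i, ∫ ξ, Ω.indicator (P i) ξ ^ 2

/-- The negative horizontal Laplacian on `Ω`, extended by zero. -/
noncomputable def negLap (Ω : Set (Heis N)) (R : HDir N → Heis N → ℝ) (ξ : Heis N) : ℝ :=
  -∑ i, Ω.indicator (R i) ξ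

theorem HorizontalC2On.integrable_negLap (S : HorizontalC2On Ω U P R) :
    Integrable (negLap Ω R) := by
  refine (integrable_finsetSum Finset.univ fun i _ => ?_).neg
  obtain ⟨M, hM⟩ := S.rbound i
  exact S.integrable_indicator (S.rcont i) hM

theorem HorizontalC2On.integral_gradient (S : HorizontalC2On Ω U P R) {v : Heis N → ℝ}
    {D : HDir N → Heis N → ℝ} (hv : HorizontalC1 v D) (hsub : tsupport v ⊆ Ω) :
    ∑ i, ∫ ξ, P i ξ * D i ξ = ∫ ξ, negLap Ω R ξ * v ξ := by
  have hpt : ∀ i ξ, R i ξ * v ξ = Ω.indicator (R i) ξ * v ξ := by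
    intro i ξ
    by_cases hξ : ξ ∈ Ω
    · rw [Set.indicator_of_mem hξ]
    · rw [image_eq_zero_of_notMem_tsupport fun h => hξ (hsub h), mul_zero, mul_zero]
  obtain ⟨K, _, hK⟩ := exists_abs_le_of_hasCompactSupport hv.cont hv.supp
  have hint : ∀ i, Integrable fun ξ => Ω.indicator (R i) ξ * v ξ := by
    intro i
    obtain ⟨M, hM⟩ := S.rbound i
    exact (S.integrable_indicator (S.rcont i) hM).mul_bdd (c := K)
      hv.cont.aestronglyMeasurable (Filter.Eventually.of_forall hK)
  have h1 : ∀ ξ, negLap Ω R ξ * v ξ = ∑ i, -(Ω.indicator (R i) ξ * v ξ) := fun ξ => by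
    rw [negLap, Finset.sum_neg_distrib, ← Finset.sum_mul, neg_mul]
  have hneg : ∀ i, Integrable fun ξ => -(Ω.indicator (R i) ξ * v ξ) := fun i => (hint i).neg
  simp only [h1]
  rw [integral_finsetSum _ fun i _ => hneg i]
  refine Finset.sum_congr rfl fun i _ => ?_
  rw [integral_mul_lineDeriv S.isOpen i (S.pcont i) (S.rcont i) (S.hasDeriv₂ i) hv hsub,
    integral_neg]
  simp only [hpt]

theorem tendsto_integral_softThr {h y : Heis N → ℝ} (hh : Integrable h) (hy : Continuous y)
    (hyc : HasCompactSupport y) :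
    Filter.Tendsto (fun ε => ∫ ξ, h ξ * softThr ε (y ξ)) (nhdsWithin 0 (Set.Ioi 0))
      (nhds (∫ ξ, h ξ * y ξ)) := by
  obtain ⟨K, hK0, hK⟩ := exists_abs_le_of_hasCompactSupport hy hyc
  refine tendsto_integral_filter_of_dominated_convergence (fun ξ => ‖h ξ‖ * K) ?_ ?_
    (hh.norm.mul_const K) (Filter.Eventually.of_forall fun ξ => (tendsto_softThr _).const_mul _)
  · filter_upwards [self_mem_nhdsWithin] with ε hε
    exact hh.aestronglyMeasurable.mul ((continuous_softThr hε).comp hy).aestronglyMeasurable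
  · filter_upwards [self_mem_nhdsWithin] with ε hε
    refine Filter.Eventually.of_forall fun ξ => ?_
    rw [norm_mul]
    gcongr
    exact (abs_softThr_le hε _).trans (hK ξ)

/-- Testing the equation against the dilated solution. -/
theorem HorizontalC2On.integral_negLap_dil_le (S : HorizontalC2On Ω U P R)
    {θ : ℝ} (hθ : 0 < θ) (hdil : ∀ ξ, dil θ ξ ∈ Ω → ξ ∈ Ω) :
    ∫ ξ, negLap Ω R ξ * U (dil θ ξ) ≤
      1 / 2 * (1 + θ ^ 2 * (θ ^ (2 * N + 2))⁻¹) * energy Ω P := by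
  have hUθ : Continuous fun ξ => U (dil θ ξ) := S.cont.comp (by fun_prop)
  have hUθc : HasCompactSupport fun ξ => U (dil θ ξ) := S.supp.comp_homeomorph (dilHomeo θ hθ)
  refine le_of_tendsto (tendsto_integral_softThr S.integrable_negLap hUθ hUθc) ?_
  filter_upwards [self_mem_nhdsWithin] with ε hε
  have hε' : 0 < ε := hε
  have hv := (S.offZero.comp_softThr hε').comp_dil hθ
  have hsub : tsupport (fun ξ => softThr ε (U (dil θ ξ))) ⊆ Ω :=
    (tsupport_softThr_subset hUθ hε').trans fun ξ hξ => hdil ξ (S.mem hξ)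
  rw [← S.integral_gradient hv hsub, energy, Finset.mul_sum]
  refine Finset.sum_le_sum fun i _ => ?_
  have hi1 := S.integrable_sq i
  have hi2 : Integrable fun ξ => Ω.indicator (P i) (dil θ ξ) ^ 2 := by
    have hmp : Measure.map (dil θ) (volume : Measure (Heis N)) = _ := map_dil_volume θ hθ
    have : Integrable (fun ξ => Ω.indicator (P i) ξ ^ 2)
        (Measure.map (dilHomeo (N := N) θ hθ) volume) := by
      change Integrable _ (Measure.map (dil θ) volume)
      rw [hmp]
      exact hi1.smul_measure ENNReal.ofReal_ne_top
    exact (dilHomeo (N := N) θ hθ).measurableEmbedding.integrable_map_iff.mp this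
  have hpt : ∀ ξ, P i ξ * (θ * (softThrDeriv ε (U (dil θ ξ)) * P i (dil θ ξ))) ≤
      1 / 2 * Ω.indicator (P i) ξ ^ 2 + 1 / 2 * θ ^ 2 * Ω.indicator (P i) (dil θ ξ) ^ 2 := by
    intro ξ
    by_cases hU : U (dil θ ξ) = 0
    · rw [hU, softThrDeriv_eq_zero hε' (by simpa using hε'.le)]
      simp only [zero_mul, mul_zero]
      positivity
    · have h1 := S.mem hU
      rw [Set.indicator_of_mem h1, Set.indicator_of_mem (hdil ξ h1)]
      set a := P i ξ
      set b := P i (dil θ ξ)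
      set c := softThrDeriv ε (U (dil θ ξ))
      have hc0 : 0 ≤ c := softThrDeriv_nonneg hε' _
      have hc1 : c ≤ 1 := softThrDeriv_le_one _ _
      have h2 : 0 ≤ 1 / 2 * a ^ 2 + 1 / 2 * θ ^ 2 * b ^ 2 := by positivity
      -- Young's inequality for `a · θ b`, then `0 ≤ c ≤ 1` against the nonnegative majorant.
      nlinarith [mul_nonneg hc0 (sq_nonneg (a - θ * b)), mul_nonneg (sub_nonneg.mpr hc1) h2]
  calc ∫ ξ, P i ξ * (θ * (softThrDeriv ε (U (dil θ ξ)) * P i (dil θ ξ)))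
      ≤ ∫ ξ, (1 / 2 * Ω.indicator (P i) ξ ^ 2 +
        1 / 2 * θ ^ 2 * Ω.indicator (P i) (dil θ ξ) ^ 2) := by
        refine integral_mono ?_ ((hi1.const_mul _).add (hi2.const_mul _)) hpt
        have hDc := hv.dsupp i
        have hPD : Continuous fun ξ =>
            P i ξ * (θ * (softThrDeriv ε (U (dil θ ξ)) * P i (dil θ ξ))) := by
          refine ((S.pcont i).mul (hv.dcont i).continuousOn).continuous_of_tsupport_subset
            S.isOpen (tsupport_mul_subset_right.trans ?_)
          refine (closure_minimal (fun ξ hξ => ?_) (isClosed_tsupport _)).trans hsub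
          by_contra h
          exact hξ (hv.deriv_eq_zero i h)
        exact hPD.integrable_of_hasCompactSupport hDc.mul_left
    _ = 1 / 2 * (∫ ξ, Ω.indicator (P i) ξ ^ 2) +
        1 / 2 * θ ^ 2 * ((θ ^ (2 * N + 2))⁻¹ * ∫ ξ, Ω.indicator (P i) ξ ^ 2) := by
        rw [integral_add (hi1.const_mul _) (hi2.const_mul _), integral_const_mul,
          integral_const_mul, integral_dil θ hθ fun ξ => Ω.indicator (P i) ξ ^ 2]
    _ = _ := by ring

/-- Testing the equation against the solution itself. -/
theorem HorizontalC2On.integral_negLap_mul_self (S : HorizontalC2On Ω U P R) :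
    ∫ ξ, negLap Ω R ξ * U ξ = energy Ω P := by
  have hlim := tendsto_integral_softThr S.integrable_negLap S.cont S.supp
  refine tendsto_nhds_unique hlim ?_
  have hE : Filter.Tendsto
      (fun ε => ∑ i, ∫ ξ, softThrDeriv ε (U ξ) * Ω.indicator (P i) ξ ^ 2)
      (nhdsWithin 0 (Set.Ioi 0)) (nhds (energy Ω P)) := by
    refine tendsto_finsetSum _ fun i _ => ?_
    have hi := S.integrable_sq i
    refine tendsto_integral_filter_of_dominated_convergence (fun ξ => Ω.indicator (P i) ξ ^ 2)
      ?_ ?_ hi ?_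
    · filter_upwards [self_mem_nhdsWithin] with ε hε
      exact ((continuous_softThrDeriv hε).comp S.cont).aestronglyMeasurable.mul
        hi.aestronglyMeasurable
    · filter_upwards [self_mem_nhdsWithin] with ε hε
      refine Filter.Eventually.of_forall fun ξ => ?_
      have h1 := softThrDeriv_nonneg hε (U ξ)
      rw [Real.norm_of_nonneg (by positivity)]
      exact mul_le_of_le_one_left (sq_nonneg _) (softThrDeriv_le_one _ _)
    -- `softThrDeriv` tends to 1 only where `U ≠ 0`. An equality in the limit requires the gradient
    -- to vanish almost everywhere on the zero set.
    · filter_upwards [ae_lineDeriv_eq_zero_of_eq_zero S.cont i] with ξ hξ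
      by_cases hU : U ξ = 0
      · have h0 : Ω.indicator (P i) ξ = 0 := by
          by_cases hmem : ξ ∈ Ω
          · rw [Set.indicator_of_mem hmem]
            exact hξ hU _ (S.hasDeriv i ξ hmem)
          · rw [Set.indicator_of_notMem hmem]
        simp [h0]
      · simpa using (tendsto_softThrDeriv hU).mul_const (Ω.indicator (P i) ξ ^ 2)
  refine hE.congr' ?_
  filter_upwards [self_mem_nhdsWithin] with ε hε
  have hε' : 0 < ε := hε
  rw [← S.integral_gradient (S.offZero.comp_softThr hε')
    ((tsupport_softThr_subset S.cont hε').trans fun ξ hξ => S.mem hξ)]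
  refine Finset.sum_congr rfl fun i _ => ?_
  congr 1; funext ξ
  by_cases hU : U ξ = 0
  · rw [hU, softThrDeriv_eq_zero hε' (by simpa using hε'.le)]; simp
  · rw [Set.indicator_of_mem (S.mem hU)]; ring

/-- Testing the equation against a signed power of the solution. -/
theorem HorizontalC2On.sqInt_spowDeriv_ne_top (S : HorizontalC2On Ω U P R) {q : ℝ} (hq : 1 < q)
    (i : HDir N) : sqInt (spowDeriv (q / 2) U P i) ≠ ∞ := by
  have hq1 : 0 < q - 1 := by linarith
  have hq2 : 0 < q / 2 := by linarith
  set y : Heis N → ℝ := fun ξ => spow (q - 1) (U ξ) with hy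
  have hyO : HorizontalC1OffZero y (spowDeriv (q - 1) U P) := S.offZero_spow hq1
  have hyne : ∀ ξ, y ξ ≠ 0 → U ξ ≠ 0 := fun ξ h hU => h (by rw [hy]; simp [hU])
  set K : ℝ := ∫ ξ, |negLap Ω R ξ * y ξ| with hK
  obtain ⟨Y, _, hY⟩ := exists_abs_le_of_hasCompactSupport hyO.cont hyO.supp
  have hKi : Integrable fun ξ => |negLap Ω R ξ * y ξ| :=
    (S.integrable_negLap.mul_bdd (c := Y) hyO.cont.aestronglyMeasurable
      (Filter.Eventually.of_forall hY)).norm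
  have hnn : ∀ ε : ℝ, 0 < ε → ∀ k ξ,
      0 ≤ P k ξ * (softThrDeriv ε (y ξ) * spowDeriv (q - 1) U P k ξ) := by
    intro ε hε k ξ
    by_cases hU : U ξ = 0
    · rw [spowDeriv_of_eq_zero hU]; simp
    · rw [spowDeriv_of_ne hU]
      have h1 := softThrDeriv_nonneg hε (y ξ)
      have h2 : P k ξ * (softThrDeriv ε (y ξ) * ((q - 1) * |U ξ| ^ (q - 1 - 1) * P k ξ)) =
          softThrDeriv ε (y ξ) * ((q - 1) * |U ξ| ^ (q - 1 - 1)) * P k ξ ^ 2 := by ring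
      rw [h2]; positivity
  have hmain : ∀ ε : ℝ, 0 < ε →
      Integrable (fun ξ => P i ξ * (softThrDeriv ε (y ξ) * spowDeriv (q - 1) U P i ξ)) ∧
      ∫ ξ, P i ξ * (softThrDeriv ε (y ξ) * spowDeriv (q - 1) U P i ξ) ≤ K := by
    intro ε hε
    have hv := hyO.comp_softThr hε
    have hsub : tsupport (fun ξ => softThr ε (y ξ)) ⊆ Ω :=
      (tsupport_softThr_subset hyO.cont hε).trans fun ξ hξ => S.mem (hyne ξ hξ)
    have hPD : Continuous fun ξ =>
        P i ξ * (softThrDeriv ε (y ξ) * spowDeriv (q - 1) U P i ξ) := by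
      refine ((S.pcont i).mul (hv.dcont i).continuousOn).continuous_of_tsupport_subset
        S.isOpen (tsupport_mul_subset_right.trans ?_)
      refine (closure_minimal (fun ξ hξ => ?_) (isClosed_tsupport _)).trans hsub
      by_contra h
      exact hξ (hv.deriv_eq_zero i h)
    refine ⟨hPD.integrable_of_hasCompactSupport (hv.dsupp i).mul_left, ?_⟩
    calc ∫ ξ, P i ξ * (softThrDeriv ε (y ξ) * spowDeriv (q - 1) U P i ξ)
        ≤ ∑ k, ∫ ξ, P k ξ * (softThrDeriv ε (y ξ) * spowDeriv (q - 1) U P k ξ) :=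
          Finset.single_le_sum (f := fun k =>
            ∫ ξ, P k ξ * (softThrDeriv ε (y ξ) * spowDeriv (q - 1) U P k ξ))
            (fun k _ => integral_nonneg (hnn ε hε k)) (Finset.mem_univ i)
      _ = ∫ ξ, negLap Ω R ξ * softThr ε (y ξ) := S.integral_gradient hv hsub
      _ ≤ ∫ ξ, |negLap Ω R ξ * y ξ| := by
          refine (Real.le_norm_self _).trans ((norm_integral_le_integral_norm
            fun ξ => negLap Ω R ξ * softThr ε (y ξ)).trans ?_)
          refine integral_mono_of_nonneg (Filter.Eventually.of_forall fun _ => norm_nonneg _) hKi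
            (Filter.Eventually.of_forall fun ξ => ?_)
          simp only [norm_mul, Real.norm_eq_abs, abs_mul]
          exact mul_le_mul_of_nonneg_left (abs_softThr_le hε _) (abs_nonneg _)
  have hzO := S.offZero_spow hq2
  have hzm : Measurable (spowDeriv (q / 2) U P i) :=
    hzO.measurable_deriv (fun k ξ hξ => spowDeriv_of_eq_zero ((spow_eq_zero hq2).mp hξ)) i
  set c : ℝ := (q / 2) ^ 2 / (q - 1) with hc
  have hc0 : 0 ≤ c := by positivity
  set e : ℕ → ℝ := fun n => 1 / (n + 1) with he
  have hepos : ∀ n, 0 < e n := fun n => by positivity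
  have helim : Filter.Tendsto e Filter.atTop (nhdsWithin 0 (Set.Ioi 0)) :=
    tendsto_nhdsWithin_iff.mpr ⟨tendsto_one_div_add_atTop_nhds_zero_nat,
      Filter.Eventually.of_forall hepos⟩
  refine ne_top_of_le_ne_top (b := ENNReal.ofReal (c * K)) ENNReal.ofReal_ne_top
    (sqInt_le_of_tendsto
      (f := fun n ξ => softThrDeriv (e n) (y ξ) * spowDeriv (q / 2) U P i ξ) (fun n => ?_)
      (fun n => ?_) fun ξ => ?_)
  · exact ((continuous_softThrDeriv (hepos n)).comp hyO.cont).measurable.mul hzm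
  · obtain ⟨hint, hle⟩ := hmain (e n) (hepos n)
    -- Both sides carry `|U|^(q-2) (P i)²`, the left with the square of the truncation factor and
    -- the right with its first power; that factor lies in `[0, 1]`.
    have hpt : ∀ ξ, (softThrDeriv (e n) (y ξ) * spowDeriv (q / 2) U P i ξ) ^ 2 ≤
        c * (P i ξ * (softThrDeriv (e n) (y ξ) * spowDeriv (q - 1) U P i ξ)) := by
      intro ξ
      by_cases hU : U ξ = 0
      · rw [spowDeriv_of_eq_zero hU, spowDeriv_of_eq_zero hU]; simp
      · rw [spowDeriv_of_ne hU, spowDeriv_of_ne hU]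
        have h0 := softThrDeriv_nonneg (hepos n) (y ξ)
        have h1 := softThrDeriv_le_one (e n) (y ξ)
        set t := softThrDeriv (e n) (y ξ)
        have hpow : (|U ξ| ^ (q / 2 - 1)) ^ 2 = |U ξ| ^ (q - 1 - 1) := by
          rw [← Real.rpow_natCast, ← Real.rpow_mul (abs_nonneg _)]
          congr 1; push_cast; ring
        have e1 : (t * (q / 2 * |U ξ| ^ (q / 2 - 1) * P i ξ)) ^ 2 =
            t ^ 2 * ((q / 2) ^ 2 * |U ξ| ^ (q - 1 - 1) * P i ξ ^ 2) := by
          rw [← hpow]; ring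
        have e2 : c * (P i ξ * (t * ((q - 1) * |U ξ| ^ (q - 1 - 1) * P i ξ))) =
            t * ((q / 2) ^ 2 * |U ξ| ^ (q - 1 - 1) * P i ξ ^ 2) := by
          rw [hc]; field_simp
        rw [e1, e2]
        gcongr
        nlinarith
    calc sqInt (fun ξ => softThrDeriv (e n) (y ξ) * spowDeriv (q / 2) U P i ξ)
        ≤ ∫⁻ ξ, ENNReal.ofReal
          (c * (P i ξ * (softThrDeriv (e n) (y ξ) * spowDeriv (q - 1) U P i ξ))) :=
          lintegral_mono fun ξ => ENNReal.ofReal_le_ofReal (hpt ξ)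
      _ = ENNReal.ofReal (∫ ξ,
          c * (P i ξ * (softThrDeriv (e n) (y ξ) * spowDeriv (q - 1) U P i ξ))) :=
          (ofReal_integral_eq_lintegral_ofReal (hint.const_mul c)
            (Filter.Eventually.of_forall fun ξ => mul_nonneg hc0 (hnn _ (hepos n) i ξ))).symm
      _ ≤ ENNReal.ofReal (c * K) := by
          rw [integral_const_mul]
          gcongr
  · by_cases hU : U ξ = 0
    · simp [spowDeriv_of_eq_zero hU]
    · have hne : y ξ ≠ 0 := fun h => hU ((spow_eq_zero hq1).mp h)
      simpa using ((tendsto_softThrDeriv hne).comp helim).mul_const (spowDeriv (q / 2) U P i ξ)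

theorem HorizontalC2On.exists_spow_incr_le (hN : 1 ≤ N) (S : HorizontalC2On Ω U P R) {q : ℝ}
    (hq : 1 < q) {ε : ℝ} (hε : 0 < ε) :
    ∃ θ₀ > (1 : ℝ), ∀ θ, 1 < θ → θ < θ₀ →
      ∫ ξ, (spow (q / 2) (U (dil θ ξ)) - spow (q / 2) (U ξ)) ^ 2 ≤ ε * (θ - 1) := by
  have hq2 : 0 < q / 2 := by linarith
  obtain ⟨θ₀, h₀, H⟩ := (S.offZero_spow hq2).exists_dilIncr_le_small hN
    (fun k ξ hξ => spowDeriv_of_eq_zero ((spow_eq_zero hq2).mp hξ))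
    (fun i => S.sqInt_spowDeriv_ne_top hq i) hε
  refine ⟨θ₀, h₀, fun θ h1 h2 => ?_⟩
  have h := H θ h1 h2
  rw [integral_eq_lintegral_of_nonneg_ae (Filter.Eventually.of_forall fun _ => sq_nonneg _)]
  · exact ENNReal.toReal_le_of_le_ofReal (by nlinarith) h
  · have h3 := (continuous_spow hq2).comp S.cont
    have h4 : Continuous fun ξ => spow (q / 2) (U (dil θ ξ)) := h3.comp (by fun_prop)
    exact ((h4.sub h3).pow 2).aestronglyMeasurable

end Energy

/-! ### The nonlocal lower bound and the Pohozaev inequality. -/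

section Pohozaev

theorem deriv_nonneg_of_eventually_ge {G : ℝ → ℝ} {G' x : ℝ} (hG : HasDerivAt G G' x)
    (h0 : G x = 0)
    (h : ∀ ε > 0, ∃ y > x, ∀ θ, x < θ → θ < y → -(ε * (θ - x)) ≤ G θ) : 0 ≤ G' := by
  have hs : Filter.Tendsto (slope G x) (nhdsWithin x (Set.Ioi x)) (nhds G') :=
    (hasDerivAt_iff_tendsto_slope.mp hG).mono_left
      (nhdsWithin_mono _ fun y (hy : x < y) => hy.ne')
  refine le_of_forall_pos_le_add fun ε hε => ?_
  obtain ⟨y, hy, H⟩ := h ε hε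
  have : -ε ≤ G' := by
    refine ge_of_tendsto hs ?_
    filter_upwards [Ioo_mem_nhdsGT hy] with θ hθ
    have h1 : 0 < θ - x := sub_pos.mpr hθ.1
    rw [slope_def_field, h0, sub_zero, le_div_iff₀ h1]
    linarith [H θ hθ.1 hθ.2]
  linarith

/-- A lower bound for the mixed nonlocal term `∫ V |U|^(q-2) U W` in terms of the energies of
`|U|^q` and `|W|^q`, with an error quadratic in the difference of the half powers. -/
theorem kernelPot_spow_mixed_ge {k U W : Heis N → ℝ} (hkm : Measurable k) (hk : Integrable k)
    (hk0 : ∀ ζ, 0 ≤ k ζ) (hsymm : ∀ ζ, k (hinv ζ) = k ζ) (hU : Continuous U)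
    (hUc : HasCompactSupport U) (hW : Continuous W) (hWc : HasCompactSupport W) {q M : ℝ}
    (hq : 1 < q) (hUM : ∀ ξ, |spow (q / 2) (U ξ)| ≤ M) (hWM : ∀ ξ, |spow (q / 2) (W ξ)| ≤ M) :
    (q - 1 / 2) * (∫ ξ, kernelPot k (fun η => |U η| ^ q) ξ * |U ξ| ^ q) +
      1 / 2 * (∫ ξ, kernelPot k (fun η => |W η| ^ q) ξ * |W ξ| ^ q) -
      (2 * q + 3) * M ^ 2 * (∫ ζ, k ζ) *
        (∫ ξ, (spow (q / 2) (W ξ) - spow (q / 2) (U ξ)) ^ 2) ≤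
      q * ∫ ξ, kernelPot k (fun η => |U η| ^ q) ξ * (spow (q - 1) (U ξ) * W ξ) := by
  have hq0 : 0 < q := by linarith
  have hq1 : 0 < q - 1 := by linarith
  have hq2 : 0 < q / 2 := by linarith
  have hpow : ∀ {f : Heis N → ℝ}, Continuous f → HasCompactSupport f →
      Continuous (fun η => |f η| ^ q) ∧ HasCompactSupport fun η => |f η| ^ q := by
    intro f hf hfc
    refine ⟨hf.abs.rpow_const fun _ => Or.inr hq0.le, HasCompactSupport.intro hfc fun ξ hξ => ?_⟩
    rw [image_eq_zero_of_notMem_tsupport hξ, abs_zero, Real.zero_rpow hq0.ne']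
  obtain ⟨hp, hpc⟩ := hpow hU hUc
  obtain ⟨hr, hrc⟩ := hpow hW hWc
  set p : Heis N → ℝ := fun η => |U η| ^ q with hpdef
  set r : Heis N → ℝ := fun η => |W η| ^ q with hrdef
  set V := kernelPot k p with hV
  set κ := ∫ ζ, k ζ with hκ
  have hκ0 : 0 ≤ κ := integral_nonneg hk0
  have hpF : ∀ ξ, p ξ = spow (q / 2) (U ξ) ^ 2 := fun ξ => (sq_spow_half hq0 _).symm
  have hrF : ∀ ξ, r ξ = spow (q / 2) (W ξ) ^ 2 := fun ξ => (sq_spow_half hq0 _).symm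
  have hM0 : 0 ≤ M := (abs_nonneg _).trans (hUM 0)
  have hpM : ∀ ξ, |p ξ| ≤ M ^ 2 := fun ξ => by
    rw [hpF, abs_pow]
    have := hUM ξ
    gcongr
  have hV0 : ∀ ξ, 0 ≤ V ξ := fun ξ =>
    integral_nonneg fun η => mul_nonneg (Real.rpow_nonneg (abs_nonneg _) _) (hk0 _)
  have hVM : ∀ ξ, V ξ ≤ M ^ 2 * κ := fun ξ =>
    (le_abs_self _).trans (abs_kernelPot_le hk hk0 hsymm hpM ξ)
  set d : Heis N → ℝ := fun ξ => (spow (q / 2) (W ξ) - spow (q / 2) (U ξ)) ^ 2 with hd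
  have hdcont : Continuous d :=
    (((continuous_spow hq2).comp hW).sub ((continuous_spow hq2).comp hU)).pow 2
  have hdc : HasCompactSupport d := HasCompactSupport.intro (hUc.union hWc) fun ξ hξ => by
    simp only [Set.mem_union, not_or] at hξ
    simp only [hd]
    rw [image_eq_zero_of_notMem_tsupport hξ.1, image_eq_zero_of_notMem_tsupport hξ.2]
    simp
  have hdi : Integrable d := hdcont.integrable_of_hasCompactSupport hdc
  have hgc : Continuous fun ξ => spow (q - 1) (U ξ) * W ξ :=
    ((continuous_spow hq1).comp hU).mul hW
  have hgs : HasCompactSupport fun ξ => spow (q - 1) (U ξ) * W ξ := hWc.mul_left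
  have iVp := integrable_kernelPot_mul hkm hk hp hpc hp hpc
  have iVr := integrable_kernelPot_mul hkm hk hp hpc hr hrc
  have iVg := integrable_kernelPot_mul hkm hk hp hpc hgc hgs
  -- The remainder estimate is multiplied by `V ≥ 0`; the bound `V ≤ M² κ` is spent only on the
  -- error term.
  have hpt : ∀ ξ, (q - 1) * (V ξ * p ξ) + V ξ * r ξ - (2 * q + 1) * (M ^ 2 * κ) * d ξ ≤
      q * (V ξ * (spow (q - 1) (U ξ) * W ξ)) := by
    intro ξ
    have h1 := rpow_remainder_le hq (U ξ) (W ξ)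
    have h2 : spow (q - 1) (U ξ) * U ξ = p ξ := spow_sub_one_mul_self hq _
    have h3 : (q - 1) * p ξ + r ξ - (2 * q + 1) * d ξ ≤ q * (spow (q - 1) (U ξ) * W ξ) := by
      simp only [hpdef, hrdef, hd] at h2 ⊢
      linarith [congrArg (q * ·) h2]
    have h4 := mul_le_mul_of_nonneg_left h3 (hV0 ξ)
    have h5 : V ξ * ((2 * q + 1) * d ξ) ≤ M ^ 2 * κ * ((2 * q + 1) * d ξ) :=
      mul_le_mul_of_nonneg_right (hVM ξ) (mul_nonneg (by linarith) (sq_nonneg _))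
    linarith
  have hint : (q - 1) * (∫ ξ, V ξ * p ξ) + (∫ ξ, V ξ * r ξ) -
      (2 * q + 1) * (M ^ 2 * κ) * (∫ ξ, d ξ) ≤ q * ∫ ξ, V ξ * (spow (q - 1) (U ξ) * W ξ) := by
    have h := integral_mono (((iVp.const_mul (q - 1)).add iVr).sub
      (hdi.const_mul ((2 * q + 1) * (M ^ 2 * κ)))) (iVg.const_mul q) hpt
    have e : ∫ ξ, ((q - 1) * (V ξ * p ξ) + V ξ * r ξ - (2 * q + 1) * (M ^ 2 * κ) * d ξ) =
        (q - 1) * (∫ ξ, V ξ * p ξ) + (∫ ξ, V ξ * r ξ) -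
          (2 * q + 1) * (M ^ 2 * κ) * (∫ ξ, d ξ) := by
      have hadd : Integrable fun ξ => (q - 1) * (V ξ * p ξ) + V ξ * r ξ :=
        (iVp.const_mul (q - 1)).add iVr
      rw [integral_sub hadd (hdi.const_mul _), integral_add (iVp.const_mul _) iVr,
        integral_const_mul, integral_const_mul]
    rw [← e, ← integral_const_mul q]
    exact h
  have hmix := kernelPot_mixed_ge hkm hk hk0 hsymm hp hpc hr hrc
  -- A difference of squares of half powers, whose sum is at most `2M`. Half of this error adds 2 to
  -- `2q + 1`, hence the `2q + 3`.
  have hsq : ∫ ξ, (p ξ - r ξ) ^ 2 ≤ 4 * M ^ 2 * ∫ ξ, d ξ := by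
    rw [← integral_const_mul]
    refine integral_mono_of_nonneg (Filter.Eventually.of_forall fun _ => sq_nonneg _)
      (hdi.const_mul _) (Filter.Eventually.of_forall fun ξ => ?_)
    simp only [hpF, hrF, hd]
    set s := spow (q / 2) (U ξ)
    set t := spow (q / 2) (W ξ)
    have h1 : |s + t| ≤ 2 * M := (abs_add_le _ _).trans (by linarith [hUM ξ, hWM ξ])
    have h2 : (s + t) ^ 2 ≤ 4 * M ^ 2 := by
      rw [← sq_abs]
      calc |s + t| ^ 2 ≤ (2 * M) ^ 2 := by gcongr
        _ = _ := by ring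
    calc (s ^ 2 - t ^ 2) ^ 2 = (s + t) ^ 2 * (t - s) ^ 2 := by ring
      _ ≤ _ := by gcongr
  have := mul_le_mul_of_nonneg_left hsq hκ0
  nlinarith

variable {Ω : Set (Heis N)} {U : Heis N → ℝ} {P R : HDir N → Heis N → ℝ}

/-- The Pohozaev inequality for solutions of a Choquard equation on a domain that is star-shaped
with respect to the dilations. -/
theorem HorizontalC2On.pohozaev (hN : 1 ≤ N) (S : HorizontalC2On Ω U P R)
    (hdil : ∀ θ, 1 < θ → ∀ ξ, dil θ ξ ∈ Ω → ξ ∈ Ω) {k : Heis N → ℝ} (hkm : Measurable k)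
    (hk : Integrable k) (hk0 : ∀ ζ, 0 ≤ k ζ) (hsymm : ∀ ζ, k (hinv ζ) = k ζ) {a q lam : ℝ}
    (hq : 1 < q) (hqlam : q * (homDim N - 2) = 2 * homDim N - lam) (ha : a < 0)
    (heq : ∀ ξ ∈ Ω, negLap Ω R ξ =
      a * U ξ + kernelPot k (fun η => |U η| ^ q) ξ * spow (q - 1) (U ξ))
    (hscale : ∀ θ, 1 < θ →
      ∫ ξ, kernelPot k (fun η => |U (dil θ η)| ^ q) ξ * |U (dil θ ξ)| ^ q =
        θ ^ (lam - 2 * homDim N) * ∫ ξ, kernelPot k (fun η => |U η| ^ q) ξ * |U ξ| ^ q) :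
    0 ≤ a * ∫ ξ, U ξ ^ 2 := by
  have hq0 : 0 < q := by linarith
  have hq1 : 0 < q - 1 := by linarith
  have hq2 : 0 < q / 2 := by linarith
  have hp : Continuous fun η => |U η| ^ q := S.cont.abs.rpow_const fun _ => Or.inr hq0.le
  have hpc : HasCompactSupport fun η => |U η| ^ q := HasCompactSupport.intro S.supp fun ξ hξ => by
    rw [image_eq_zero_of_notMem_tsupport hξ, abs_zero, Real.zero_rpow hq0.ne']
  set V := kernelPot k fun η => |U η| ^ q with hV
  set A := energy Ω P with hA
  set B := ∫ ξ, U ξ ^ 2 with hB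
  set C := ∫ ξ, V ξ * |U ξ| ^ q with hC
  obtain ⟨M, hM0, hM⟩ := exists_abs_le_of_hasCompactSupport ((continuous_spow hq2).comp S.cont)
    (S.supp.comp_left (spow_zero _))
  set K := (2 * q + 3) * M ^ 2 * (∫ ζ, k ζ) / q with hK
  have hK0 : 0 ≤ K := by
    have : 0 ≤ ∫ ζ, k ζ := integral_nonneg hk0
    positivity
  have htest : ∀ {W : Heis N → ℝ}, Continuous W → HasCompactSupport W → (∀ ξ, ξ ∉ Ω → W ξ = 0) →
      ∫ ξ, negLap Ω R ξ * W ξ =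
        a * (∫ ξ, U ξ * W ξ) + ∫ ξ, V ξ * (spow (q - 1) (U ξ) * W ξ) := by
    intro W hW hWc hW0
    have i1 : Integrable fun ξ => U ξ * W ξ :=
      (S.cont.mul hW).integrable_of_hasCompactSupport hWc.mul_left
    have i2 : Integrable fun ξ => V ξ * (spow (q - 1) (U ξ) * W ξ) :=
      integrable_kernelPot_mul hkm hk hp hpc (((continuous_spow hq1).comp S.cont).mul hW) hWc.mul_left
    rw [← integral_const_mul, ← integral_add (i1.const_mul a) i2]
    congr 1; funext ξ
    by_cases hξ : ξ ∈ Ω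
    · rw [heq ξ hξ]; ring
    · simp [hW0 ξ hξ]
  have hAeq : A = a * B + C := by
    rw [hA, ← S.integral_negLap_mul_self, htest S.cont S.supp S.zero]
    simp only [spow_sub_one_mul_self hq, ← sq]
    rfl
  -- `G` is the upper bound for the gradient term minus the lower bounds for the linear and nonlocal
  -- terms, without the error `K I`. Testing with the dilate therefore gives `G θ ≥ -K I`.
  set G : ℝ → ℝ := fun θ => 1 / 2 * (1 + θ ^ (2 - homDim N)) * A -
    a / 2 * (1 + θ ^ (-homDim N)) * B - C -
    1 / (2 * q) * (θ ^ (lam - 2 * homDim N) - 1) * C with hG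
  have hG1 : G 1 = 0 := by
    simp only [hG, Real.one_rpow]
    rw [hAeq]; ring
  have hpowd : ∀ s : ℝ, HasDerivAt (fun θ : ℝ => θ ^ s) s 1 := fun s =>
    (Real.hasDerivAt_rpow_const (p := s) (Or.inl one_ne_zero)).congr_deriv (by simp)
  have hG' : HasDerivAt G (a * B) 1 := by
    have h1 := (((hpowd (2 - homDim N)).const_add 1).const_mul (1 / 2)).mul_const A
    have h2 := (((hpowd (-homDim N)).const_add 1).const_mul (a / 2)).mul_const B
    have h3 := (((hpowd (lam - 2 * homDim N)).sub_const 1).const_mul (1 / (2 * q))).mul_const C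
    refine (((h1.sub h2).sub_const C).sub h3).congr_deriv ?_
    rw [hAeq]
    -- Criticality of the exponent: the contributions of `C` to the derivative cancel, and only `a
    -- B` is left.
    have : lam - 2 * homDim N = -(q * (homDim N - 2)) := by linarith
    rw [this]
    field_simp
    ring
  refine deriv_nonneg_of_eventually_ge hG' hG1 fun ε hε => ?_
  obtain ⟨θ₀, hθ₀, H⟩ := S.exists_spow_incr_le hN hq (ε := ε / (K + 1)) (by positivity)
  refine ⟨θ₀, hθ₀, fun θ h1 h2 => ?_⟩
  have hθ : 0 < θ := by linarith
  have hUθ : Continuous fun ξ => U (dil θ ξ) := S.cont.comp (by fun_prop)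
  have hUθc : HasCompactSupport fun ξ => U (dil θ ξ) := S.supp.comp_homeomorph (dilHomeo θ hθ)
  have hupper := S.integral_negLap_dil_le hθ (hdil θ h1)
  rw [htest hUθ hUθc fun ξ hξ => S.zero _ fun h => hξ (hdil θ h1 ξ h)] at hupper
  have hlower := kernelPot_spow_mixed_ge hkm hk hk0 hsymm S.cont S.supp hUθ hUθc hq hM
    fun ξ => hM (dil θ ξ)
  rw [hscale θ h1] at hlower
  have hI := H θ h1 h2
  set I := ∫ ξ, (spow (q / 2) (U (dil θ ξ)) - spow (q / 2) (U ξ)) ^ 2 with hIdef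
  set E := ∫ ξ, V ξ * (spow (q - 1) (U ξ) * U (dil θ ξ)) with hE
  have hnat : (θ ^ (2 * N + 2))⁻¹ = θ ^ (-homDim N) := by
    rw [Real.rpow_neg hθ.le, ← Real.rpow_natCast]
    congr 2; simp [homDim]
  have hnat2 : θ ^ 2 * (θ ^ (2 * N + 2))⁻¹ = θ ^ (2 - homDim N) := by
    rw [hnat, sub_eq_add_neg, Real.rpow_add hθ]
    norm_num
  rw [hnat2] at hupper
  have hcross : ∫ ξ, U ξ * U (dil θ ξ) ≤ 1 / 2 * (1 + θ ^ (-homDim N)) * B := by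
    have hs : Continuous fun ξ => U ξ ^ 2 := S.cont.pow 2
    have i1 : Integrable fun ξ => U ξ ^ 2 := hs.integrable_of_hasCompactSupport
      (HasCompactSupport.intro S.supp fun ξ hξ => by
        rw [image_eq_zero_of_notMem_tsupport hξ]; norm_num)
    have i2 : Integrable fun ξ => U (dil θ ξ) ^ 2 := by
      have hs : Continuous fun ξ => U (dil θ ξ) ^ 2 := hUθ.pow 2
      exact hs.integrable_of_hasCompactSupport (HasCompactSupport.intro hUθc fun ξ hξ => by
        rw [image_eq_zero_of_notMem_tsupport (f := fun ξ => U (dil θ ξ)) hξ]; norm_num)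
    have i3 : Integrable fun ξ => U ξ * U (dil θ ξ) :=
      (S.cont.mul hUθ).integrable_of_hasCompactSupport hUθc.mul_left
    have h := integral_mono i3 ((i1.const_mul (1 / 2)).add (i2.const_mul (1 / 2))) (fun ξ => by
      simp only [Pi.add_apply]
      nlinarith [sq_nonneg (U ξ - U (dil θ ξ))])
    refine h.trans_eq ?_
    change ∫ ξ, (1 / 2 * U ξ ^ 2 + 1 / 2 * U (dil θ ξ) ^ 2) = _
    rw [integral_add (i1.const_mul _) (i2.const_mul _), integral_const_mul, integral_const_mul,
      integral_dil θ hθ fun ξ => U ξ ^ 2, hnat]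
    ring
  have hcross' := mul_le_mul_of_nonpos_left hcross ha.le
  have hElow : C + 1 / (2 * q) * (θ ^ (lam - 2 * homDim N) - 1) * C - K * I ≤ E := by
    refine le_of_mul_le_mul_left ?_ hq0
    refine le_trans (le_of_eq ?_) hlower
    rw [hK]
    field_simp
    ring
  have hKI : K * I ≤ ε * (θ - 1) := by
    have h3 : 0 ≤ ε / (K + 1) * (θ - 1) := by
      have : 0 ≤ θ - 1 := by linarith
      positivity
    calc K * I ≤ K * (ε / (K + 1) * (θ - 1)) := by gcongr
      _ ≤ (K + 1) * (ε / (K + 1) * (θ - 1)) := by gcongr; linarith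
      _ = _ := by field_simp
  simp only [hG]
  linarith

end Pohozaev

/-! ### Application to the Choquard equation. -/

section Solutions

theorem rieszKernel_indicator_of_norm_le {lam r : ℝ} {ξ η : Heis N} (hξ : ‖ξ‖ ≤ r)
    (hη : ‖η‖ ≤ r) :
    (Metric.closedBall (0 : Heis N) (2 * r + 2 * r ^ 2)).indicator (rieszKernel lam)
      (hmul (hinv η) ξ) = rieszKernel lam (hmul (hinv η) ξ) := by
  refine Set.indicator_of_mem (mem_closedBall_zero_iff.mpr ?_) _
  refine (norm_hmul_le _ _).trans ?_
  rw [norm_hinv]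
  have h0 := norm_nonneg ξ
  have h1 := norm_nonneg η
  nlinarith [mul_le_mul hη hξ h0 (h1.trans hη)]

/-- The truncated kernel is integrable but not homogeneous. On densities supported in the ball of
radius `r` the truncation is invisible, so the scaling law of the full kernel can still be used. -/
theorem integral_kernelPot_rieszKernel_indicator {lam r : ℝ} {p : Heis N → ℝ}
    (hp : ∀ ξ, p ξ ≠ 0 → ‖ξ‖ ≤ r) :
    ∫ ξ, kernelPot ((Metric.closedBall (0 : Heis N) (2 * r + 2 * r ^ 2)).indicator
      (rieszKernel lam)) p ξ * p ξ =
      ∫ ξ, ∫ η, p η * p ξ * rieszKernel lam (hmul (hinv η) ξ) := by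
  rw [integral_kernelPot_mul]
  congr 1; funext ξ; congr 1; funext η
  by_cases h1 : p η = 0
  · simp [h1]
  by_cases h2 : p ξ = 0
  · simp [h2]
  rw [rieszKernel_indicator_of_norm_le (hp ξ h2) (hp η h1)]

theorem choquardPotential_eq_kernelPot {lam r : ℝ} {Ω : Set (Heis N)} (hΩ : MeasurableSet Ω)
    (hr : ∀ ξ ∈ Ω, ‖ξ‖ ≤ r) (hq : critExp N lam ≠ 0) (u : Heis N → ℝ) {ξ : Heis N} (hξ : ξ ∈ Ω) :
    choquardPotential lam Ω u ξ =
      kernelPot ((Metric.closedBall (0 : Heis N) (2 * r + 2 * r ^ 2)).indicator (rieszKernel lam))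
        (fun η => |Ω.indicator u η| ^ critExp N lam) ξ := by
  rw [choquardPotential, kernelPot, ← integral_indicator hΩ]
  congr 1; funext η
  by_cases hη : η ∈ Ω
  · rw [Set.indicator_of_mem hη, Set.indicator_of_mem hη,
      rieszKernel_indicator_of_norm_le (hr ξ hξ) (hr η hη), rieszKernel, div_eq_mul_inv]
  · rw [Set.indicator_of_notMem hη, Set.indicator_of_notMem hη, abs_zero, Real.zero_rpow hq,
      zero_mul]

theorem ContinuousUpTo.continuousOn {Ω : Set (Heis N)} {g : Heis N → ℝ}
    (h : ContinuousUpTo Ω g) : ContinuousOn g Ω := by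
  obtain ⟨G, hG, hGg⟩ := h
  exact (hG.mono subset_closure).congr hGg.symm

theorem ContinuousUpTo.exists_abs_le {Ω : Set (Heis N)} (hbdd : Bornology.IsBounded Ω)
    {g : Heis N → ℝ} (h : ContinuousUpTo Ω g) : ∃ M, ∀ ξ ∈ Ω, |g ξ| ≤ M := by
  obtain ⟨G, hG, hGg⟩ := h
  obtain ⟨M, hM⟩ := hbdd.isCompact_closure.exists_bound_of_continuousOn hG
  exact ⟨M, fun ξ hξ => by rw [← hGg hξ]; exact hM ξ (subset_closure hξ)⟩

theorem kohnLaplacian_eq_sum (u : Heis N → ℝ) (ξ : Heis N) :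
    kohnLaplacian u ξ = ∑ i, along (hField i) (along (hField i) u) ξ := by
  rw [kohnLaplacian, Finset.sum_add_distrib, Fintype.sum_sum_type]
  rfl

theorem GammaTwo.twiceDiffAlong {Ω : Set (Heis N)} {u : Heis N → ℝ} (hu : GammaTwo Ω u)
    (i : HDir N) : TwiceDiffAlong (hField i) Ω u := by
  rcases i with j | j
  · exact (hu.2 j).1
  · exact (hu.2 j).2

theorem GammaTwo.horizontalC2On {Ω : Set (Heis N)} {u : Heis N → ℝ} (hu : GammaTwo Ω u)
    (hopen : IsOpen Ω) (hbdd : Bornology.IsBounded Ω) (h0 : ∀ ξ ∈ frontier Ω, u ξ = 0) :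
    HorizontalC2On Ω (Ω.indicator u) (fun i => along (hField i) u)
      fun i => along (hField i) (along (hField i) u) where
  isOpen := hopen
  bdd := hbdd
  cont := continuous_indicator h0 hu.1
  zero _ hξ := Set.indicator_of_notMem hξ _
  pcont i := (hu.twiceDiffAlong i).2.2.1.continuousOn
  rcont i := (hu.twiceDiffAlong i).2.2.2.continuousOn
  hasDeriv i ξ hξ := by
    refine ((hu.twiceDiffAlong i).1 ξ hξ).hasLineDerivAt.congr_of_eventuallyEq ?_
    filter_upwards [hopen.mem_nhds hξ] with η hη
    exact Set.indicator_of_mem hη _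
  hasDeriv₂ i ξ hξ := ((hu.twiceDiffAlong i).2.1 ξ hξ).hasLineDerivAt
  pbound i := (hu.twiceDiffAlong i).2.2.1.exists_abs_le hbdd
  rbound i := (hu.twiceDiffAlong i).2.2.2.exists_abs_le hbdd

/-- A solution of the Choquard equation with negative linear part vanishes on every bounded domain
that is strictly star-shaped for the dilations. -/
theorem IsSolution.eq_zero (hN : 1 ≤ N) {lam : ℝ} (hlam0 : 0 < lam) (hlamQ : lam < homDim N)
    {a : ℝ} (ha : a < 0) {Ω : Set (Heis N)} (hopen : IsOpen Ω) (hbdd : Bornology.IsBounded Ω)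
    (hC2 : HasC2Boundary Ω) (hstar : StrictlyStarShaped Ω) {u : Heis N → ℝ} (hu : GammaTwo Ω u)
    (hsol : IsSolution a lam Ω u) : ∀ ξ ∈ closure Ω, u ξ = 0 := by
  obtain ⟨heq, hzero⟩ := hsol
  have S := hu.horizontalC2On hopen hbdd hzero
  set U := Ω.indicator u with hU
  have hN' : (1 : ℝ) ≤ N := by exact_mod_cast hN
  have hQ2 : 0 < homDim N - 2 := by rw [homDim]; linarith
  set q := critExp N lam with hq
  have hqQ : q * (homDim N - 2) = 2 * homDim N - lam := div_mul_cancel₀ _ hQ2.ne'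
  have hq1 : 1 < q := by
    rw [hq, critExp, lt_div_iff₀ hQ2]
    linarith
  obtain ⟨r, hr0, hr⟩ : ∃ r : ℝ, 0 ≤ r ∧ ∀ ξ ∈ Ω, ‖ξ‖ ≤ r := by
    obtain ⟨r, hr⟩ := hbdd.exists_norm_le
    exact ⟨max r 0, le_max_right _ _, fun ξ hξ => (hr ξ hξ).trans (le_max_left _ _)⟩
  -- The radius bounds `‖η⁻¹ ξ‖` for `‖ξ‖, ‖η‖ ≤ r`, the term `2 r²` coming from the bracket in the
  -- group law.
  set k := (Metric.closedBall (0 : Heis N) (2 * r + 2 * r ^ 2)).indicator (rieszKernel lam) with hk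
  have hdil : ∀ θ, 1 < θ → ∀ ξ, dil θ ξ ∈ Ω → ξ ∈ Ω := by
    intro θ hθ ξ hξ
    have h0 : 0 < θ := by linarith
    have h := hstar.dil_mem hopen hC2 hξ (inv_pos.mpr h0) (inv_le_one_of_one_le₀ hθ.le)
    rwa [dil_dil, inv_mul_cancel₀ h0.ne', dil_one] at h
  have hmem : ∀ ξ, |U ξ| ^ q ≠ 0 → ξ ∈ Ω := fun ξ h => S.mem fun h0 => h (by
    rw [h0, abs_zero, Real.zero_rpow (by linarith)])
  have hB := S.pohozaev hN hdil (k := k) (q := q) (lam := lam) (a := a)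
    ((measurable_rieszKernel lam).indicator measurableSet_closedBall)
    (integrable_rieszKernel_indicator hlam0 hlamQ (by positivity))
    (Set.indicator_nonneg fun ζ _ => rieszKernel_nonneg lam ζ)
    (fun ζ => by
      simp only [hk, Set.indicator, mem_closedBall_zero_iff, norm_hinv, rieszKernel_hinv])
    hq1 hqQ ha (fun ξ hξ => by
      have h := heq ξ hξ
      rw [kohnLaplacian_eq_sum, choquardPotential_eq_kernelPot hopen.measurableSet hr
        (by linarith) u hξ] at h
      simp only [negLap, hU, Set.indicator_of_mem hξ, spow]
      rw [h, show q - 1 - 1 = q - 2 by ring])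
    (fun θ hθ => by
      have h1 : ∀ ξ, |U (dil θ ξ)| ^ q ≠ 0 → ‖ξ‖ ≤ r := fun ξ h => hr ξ (hdil θ hθ ξ (hmem _ h))
      rw [integral_kernelPot_rieszKernel_indicator h1,
        integral_kernelPot_rieszKernel_indicator fun ξ h => hr ξ (hmem ξ h),
        rieszEnergy_dil (by linarith) fun ξ => |U ξ| ^ q])
  have hsq : Continuous fun ξ => U ξ ^ 2 := S.cont.pow 2
  have hi : Integrable fun ξ => U ξ ^ 2 := hsq.integrable_of_hasCompactSupport
    (HasCompactSupport.intro S.supp fun ξ hξ => by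
      rw [image_eq_zero_of_notMem_tsupport hξ]; norm_num)
  have hint : ∫ ξ, U ξ ^ 2 = 0 := le_antisymm
    (nonpos_of_mul_nonneg_right hB ha) (integral_nonneg fun _ => sq_nonneg _)
  have hU0 : (fun ξ => U ξ ^ 2) = 0 :=
    (hsq.ae_eq_iff_eq volume continuous_const).mp
      ((integral_eq_zero_iff_of_nonneg (fun _ => sq_nonneg _) hi).mp hint)
  intro ξ hξ
  by_cases h : ξ ∈ Ω
  · have := pow_eq_zero_iff (two_ne_zero) |>.mp (congrFun hU0 ξ)
    rwa [hU, Set.indicator_of_mem h] at this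
  · exact hzero ξ ⟨hξ, fun hin => h (interior_subset hin)⟩

end Solutions

end HeisChoquard

theorem theorem1p2 (N : ℕ) (hN : 1 ≤ N) (lam : ℝ) (hlam0 : 0 < lam)
    (hlamQ : lam < HeisChoquard.homDim N) (a : ℝ) (ha : a < 0)
    (Ω : Set (HeisChoquard.Heis N)) (hopen : IsOpen Ω) (hconn : IsConnected Ω)
    (hbdd : Bornology.IsBounded Ω) (hC2 : HeisChoquard.HasC2Boundary Ω)
    (hstar : HeisChoquard.StrictlyStarShaped Ω)
    (u : HeisChoquard.Heis N → ℝ) (hu : HeisChoquard.GammaTwo Ω u)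
    (hsol : HeisChoquard.IsSolution a lam Ω u) :
    ∀ ξ ∈ closure Ω, u ξ = 0 :=
  hsol.eq_zero hN hlam0 hlamQ ha hopen hbdd hC2 hstar hu
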